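/- Let $\{E_G^*\}_G$ be a family of $\mathbb{Z}$-graded equivariant cohomology theories, indexed by the compact Lie groups $G$, with restriction maps: for every $G$, $E_G^*$ is a contravariant functor on pairs $(X,A)$ of $G$-spaces (with $E_G^*(X)=E_G^*(X,\emptyset)$) which is $G$-homotopy invariant and has long exact sequences of pairs and excision, and every continuous homomorphism $\varphi:H\to G$ induces maps $\varphi^*:E_G^*(Y,B)\to E_H^*(\varphi^*Y,\varphi^*B)$, where $\varphi^*Y$ is $Y$ with $H$ acting through $\varphi$; these are functorial in $\varphi$, natural in $(Y,B)$ and compatible with the connecting maps. The family has *change-of-group isomorphisms* if for every compact Lie group $G$, every closed subgroup $H\le G$ and every $H$-space $X$ the composite $$E_G^*(G\times_H X)\longrightarrow E_H^*(G\times_H X)\longrightarrow E_H^*(X)$$ of restriction along the inclusion $H\to G$ and pullback along $i:X\to G\times_H X$, $i(x)=[e,x]$, is an isomorphism. Let $n$ be a positive integer. For a compact Lie group $G$ let $G^n_z$ be a set of representatives, under simultaneous conjugation by $G$, of the $n$-tuples $\sigma=(\sigma_1,\dots,\sigma_n)$ of pairwise commuting torsion elements of $G$. For such $\sigma$ put $C_G(\sigma)=\bigcap_i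 C_G(\sigma_i)$, $$\Lambda_G(\sigma)=C_G(\sigma)\times\mathbb{R}^n/\langle(\sigma_1,-e_1),\dots,(\sigma_n,-e_n)\rangle ,$$ and for a $G$-space $X$ let $\Lambda_G(\sigma)$ act on $X^\sigma=\bigcap_i X^{\sigma_i}$ by $[a,t]\cdot x=a x$. The quasi-theory is $$QE^*_{n,G}(X)=\prod_{\sigma\in G^n_z}E^*_{\Lambda_G(\sigma)}(X^\sigma)$$ (the product is taken in each degree). Let $H\le G$ be a closed subgroup of a compact Lie group, with inclusion $\varphi:H\to G$, and let $X$ be an $H$-space. For every $\tau\in H^n_z$ let $\sigma_\tau\in G^n_z$ be the representative of the $G$-conjugacy class of $\tau$ and choose $g_\tau\in G$ with $\tau=g_\tau\sigma_\tau g_\tau^{-1}$. For a $G$-space $Y$ let $\varphi^*:QE^*_{n,G}(Y)\to QE^*_{n,H}(Y)$ be the map whose $\tau$-component is the projection to the factor of $\sigma_\tau$ followed by the map $E^*_{\Lambda_G(\sigma_\tau)}(Y^{\sigma_\tau})\to E^*_{\Lambda_H(\tau)}(Y^\tau)$ induced by the homomorphism $\Lambda_H(\tau)\to\Lambda_G(\sigma_\tau)$,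 $[u,t]\mapsto[g_\tau^{-1}ug_\tau,t]$, and the map $Y^\tau\to Y^{\sigma_\tau}$, $y\mapsto g_\tau^{-1}y$. Let $i^*:QE^*_{n,H}(G\times_H X)\to QE^*_{n,H}(X)$ be induced by the $H$-map $i(x)=[e,x]$. **Proposition.** If $\{E_G^*\}_G$ has change-of-group isomorphisms, then for all choices of $G^n_z$, $H^n_z$ and $(g_\tau)_\tau$ the change-of-group map $$\rho^G_H=i^*\circ\varphi^*:QE^*_{n,G}(G\times_H X)\longrightarrow QE^*_{n,H}(X)$$ is an isomorphism of graded abelian groups. If the groups $E_G^*(X)$ carry graded ring structures that are preserved by all induced maps and restriction maps, then $\rho^G_H$ is an isomorphism of graded rings, for the componentwise products. -/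

import Mathlib

open scoped Manifold ContDiff

universe u v

/-! ## Compact Lie groups, `G`-spaces and pairs of `G`-spaces -/

/-- A compact Lie group: a compact Hausdorff topological group whose topology is that of a
finite-dimensional smooth manifold with smooth multiplication and inversion. Dimension `0`
(finite groups) is allowed. -/
class IsCompactLieGroup (G : Type u) [Group G] [TopologicalSpace G] : Prop
    extends IsTopologicalGroup G, CompactSpace G, T2Space G where
  exists_lieGroup : ∃ (d : ℕ) (_ : ChartedSpace (EuclideanSpace ℝ (Fin d)) G), LieGroup (𝓡 d) ∞ G

/-- A (left) `G`-space: a topological space with a jointly continuous action of `G`. -/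
structure GSpace (G : Type u) [Group G] [TopologicalSpace G] where
  carrier : Type u
  [topologicalSpace : TopologicalSpace carrier]
  [mulAction : MulAction G carrier]
  [continuousSMul : ContinuousSMul G carrier]

attribute [instance] GSpace.topologicalSpace GSpace.mulAction GSpace.continuousSMul

instance (G : Type u) [Group G] [TopologicalSpace G] : CoeSort (GSpace G) (Type u) :=
  ⟨GSpace.carrier⟩

/-- A pair `(X, A)` consisting of a `G`-space `X` and a `G`-invariant subspace `A`. -/
structure GPair (G : Type u) [Group G] [TopologicalSpace G] where
  space : GSpace G
  sub : Set space
  smul_mem : ∀ (g : G) (x : space), x ∈ sub → g • x ∈ sub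

/-- The pair `(X, ∅)`. -/
def GSpace.toPair {G : Type u} [Group G] [TopologicalSpace G] (X : GSpace G) : GPair G where
  space := X
  sub := ∅
  smul_mem := fun _ _ h => h

/-- An invariant subset of a `G`-space, as a `G`-space. -/
def GSpace.subspace {G : Type u} [Group G] [TopologicalSpace G] (X : GSpace G) (A : Set X)
    (hA : ∀ (g : G) (x : X), x ∈ A → g • x ∈ A) : GSpace G :=
  letI : MulAction G A :=
    { smul := fun g x => ⟨g • x.1, hA g x.1 x.2⟩
      one_smul := fun x => Subtype.ext (one_smul G x.1)
      mul_smul := fun g h x => Subtype.ext (mul_smul g h x.1) }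
  haveI : ContinuousSMul G A :=
    ⟨(continuous_fst.smul (continuous_subtype_val.comp continuous_snd)).subtype_mk _⟩
  { carrier := A }

/-- The subspace `A` of the pair `(X, A)`, as a `G`-space. -/
def GPair.subSpace {G : Type u} [Group G] [TopologicalSpace G] (P : GPair G) : GSpace G :=
  P.space.subspace P.sub P.smul_mem

/-- For `φ : H → G`, the `H`-space `φ^*Y` that a `G`-space `Y` becomes through `φ`. -/
def GSpace.res {H G : Type u} [Group H] [TopologicalSpace H] [Group G] [TopologicalSpace G]
    (φ : H →ₜ* G) (Y : GSpace G) : GSpace H :=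
  letI : MulAction H Y := MulAction.compHom Y φ.toMonoidHom
  haveI : ContinuousSMul H Y :=
    ⟨((map_continuous φ).comp continuous_fst).smul continuous_snd⟩
  { carrier := Y }

/-- A map `(X, A) → (Y, B)` from a pair of `H`-spaces to a pair of `G`-spaces over a continuous
homomorphism `φ : H → G`: a continuous map `f : X → Y` with `f (h x) = φ(h) f(x)` and
`f(A) ⊆ B`. In other words, a map of `H`-pairs `(X, A) → φ^*(Y, B)`. -/
structure PairMap {H G : Type u} [Group H] [TopologicalSpace H] [Group G] [TopologicalSpace G]
    (φ : H →ₜ* G) (P : GPair H) (Q : GPair G) where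
  toMap : C(P.space, Q.space)
  map_smul : ∀ (h : H) (x : P.space), toMap (h • x) = φ h • toMap x
  map_sub : ∀ x ∈ P.sub, toMap x ∈ Q.sub

namespace PairMap

variable {K H G : Type u} [Group K] [TopologicalSpace K] [Group H] [TopologicalSpace H]
  [Group G] [TopologicalSpace G]

/-- The identity of a pair. -/
def id (P : GPair G) : PairMap (ContinuousMonoidHom.id G) P P where
  toMap := ContinuousMap.id _
  map_smul := fun _ _ => rfl
  map_sub := fun _ h => h

/-- Composition of maps of pairs over composable homomorphisms. -/
def comp {φ : H →ₜ* G} {ψ : K →ₜ* H} {P : GPair K} {Q : GPair H} {R : GPair G}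
    (f : PairMap φ Q R) (g : PairMap ψ P Q) : PairMap (φ.comp ψ) P R where
  toMap := f.toMap.comp g.toMap
  map_smul := fun k x => by
    change f.toMap (g.toMap (k • x)) = φ (ψ k) • f.toMap (g.toMap x)
    rw [g.map_smul, f.map_smul]
  map_sub := fun x hx => f.map_sub _ (g.map_sub x hx)

/-- An equivariant map of spaces, as a map of the pairs with empty subspaces. -/
def ofMap {φ : H →ₜ* G} {X : GSpace H} {Y : GSpace G} (f : C(X, Y))
    (hf : ∀ (h : H) (x : X), f (h • x) = φ h • f x) : PairMap φ X.toPair Y.toPair where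
  toMap := f
  map_smul := hf
  map_sub := fun _ h => h.elim

/-- The map `φ^*Y → Y` over `φ` whose underlying map is the identity. -/
def ofRes (φ : H →ₜ* G) (Y : GSpace G) : PairMap φ (Y.res φ).toPair Y.toPair :=
  ofMap (X := Y.res φ) (ContinuousMap.id Y) (fun _ _ => rfl)

/-- The restriction `A → B` of a map of pairs `(X, A) → (Y, B)`. -/
def onSub {φ : H →ₜ* G} {P : GPair H} {Q : GPair G} (f : PairMap φ P Q) :
    PairMap φ P.subSpace.toPair Q.subSpace.toPair :=
  ofMap (X := P.subSpace) (Y := Q.subSpace)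
    ⟨fun x : P.sub => (⟨f.toMap x.1, f.map_sub x.1 x.2⟩ : Q.sub),
      (f.toMap.continuous.comp continuous_subtype_val).subtype_mk _⟩
    (fun h x => Subtype.ext (f.map_smul h x.1))

/-- The inclusion `(A, ∅) → (X, ∅)`. -/
def subIncl (P : GPair G) :
    PairMap (ContinuousMonoidHom.id G) P.subSpace.toPair P.space.toPair :=
  ofMap (X := P.subSpace) ⟨fun x : P.sub => x.1, continuous_subtype_val⟩ (fun _ _ => rfl)

/-- The inclusion `(X, ∅) → (X, A)`. -/
def toRel (P : GPair G) : PairMap (ContinuousMonoidHom.id G) P.space.toPair P where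
  toMap := ContinuousMap.id _
  map_smul := fun _ _ => rfl
  map_sub := fun _ h => h.elim

/-- Two maps of `G`-pairs are `G`-homotopic if they are joined by a homotopy through maps of
`G`-pairs. -/
def Homotopic {P Q : GPair G} (f₀ f₁ : PairMap (ContinuousMonoidHom.id G) P Q) : Prop :=
  ∃ F : C(P.space × unitInterval, Q.space),
    (∀ x, F (x, 0) = f₀.toMap x) ∧ (∀ x, F (x, 1) = f₁.toMap x) ∧
    (∀ (g : G) x t, F (g • x, t) = g • F (x, t)) ∧ (∀ x t, x ∈ P.sub → F (x, t) ∈ Q.sub)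

end PairMap

/-- The pair `(X ∖ U, A ∖ U)` for an invariant subset `U` of `X`. -/
def GPair.excise {G : Type u} [Group G] [TopologicalSpace G] (P : GPair G) (U : Set P.space)
    (hU : ∀ (g : G) (x : P.space), x ∈ U → g • x ∈ U) : GPair G where
  space := P.space.subspace Uᶜ
    (fun g x hx hgx => hx (by simpa only [inv_smul_smul] using hU g⁻¹ (g • x) hgx))
  sub := {x : (Uᶜ : Set P.space) | x.1 ∈ P.sub}
  smul_mem := fun g (x : (Uᶜ : Set P.space)) hx => P.smul_mem g x.1 hx

/-- The inclusion `(X ∖ U, A ∖ U) → (X, A)`. -/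
def PairMap.exciseIncl {G : Type u} [Group G] [TopologicalSpace G] (P : GPair G)
    (U : Set P.space) (hU : ∀ (g : G) (x : P.space), x ∈ U → g • x ∈ U) :
    PairMap (ContinuousMonoidHom.id G) (P.excise U hU) P where
  toMap := ⟨fun x : (Uᶜ : Set P.space) => x.1, continuous_subtype_val⟩
  map_smul := fun _ _ => rfl
  map_sub := fun _ h => h

/-! ## Equivariant cohomology theories with restriction maps -/

/-- A family `{E_G^*}_G` of `ℤ`-graded equivariant cohomology theories, one for each compact Lie
group `G`, with restriction maps along continuous homomorphisms.

The maps induced by `G`-maps and the restriction maps `φ^* : E_G^*(Y) → E_H^*(φ^*Y)` are given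
together: the group `E_G^*(Y, B)` is contravariantly functorial for the maps
`(X, A) → (Y, B)` over homomorphisms `φ : H → G`. The map over an identity homomorphism is the
map induced by a `G`-map, and the map over `φ` with underlying map `id : φ^*Y → Y` is the
restriction map.

The axioms (functoriality, homotopy invariance, long exact sequences, excision) are imposed at the
compact Lie groups only. The data are written for all groups with a topology, so that one may
write `E_K^*` for a group `K` before it is known to be a compact Lie group; the values at other
groups are arbitrary and irrelevant.

Excision is asked for only if `U` and the complement of `A` are separated by an invariant
continuous function; this is weaker than excision for all `U` with `closure U ⊆ interior A`.
No additivity for infinite disjoint unions is asked for. -/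
structure EquivariantCohomologyTheory where
  obj : ∀ {G : Type u} [Group G] [TopologicalSpace G], GPair G → ℤ → Type v
  [addCommGroup : ∀ {G : Type u} [Group G] [TopologicalSpace G] (P : GPair G) (k : ℤ),
    AddCommGroup (obj P k)]
  map : ∀ {H G : Type u} [Group H] [TopologicalSpace H] [Group G] [TopologicalSpace G]
    {φ : H →ₜ* G} {P : GPair H} {Q : GPair G} (_ : PairMap φ P Q) (k : ℤ), obj Q k →+ obj P k
  /-- The connecting homomorphism `E_G^k(A) → E_G^{k+1}(X, A)`. -/
  δ : ∀ {G : Type u} [Group G] [TopologicalSpace G] (P : GPair G) (k : ℤ),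
    obj P.subSpace.toPair k →+ obj P (k + 1)
  map_id : ∀ {G : Type u} [Group G] [TopologicalSpace G] [IsCompactLieGroup G] (P : GPair G)
    (k : ℤ) (a : obj P k), map (PairMap.id P) k a = a
  map_comp : ∀ {K H G : Type u} [Group K] [TopologicalSpace K] [IsCompactLieGroup K]
    [Group H] [TopologicalSpace H] [IsCompactLieGroup H]
    [Group G] [TopologicalSpace G] [IsCompactLieGroup G]
    {φ : H →ₜ* G} {ψ : K →ₜ* H} {P : GPair K} {Q : GPair H} {R : GPair G}
    (f : PairMap φ Q R) (g : PairMap ψ P Q) (k : ℤ) (a : obj R k),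
    map (f.comp g) k a = map g k (map f k a)
  map_δ : ∀ {H G : Type u} [Group H] [TopologicalSpace H] [IsCompactLieGroup H]
    [Group G] [TopologicalSpace G] [IsCompactLieGroup G]
    {φ : H →ₜ* G} {P : GPair H} {Q : GPair G} (f : PairMap φ P Q) (k : ℤ)
    (a : obj Q.subSpace.toPair k), map f (k + 1) (δ Q k a) = δ P k (map f.onSub k a)
  homotopy : ∀ {G : Type u} [Group G] [TopologicalSpace G] [IsCompactLieGroup G]
    {P Q : GPair G} (f₀ f₁ : PairMap (ContinuousMonoidHom.id G) P Q), f₀.Homotopic f₁ →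
    ∀ k, map f₀ k = map f₁ k
  exact_rel : ∀ {G : Type u} [Group G] [TopologicalSpace G] [IsCompactLieGroup G] (P : GPair G)
    (k : ℤ), Function.Exact (δ P k) (map (PairMap.toRel P) (k + 1))
  exact_space : ∀ {G : Type u} [Group G] [TopologicalSpace G] [IsCompactLieGroup G]
    (P : GPair G) (k : ℤ),
    Function.Exact (map (PairMap.toRel P) k) (map (PairMap.subIncl P) k)
  exact_sub : ∀ {G : Type u} [Group G] [TopologicalSpace G] [IsCompactLieGroup G] (P : GPair G)
    (k : ℤ), Function.Exact (map (PairMap.subIncl P) k) (δ P k)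
  excision : ∀ {G : Type u} [Group G] [TopologicalSpace G] [IsCompactLieGroup G] (P : GPair G)
    (U : Set P.space) (hU : ∀ (g : G) (x : P.space), x ∈ U → g • x ∈ U)
    (w : C(P.space, unitInterval)), (∀ (g : G) x, w (g • x) = w x) →
    (∀ x ∈ U, w x = 0) → (∀ x ∉ P.sub, w x = 1) →
    ∀ k, Function.Bijective (map (PairMap.exciseIncl P U hU) k)

attribute [instance] EquivariantCohomologyTheory.addCommGroup

/-! ## The balanced product `G ×_H X` -/

section Balanced

variable {G : Type u} [Group G] [TopologicalSpace G]

/-- The inclusion of a subgroup, as a continuous homomorphism. -/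
def subgroupIncl (H : Subgroup G) : H →ₜ* G := ⟨H.subtype, continuous_subtype_val⟩

/-- `(g, x) ∼ (g h⁻¹, h x)` on `G × X`, for `h ∈ H`. -/
def balancedSetoid (H : Subgroup G) (X : GSpace H) : Setoid (G × X) where
  r p q := ∃ h : H, q = (p.1 * (h : G)⁻¹, h • p.2)
  iseqv :=
    { refl := fun p => ⟨1, by simp⟩
      symm := by
        rintro p _ ⟨h, rfl⟩
        exact ⟨h⁻¹, by simp⟩
      trans := by
        rintro p _ _ ⟨h, rfl⟩ ⟨k, rfl⟩
        exact ⟨k * h, by simp [mul_assoc, mul_smul]⟩ }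

/-- The underlying space of `G ×_H X`, with the quotient topology. -/
abbrev BalancedProduct (H : Subgroup G) (X : GSpace H) : Type u := Quotient (balancedSetoid H X)

theorem isOpenQuotientMap_balanced [IsTopologicalGroup G] (H : Subgroup G) (X : GSpace H) :
    IsOpenQuotientMap (Quotient.mk (balancedSetoid H X)) := by
  refine ⟨Quotient.mk_surjective, continuous_quot_mk, fun U hU => ?_⟩
  have : Quotient.mk (balancedSetoid H X) ⁻¹' (Quotient.mk (balancedSetoid H X) '' U) =
      ⋃ h : H, (fun p : G × X => (p.1 * (h : G)⁻¹, h • p.2)) ⁻¹' U := by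
    ext p
    simp only [Set.mem_preimage, Set.mem_image, Set.mem_iUnion]
    constructor
    · rintro ⟨q, hq, hqp⟩
      obtain ⟨h, rfl⟩ : ∃ h : H, q = (p.1 * (h : G)⁻¹, h • p.2) := Quotient.exact hqp.symm
      exact ⟨h, hq⟩
    · rintro ⟨h, hh⟩
      have hr : balancedSetoid H X p (p.1 * (h : G)⁻¹, h • p.2) := ⟨h, rfl⟩
      exact ⟨_, hh, (Quotient.sound hr).symm⟩
  have hopen : IsOpen (Quotient.mk (balancedSetoid H X) ⁻¹'
      (Quotient.mk (balancedSetoid H X) '' U)) := by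
    rw [this]
    exact isOpen_iUnion fun h => hU.preimage
      ((continuous_fst.mul continuous_const).prodMk (continuous_snd.const_smul h))
  exact hopen

/-- The `G`-space `G ×_H X`, with `g' [g, x] = [g' g, x]`. -/
def GSpace.induced [IsTopologicalGroup G] (H : Subgroup G) (X : GSpace H) : GSpace G :=
  letI : MulAction G (BalancedProduct H X) :=
    { smul := fun g => Quotient.map (fun p => (g * p.1, p.2)) (by
        rintro p _ ⟨h, rfl⟩
        exact ⟨h, by simp [mul_assoc]⟩)
      one_smul := by
        rintro ⟨p⟩
        exact congrArg (Quotient.mk _) (by simp)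
      mul_smul := by
        rintro g g' ⟨p⟩
        exact congrArg (Quotient.mk _) (by simp [mul_assoc]) }
  haveI : ContinuousSMul G (BalancedProduct H X) := by
    constructor
    refine (IsOpenQuotientMap.id.prodMap
      (isOpenQuotientMap_balanced H X)).isQuotientMap.continuous_iff.2 ?_
    exact continuous_quot_mk.comp (f := fun p : G × (G × X) => (p.1 * p.2.1, p.2.2))
      ((continuous_fst.mul (continuous_fst.comp continuous_snd)).prodMk
        (continuous_snd.comp continuous_snd))
  { carrier := BalancedProduct H X }

/-- The `H`-equivariant map `i : X → G ×_H X`, `x ↦ [e, x]`. -/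
def inducedUnit [IsTopologicalGroup G] (H : Subgroup G) (X : GSpace H) :
    C(X, (X.induced H).res (subgroupIncl H)) :=
  ⟨fun x => (Quotient.mk (balancedSetoid H X) (1, x)),
    continuous_quot_mk.comp (continuous_const.prodMk continuous_id)⟩

theorem inducedUnit_smul [IsTopologicalGroup G] (H : Subgroup G) (X : GSpace H) (h : H) (x : X) :
    inducedUnit H X (h • x) = h • inducedUnit H X x := by
  have hr : balancedSetoid H X (1, h • x) ((h : G) * 1, x) := ⟨h⁻¹, by simp⟩
  exact Quotient.sound hr

end Balanced

namespace EquivariantCohomologyTheory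

variable (E : EquivariantCohomologyTheory.{u, v})

/-- `E_G^k(X) = E_G^k(X, ∅)`. -/
abbrev abs {G : Type u} [Group G] [TopologicalSpace G] (X : GSpace G) (k : ℤ) : Type v :=
  E.obj X.toPair k

/-- The map `f^* : E_G^k(Y) → E_G^k(X)` induced by a `G`-map `f : X → Y`. -/
def pullback {G : Type u} [Group G] [TopologicalSpace G] {X Y : GSpace G} (f : C(X, Y))
    (hf : ∀ (g : G) (x : X), f (g • x) = g • f x) (k : ℤ) : E.abs Y k →+ E.abs X k :=
  E.map (PairMap.ofMap (φ := ContinuousMonoidHom.id G) f hf) k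

/-- The restriction map `φ^* : E_G^k(Y) → E_H^k(φ^*Y)`. -/
def restrict {H G : Type u} [Group H] [TopologicalSpace H] [Group G] [TopologicalSpace G]
    (φ : H →ₜ* G) (Y : GSpace G) (k : ℤ) : E.abs Y k →+ E.abs (Y.res φ) k :=
  E.map (PairMap.ofRes φ Y) k

/-- The change-of-group map `E_G^k(G ×_H X) → E_H^k(G ×_H X) → E_H^k(X)` of the theory `E`. -/
def changeOfGroup {G : Type u} [Group G] [TopologicalSpace G] [IsTopologicalGroup G]
    (H : Subgroup G) (X : GSpace H) (k : ℤ) : E.abs (X.induced H) k →+ E.abs X k :=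
  (E.pullback (inducedUnit H X) (inducedUnit_smul H X) k).comp
    (E.restrict (subgroupIncl H) (X.induced H) k)

/-- The theory has change-of-group isomorphisms: `E_G^*(G ×_H X) ≅ E_H^*(X)` for every compact
Lie group `G`, closed subgroup `H` and `H`-space `X`. -/
def HasChangeOfGroup : Prop :=
  ∀ (G : Type u) [Group G] [TopologicalSpace G] [IsCompactLieGroup G] (H : Subgroup G),
    IsClosed (H : Set G) → ∀ (X : GSpace H) (k : ℤ), Function.Bijective (E.changeOfGroup H X k)

/-- A graded ring structure on the groups `E_G^*(X)` that is preserved by all induced maps and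
restriction maps. -/
structure RingStructure where
  one : ∀ {G : Type u} [Group G] [TopologicalSpace G] (X : GSpace G), E.abs X 0
  mul : ∀ {G : Type u} [Group G] [TopologicalSpace G] (X : GSpace G) {k l m : ℤ},
    k + l = m → E.abs X k →+ E.abs X l →+ E.abs X m
  one_mul : ∀ {G : Type u} [Group G] [TopologicalSpace G] [IsCompactLieGroup G] (X : GSpace G)
    {k : ℤ} (a : E.abs X k), mul X (zero_add k) (one X) a = a
  mul_one : ∀ {G : Type u} [Group G] [TopologicalSpace G] [IsCompactLieGroup G] (X : GSpace G)
    {k : ℤ} (a : E.abs X k), mul X (add_zero k) a (one X) = a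
  mul_assoc : ∀ {G : Type u} [Group G] [TopologicalSpace G] [IsCompactLieGroup G] (X : GSpace G)
    {k l m kl lm klm : ℤ} (h₁ : k + l = kl) (h₂ : l + m = lm) (h₃ : kl + m = klm)
    (h₄ : k + lm = klm) (a : E.abs X k) (b : E.abs X l) (c : E.abs X m),
    mul X h₃ (mul X h₁ a b) c = mul X h₄ a (mul X h₂ b c)
  map_one : ∀ {H G : Type u} [Group H] [TopologicalSpace H] [IsCompactLieGroup H]
    [Group G] [TopologicalSpace G] [IsCompactLieGroup G] {φ : H →ₜ* G} {X : GSpace H}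
    {Y : GSpace G} (f : PairMap φ X.toPair Y.toPair), E.map f 0 (one Y) = one X
  map_mul : ∀ {H G : Type u} [Group H] [TopologicalSpace H] [IsCompactLieGroup H]
    [Group G] [TopologicalSpace G] [IsCompactLieGroup G] {φ : H →ₜ* G} {X : GSpace H}
    {Y : GSpace G} (f : PairMap φ X.toPair Y.toPair) {k l m : ℤ} (h : k + l = m)
    (a : E.abs Y k) (b : E.abs Y l),
    E.map f m (mul Y h a b) = mul X h (E.map f k a) (E.map f l b)

end EquivariantCohomologyTheory

/-! ## The groups `Λ_G(σ)` and the fixed point spaces `X^σ` -/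

section Lambda

variable {G : Type u} [Group G] {n : ℕ}

/-- Commuting `n`-tuples of torsion elements. -/
def IsCommutingTorsion (σ : Fin n → G) : Prop :=
  (∀ i, IsOfFinOrder (σ i)) ∧ ∀ i j, Commute (σ i) (σ j)

/-- `S` is a set of representatives of the commuting `n`-tuples of torsion elements of `G` under
simultaneous conjugation by `G`. -/
structure IsConjugacyRepresentatives (S : Set (Fin n → G)) : Prop where
  isCommutingTorsion : ∀ σ ∈ S, IsCommutingTorsion σ
  existsUnique : ∀ τ : Fin n → G, IsCommutingTorsion τ →
    ∃! σ, σ ∈ S ∧ ∃ g : G, ∀ i, τ i = g * σ i * g⁻¹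

/-- The common centralizer `C_G(σ)` of the entries of `σ`. -/
abbrev centralizerOf (σ : Fin n → G) : Subgroup G := Subgroup.centralizer (Set.range σ)

/-- The subgroup `⟨(σ₁, -e₁), …, (σₙ, -eₙ)⟩` of `C_G(σ) × ℝⁿ`; each `σᵢ` is in `C_G(σ)` if `σ`
is a commuting tuple. -/
def lambdaRel (σ : Fin n → G) :
    Subgroup (centralizerOf σ × Multiplicative (Fin n → ℝ)) :=
  Subgroup.closure
    {p | ∃ i, (p.1 : G) = σ i ∧ p.2 = Multiplicative.ofAdd (-(Pi.single i 1 : Fin n → ℝ))}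

instance lambdaRel_normal (σ : Fin n → G) : (lambdaRel σ).Normal := by
  have hle : lambdaRel σ ≤ Subgroup.center _ := by
    refine (Subgroup.closure_le _).2 ?_
    rintro ⟨a, t⟩ ⟨i, ha, -⟩
    refine Subgroup.mem_center_iff.2 fun ⟨b, s⟩ => Prod.ext (Subtype.ext ?_) (mul_comm _ _)
    have hb := Subgroup.mem_centralizer_iff.1 b.2 (σ i) ⟨i, rfl⟩
    change (a : G) = σ i at ha
    change (b : G) * (a : G) = (a : G) * (b : G)
    rw [ha, hb]
  exact ⟨fun x hx y => by
    rw [Subgroup.mem_center_iff.1 (hle hx) y, mul_assoc, mul_inv_cancel, mul_one]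
    exact hx⟩

/-- `Λ_G(σ) = C_G(σ) × ℝⁿ / ⟨(σ₁, -e₁), …, (σₙ, -eₙ)⟩`, with the quotient topology. -/
abbrev LambdaGroup (σ : Fin n → G) : Type u :=
  (centralizerOf σ × Multiplicative (Fin n → ℝ)) ⧸ lambdaRel σ

variable [TopologicalSpace G]

/-- The fixed point set `X^σ = ⋂ᵢ X^{σᵢ}`. -/
abbrev fixedSet (σ : Fin n → G) (X : GSpace G) : Set X := {x | ∀ i, σ i • x = x}

/-- The action of `C_G(σ)` on `X^σ`, as a homomorphism to permutations. -/
def centralizerPerm (σ : Fin n → G) (X : GSpace G) :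
    centralizerOf σ →* Equiv.Perm (fixedSet σ X) where
  toFun a :=
    have key : ∀ (b : centralizerOf σ) (x : fixedSet σ X), (b : G) • x.1 ∈ fixedSet σ X := by
      intro b x i
      rw [← mul_smul, Subgroup.mem_centralizer_iff.1 b.2 (σ i) ⟨i, rfl⟩, mul_smul, x.2 i]
    { toFun := fun x => ⟨(a : G) • x.1, key a x⟩
      invFun := fun x => ⟨((a⁻¹ : centralizerOf σ) : G) • x.1, key a⁻¹ x⟩
      left_inv := fun x => Subtype.ext (by simp)
      right_inv := fun x => Subtype.ext (by simp) }
  map_one' := Equiv.ext fun x => Subtype.ext (by simp)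
  map_mul' := fun a b => Equiv.ext fun x => Subtype.ext (by simp [mul_smul])

/-- The action of `Λ_G(σ)` on `X^σ`, as a homomorphism to permutations: `[a, t] x = a x`. -/
def lambdaPerm (σ : Fin n → G) (X : GSpace G) : LambdaGroup σ →* Equiv.Perm (fixedSet σ X) :=
  QuotientGroup.lift (lambdaRel σ) ((centralizerPerm σ X).comp (MonoidHom.fst _ _)) (by
    refine (Subgroup.closure_le _).2 ?_
    rintro ⟨a, t⟩ ⟨i, ha, -⟩
    refine Equiv.ext fun x => Subtype.ext ?_
    change (a : G) = σ i at ha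
    change (a : G) • x.1 = x.1
    rw [ha]
    exact x.2 i)

/-- The `Λ_G(σ)`-space `X^σ`, with `[a, t] x = a x`. -/
def GSpace.fixed [IsTopologicalGroup G] (X : GSpace G) (σ : Fin n → G) :
    GSpace (LambdaGroup σ) :=
  letI : MulAction (LambdaGroup σ) (fixedSet σ X) :=
    MulAction.compHom (fixedSet σ X) (lambdaPerm σ X)
  haveI : ContinuousSMul (LambdaGroup σ) (fixedSet σ X) := by
    constructor
    refine ((QuotientGroup.isOpenQuotientMap_mk (N := lambdaRel σ)).prodMap
      IsOpenQuotientMap.id).isQuotientMap.continuous_iff.2 ?_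
    exact Continuous.subtype_mk (f := fun p :
        (centralizerOf σ × Multiplicative (Fin n → ℝ)) × fixedSet σ X => (p.1.1 : G) • p.2.1)
      ((continuous_subtype_val.comp (continuous_fst.comp continuous_fst)).smul
        (continuous_subtype_val.comp continuous_snd)) _
  { carrier := fixedSet σ X }

end Lambda

section LambdaMaps

variable {H G : Type u} [Group H] [TopologicalSpace H] [Group G] [TopologicalSpace G]
  [IsTopologicalGroup H] [IsTopologicalGroup G] {n : ℕ}

/-- If `φ(τ) = g σ g⁻¹`, the homomorphism `Λ_H(τ) → Λ_G(φ(τ)) ≅ Λ_G(σ)`,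
`[u, t] ↦ [g⁻¹ φ(u) g, t]`. -/
def lambdaHom (φ : H →ₜ* G) (τ : Fin n → H) (σ : Fin n → G) (g : G)
    (hg : ∀ i, φ (τ i) = g * σ i * g⁻¹) : LambdaGroup τ →ₜ* LambdaGroup σ :=
  have hmem : ∀ a : centralizerOf τ, g⁻¹ * φ a * g ∈ centralizerOf σ := by
    intro a
    refine Subgroup.mem_centralizer_iff.2 ?_
    rintro _ ⟨i, rfl⟩
    have h1 : φ (τ i) * φ a = φ a * φ (τ i) := by
      rw [← map_mul, ← map_mul, Subgroup.mem_centralizer_iff.1 a.2 (τ i) ⟨i, rfl⟩]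
    have h2 : σ i = g⁻¹ * φ (τ i) * g := by rw [hg]; group
    calc σ i * (g⁻¹ * φ a * g) = g⁻¹ * (φ (τ i) * φ a) * g := by rw [h2]; group
      _ = g⁻¹ * φ a * g * σ i := by rw [h1, h2]; group
  let f : centralizerOf τ × Multiplicative (Fin n → ℝ) →*
      centralizerOf σ × Multiplicative (Fin n → ℝ) :=
    { toFun := fun p => (⟨g⁻¹ * φ p.1 * g, hmem p.1⟩, p.2)
      map_one' := Prod.ext (Subtype.ext (by simp)) rfl
      map_mul' := fun p q => Prod.ext (Subtype.ext (by simp [mul_assoc])) rfl }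
  have hf : Continuous f :=
    (Continuous.subtype_mk ((continuous_const.mul ((map_continuous φ).comp
      (continuous_subtype_val.comp continuous_fst))).mul continuous_const) _).prodMk
      continuous_snd
  { toMonoidHom := QuotientGroup.map (lambdaRel τ) (lambdaRel σ) f (by
      refine (Subgroup.closure_le _).2 ?_
      rintro ⟨a, t⟩ ⟨i, ha, ht⟩
      refine Subgroup.subset_closure ⟨i, ?_, ht⟩
      change (a : H) = τ i at ha
      change g⁻¹ * φ (a : H) * g = σ i
      rw [ha, hg]
      group)
    continuous_toFun :=
      (QuotientGroup.isOpenQuotientMap_mk (N := lambdaRel τ)).isQuotientMap.continuous_iff.2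
        ((QuotientGroup.isOpenQuotientMap_mk (N := lambdaRel σ)).continuous.comp hf) }

/-- If `φ(τ) = g σ g⁻¹`, the map `(φ^*Y)^τ → Y^σ`, `y ↦ g⁻¹ y`, over
`Λ_H(τ) → Λ_G(σ)`. -/
def fixedTranslate (φ : H →ₜ* G) (τ : Fin n → H) (σ : Fin n → G) (g : G)
    (hg : ∀ i, φ (τ i) = g * σ i * g⁻¹) (Y : GSpace G) :
    PairMap (lambdaHom φ τ σ g hg) ((Y.res φ).fixed τ).toPair (Y.fixed σ).toPair :=
  PairMap.ofMap (X := (Y.res φ).fixed τ) (Y := Y.fixed σ)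
    ⟨fun y : fixedSet τ (Y.res φ) => (⟨g⁻¹ • (show Y from y.1), fun i => by
        have h1 : φ (τ i) • (show Y from y.1) = y.1 := y.2 i
        have h2 : σ i * g⁻¹ = g⁻¹ * φ (τ i) := by rw [hg]; group
        rw [← mul_smul, h2, mul_smul, h1]⟩ : fixedSet σ Y),
      Continuous.subtype_mk (Continuous.const_smul
        (g := fun y : fixedSet τ (Y.res φ) => (show Y from y.1)) continuous_subtype_val g⁻¹) _⟩
    (by
      rintro ⟨a, t⟩ y
      refine Subtype.ext ?_
      change g⁻¹ • (φ (a : H) • (show Y from y.1)) =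
        (g⁻¹ * φ (a : H) * g) • (g⁻¹ • (show Y from y.1))
      rw [← mul_smul, ← mul_smul]
      congr 1
      group)

/-- The map `X^τ → Y^τ` induced by an `H`-map `X → Y`. -/
def fixedMap {X Y : GSpace H} (f : C(X, Y)) (hf : ∀ (h : H) (x : X), f (h • x) = h • f x)
    (τ : Fin n → H) :
    C(X.fixed τ, Y.fixed τ) :=
  ⟨fun x : fixedSet τ X => (⟨f x.1, fun i => by rw [← hf, x.2 i]⟩ : fixedSet τ Y),
    (f.continuous.comp continuous_subtype_val).subtype_mk _⟩

theorem fixedMap_smul {X Y : GSpace H} (f : C(X, Y))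
    (hf : ∀ (h : H) (x : X), f (h • x) = h • f x) (τ : Fin n → H) (a : LambdaGroup τ)
    (x : X.fixed τ) : fixedMap f hf τ (a • x) = a • fixedMap f hf τ x := by
  obtain ⟨a, t⟩ := a
  exact Subtype.ext (hf a x.1)

end LambdaMaps

/-! ## Quasi-theories -/

namespace EquivariantCohomologyTheory

variable (E : EquivariantCohomologyTheory.{u, v}) {n : ℕ}

/-- `QE_{n,G}^k(X) = ∏_σ E_{Λ_G(σ)}^k(X^σ)`, where `σ` runs over the set `S` of
representatives. -/
abbrev Quasi {G : Type u} [Group G] [TopologicalSpace G] [IsTopologicalGroup G]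
    (S : Set (Fin n → G)) (X : GSpace G) (k : ℤ) : Type (max u v) :=
  ∀ σ : S, E.abs (X.fixed σ.1) k

/-- The map `f^* : QE_{n,H}^k(Y) → QE_{n,H}^k(X)` induced by an `H`-map `f : X → Y`. -/
def quasiPullback {H : Type u} [Group H] [TopologicalSpace H] [IsTopologicalGroup H]
    (S : Set (Fin n → H)) {X Y : GSpace H} (f : C(X, Y))
    (hf : ∀ (h : H) (x : X), f (h • x) = h • f x) (k : ℤ) :
    E.Quasi S Y k →+ E.Quasi S X k :=
  AddMonoidHom.pi fun τ =>
    (E.pullback (fixedMap f hf τ.1) (fixedMap_smul f hf τ.1) k).comp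
      (Pi.evalAddMonoidHom (fun τ : S => E.abs (Y.fixed τ.1) k) τ)

/-- The restriction map `φ^* : QE_{n,G}^k(Y) → QE_{n,H}^k(φ^*Y)` along `φ : H → G`. For each
representative `τ` over `H`, let `s τ` be the representative over `G` of the conjugacy class of
`φ(τ)`, and `φ(τ) = g_τ (s τ) g_τ⁻¹`. The `τ`-component of `φ^*` is
`E_{Λ_G(s τ)}^k(Y^{s τ}) ≅ E_{Λ_G(φ(τ))}^k(Y^{φ(τ)}) → E_{Λ_H(τ)}^k((φ^*Y)^τ)`,
where the isomorphism is the one given by conjugation with `g_τ` and the second map is the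
restriction along `Λ_H(τ) → Λ_G(φ(τ))`. -/
def quasiRestrict {H G : Type u} [Group H] [TopologicalSpace H] [IsTopologicalGroup H]
    [Group G] [TopologicalSpace G] [IsTopologicalGroup G] (φ : H →ₜ* G)
    (SH : Set (Fin n → H)) (SG : Set (Fin n → G)) (s : SH → SG) (g : SH → G)
    (hg : ∀ (τ : SH) (i : Fin n), φ (τ.1 i) = g τ * (s τ).1 i * (g τ)⁻¹)
    (Y : GSpace G) (k : ℤ) : E.Quasi SG Y k →+ E.Quasi SH (Y.res φ) k :=
  AddMonoidHom.pi fun τ =>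
    (E.map (fixedTranslate φ τ.1 (s τ).1 (g τ) (hg τ) Y) k).comp
      (Pi.evalAddMonoidHom (fun σ : SG => E.abs (Y.fixed σ.1) k) (s τ))

/-- The change-of-group map `ρ^G_H = i^* ∘ φ^* : QE_{n,G}^k(G ×_H X) → QE_{n,H}^k(X)`, where
`φ : H → G` is the inclusion and `i : X → G ×_H X`, `x ↦ [e, x]`. -/
def quasiChangeOfGroup {G : Type u} [Group G] [TopologicalSpace G] [IsTopologicalGroup G]
    (H : Subgroup G) (SH : Set (Fin n → H)) (SG : Set (Fin n → G)) (s : SH → SG) (g : SH → G)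
    (hg : ∀ (τ : SH) (i : Fin n), (τ.1 i : G) = g τ * (s τ).1 i * (g τ)⁻¹)
    (X : GSpace H) (k : ℤ) : E.Quasi SG (X.induced H) k →+ E.Quasi SH X k :=
  (E.quasiPullback SH (inducedUnit H X) (inducedUnit_smul H X) k).comp
    (E.quasiRestrict (subgroupIncl H) SH SG s g hg (X.induced H) k)

/-- The unit of `QE_{n,G}^*(X)`, for a theory with ring structure. -/
def RingStructure.quasiOne {E : EquivariantCohomologyTheory.{u, v}} (R : E.RingStructure)
    {G : Type u} [Group G] [TopologicalSpace G] [IsTopologicalGroup G]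
    (S : Set (Fin n → G)) (X : GSpace G) : E.Quasi S X 0 :=
  fun σ => R.one (X.fixed σ.1)

/-- The componentwise product of `QE_{n,G}^*(X)`, for a theory with ring structure. -/
def RingStructure.quasiMul {E : EquivariantCohomologyTheory.{u, v}} (R : E.RingStructure)
    {G : Type u} [Group G] [TopologicalSpace G] [IsTopologicalGroup G]
    (S : Set (Fin n → G)) (X : GSpace G) {k l m : ℤ} (h : k + l = m)
    (a : E.Quasi S X k) (b : E.Quasi S X l) : E.Quasi S X m :=
  fun σ => R.mul (X.fixed σ.1) h (a σ) (b σ)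

end EquivariantCohomologyTheory

open scoped Topology InnerProductSpace
open MeasureTheory

/-! The heart of the matter is a description of the fixed points of a balanced product. A point `[a,
x]` is fixed by `σ` exactly if `a⁻¹ σ a` lies in `H` and fixes `x`. Let `N` be the set of all `a`
with `a⁻¹ σ a` in `H`. The double cosets in `C_G(σ) \ N / H` correspond to the `H`-classes of tuples
in `H` that are `G`-conjugate to `σ`, hence to the `τ` with `s τ = σ` (`exists_double_coset_rep`,
`eq_of_double_coset_eq`). The part of `(G ×_H X)^σ` over the double coset of `g_τ⁻¹` is the balanced
product of `Λ_G(σ)` and `X^τ` over `Λ_H(τ)` (`exists_of_orbitMap_fixedUnit_eq`,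
`isQuotientMap_orbitMap_fixedUnit`). Change of groups for `E` on each part identifies the `σ`-factor
of the source with the product of the `τ`-factors over all `τ` with `s τ = σ`, and every `τ` occurs
for exactly one `σ`.

Only finite additivity follows from excision and exactness (`bijective_pi_of_isOpenEmbedding`), so
the parts must be open and finite in number. Both come from a rigidity statement,
`eventually_mem_centralizerOf_mul`: double cosets are open in `N`, and `N` is compact.

The axioms of `E` hold at compact Lie groups only, so closed subgroups and the groups `Λ` must be
shown to be such. The criterion is that a compact Hausdorff group without small subgroups is a Lie
group: by Peter-Weyl it has a faithful representation, and the exponential map gives charts on the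
image. Conversely a Lie group has no small subgroups, because squaring expands near the identity.
Absence of small subgroups passes to subgroups, products and quotients by discrete normal subgroups.
The exponential coordinates that give the charts also prove rigidity. -/

/-- A topological group has no small subgroups if some neighbourhood of the identity contains no
nontrivial subgroup. -/
def NoSmallSubgroups (G : Type*) [Group G] [TopologicalSpace G] : Prop :=
  ∃ U ∈ 𝓝 (1 : G), ∀ K : Subgroup G, (K : Set G) ⊆ U → K = ⊥

/-! ### Compactness of integral operators -/

section IntegralOperator

variable {K E : Type*} [TopologicalSpace K] [CompactSpace K] [NormedAddCommGroup E]
  [InnerProductSpace ℝ E]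

/-- The operator `f ↦ (x ↦ ⟪k x, f⟫)` for a continuous family `k` of vectors. -/
noncomputable def innerFamily (k : C(K, E)) : E →L[ℝ] C(K, ℝ) :=
  LinearMap.mkContinuous
    { toFun := fun f => ⟨fun x => ⟪k x, f⟫_ℝ, by fun_prop⟩
      map_add' := fun f g => by ext x; simp [inner_add_right]
      map_smul' := fun c f => by ext x; simp [inner_smul_right] } ‖k‖ (fun f => by
        refine (ContinuousMap.norm_le _ (by positivity)).2 fun x => ?_
        exact (norm_inner_le_norm _ _).trans
          (mul_le_mul_of_nonneg_right (k.norm_coe_le_norm x) (norm_nonneg _)))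

theorem innerFamily_apply (k : C(K, E)) (f : E) (x : K) : innerFamily k f x = ⟪k x, f⟫_ℝ := rfl

/-- The range of `k` is compact, so it lies within `ε / 2` of a finite set `t`. Composing with the
orthogonal projection to the span of `t` changes the operator by at most `ε / 2` and makes it of
finite rank; compact operators form a closed set. -/
theorem isCompactOperator_innerFamily (k : C(K, E)) : IsCompactOperator (innerFamily k) := by
  have hcl := isClosed_setOfPred_isCompactOperator (𝕜₁ := ℝ) (𝕜₂ := ℝ) (σ₁₂ := RingHom.id ℝ)
    (M₁ := E) (M₂ := C(K, ℝ))
  refine hcl.closure_subset_iff.2 subset_rfl ((Metric.mem_closure_iff (α := E →L[ℝ] C(K, ℝ))).2 fun ε hε => ?_)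
  obtain ⟨t, -, ht, hcov⟩ :=
    (isCompact_range k.continuous).finite_cover_balls (e := ε / 2) (by positivity)
  let V := Submodule.span ℝ t
  have : FiniteDimensional ℝ V := FiniteDimensional.span_of_finite ℝ ht
  refine ⟨(innerFamily k).comp V.starProjection, ?_, ?_⟩
  · have h1 : IsCompactOperator V.subtypeL :=
      by
      have : ProperSpace V := FiniteDimensional.proper ℝ V
      exact isCompactOperator_of_locallyCompactSpace_rng V.subtypeL
    have h2 : IsCompactOperator V.starProjection := h1.comp_clm V.orthogonalProjectionOnto
    exact h2.clm_comp (innerFamily k)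
  · refine lt_of_le_of_lt ((dist_eq_norm (E := E →L[ℝ] C(K, ℝ)) _ _).trans_le <|
      ContinuousLinearMap.opNorm_le_bound _ (half_pos hε).le fun f => ?_)
      (half_lt_self hε)
    refine (ContinuousMap.norm_le _ (by positivity)).2 fun x => ?_
    obtain ⟨v, hvt, hv⟩ := Set.mem_iUnion₂.1 (hcov ⟨x, rfl⟩)
    have hvV : v ∈ V := Submodule.subset_span hvt
    -- The vector `f - V.starProjection f` is orthogonal to `v`, so `k x` may be replaced by the
    -- small vector `k x - v`.
    have e1 : (innerFamily k - (innerFamily k).comp V.starProjection) f x =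
        ⟪k x - v, f - V.starProjection f⟫_ℝ := by
      have : ⟪v, f - V.starProjection f⟫_ℝ = 0 :=
        Submodule.inner_right_of_mem_orthogonal hvV (V.sub_starProjection_mem_orthogonal f)
      rw [inner_sub_left, this, sub_zero, inner_sub_right]
      rfl
    rw [e1]
    refine (norm_inner_le_norm _ _).trans (mul_le_mul ?_ ?_ (norm_nonneg _) (by positivity))
    · rw [← dist_eq_norm]; exact (Metric.mem_ball.1 hv).le
    · have := V.norm_sq_eq_add_norm_sq_starProjection f
      have h3 : f - V.starProjection f = Vᗮ.starProjection f := by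
        rw [Submodule.starProjection_orthogonal]; rfl
      rw [h3]
      exact Vᗮ.norm_starProjection_apply_le f

end IntegralOperator

/-! ### Peter-Weyl: faithful representations from eigenspaces of convolution operators -/

section PeterWeyl

open DomMulAct

variable {G : Type u} [Group G] [TopologicalSpace G] [IsTopologicalGroup G]
  [MeasurableSpace G] [BorelSpace G] (μ : Measure G) [μ.IsHaarMeasure]

/-- The action of an element of `Gᵈᵐᵃ` on `L²(G)`, as a linear isometry. -/
noncomputable def translateIsometry (c : Gᵈᵐᵃ) : Lp ℝ 2 μ →ₗᵢ[ℝ] Lp ℝ 2 μ where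
  toFun f := c • f
  map_add' := smul_add c
  map_smul' r f := smul_comm c r f
  norm_map' f := norm_smul_Lp c f

theorem inner_translate (c : Gᵈᵐᵃ) (f h : Lp ℝ 2 μ) : ⟪c • f, c • h⟫_ℝ = ⟪f, h⟫_ℝ :=
  (translateIsometry μ c).inner_map_map f h

theorem inner_translate_right (c : Gᵈᵐᵃ) (f h : Lp ℝ 2 μ) : ⟪f, c • h⟫_ℝ = ⟪c⁻¹ • f, h⟫_ℝ := by
  rw [← inner_translate μ c (c⁻¹ • f) h, smul_inv_smul]

variable [CompactSpace G]

/-- The translates `y ↦ φ (x⁻¹ y)` of a continuous function, as elements of `L²(G)`. -/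
noncomputable def translates (φ : C(G, ℝ)) : C(G, Lp ℝ 2 μ) :=
  (ContinuousMap.mk (ContinuousMap.toLp 2 μ ℝ) (ContinuousLinearMap.continuous _)).comp
    (ContinuousMap.curry ⟨fun p : G × G => φ (p.1⁻¹ * p.2), by fun_prop⟩)

theorem smul_toLp (g : G) (f : C(G, ℝ)) :
    mk g • ContinuousMap.toLp 2 μ ℝ f =
      ContinuousMap.toLp 2 μ ℝ (f.comp ⟨fun y => g * y, by fun_prop⟩) := by
  refine Lp.ext ?_
  have h1 := smul_Lp_ae_eq (mk g) (ContinuousMap.toLp 2 μ ℝ f)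
  have h2 := (measurePreserving_mul_left μ g).quasiMeasurePreserving.ae (ContinuousMap.coeFn_toLp (p := 2) (𝕜 := ℝ) μ f)
  have h3 := ContinuousMap.coeFn_toLp (p := 2) (𝕜 := ℝ) μ
    (f.comp ⟨fun y => g * y, by fun_prop⟩)
  filter_upwards [h1, h2, h3] with y h1 h2 h3
  rw [h1, h3]
  exact h2

theorem smul_translates (φ : C(G, ℝ)) (g x : G) :
    mk g • translates μ φ x = translates μ φ (g⁻¹ * x) := by
  refine (smul_toLp μ g _).trans (congrArg (ContinuousMap.toLp 2 μ ℝ) ?_)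
  ext y
  simp [mul_assoc]

theorem innerFamily_translates_smul (φ : C(G, ℝ)) (g : G) (f : Lp ℝ 2 μ) :
    innerFamily (translates μ φ) (mk g • f) =
      (innerFamily (translates μ φ) f).comp ⟨fun y => g * y, by fun_prop⟩ := by
  ext x
  simp only [innerFamily_apply, ContinuousMap.comp_apply, ContinuousMap.coe_mk]
  rw [inner_translate_right, ← mk_inv, smul_translates, inv_inv]

/-- The convolution operator `L²(G) → L²(G)` of a continuous function. -/
noncomputable def convolutionOp (φ : C(G, ℝ)) : Lp ℝ 2 μ →L[ℝ] Lp ℝ 2 μ :=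
  (ContinuousMap.toLp 2 μ ℝ).comp (innerFamily (translates μ φ))

theorem convolutionOp_smul (φ : C(G, ℝ)) (c : Gᵈᵐᵃ) (f : Lp ℝ 2 μ) :
    convolutionOp μ φ (c • f) = c • convolutionOp μ φ f := by
  obtain ⟨g, rfl⟩ := mk.surjective c
  change ContinuousMap.toLp 2 μ ℝ (innerFamily (translates μ φ) (mk g • f)) = _
  rw [innerFamily_translates_smul, ← smul_toLp]
  rfl

open ContinuousLinearMap in
/-- The positive operator `S† S`, for `S` the convolution operator of a continuous function. -/
noncomputable def convolutionSq (φ : C(G, ℝ)) : Lp ℝ 2 μ →L[ℝ] Lp ℝ 2 μ :=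
  (adjoint (convolutionOp μ φ)).comp (convolutionOp μ φ)

theorem inner_convolutionSq (φ : C(G, ℝ)) (f h : Lp ℝ 2 μ) :
    ⟪f, convolutionSq μ φ h⟫_ℝ = ⟪convolutionOp μ φ f, convolutionOp μ φ h⟫_ℝ := by
  rw [convolutionSq, ContinuousLinearMap.comp_apply, ContinuousLinearMap.adjoint_inner_right]

theorem convolutionSq_smul (φ : C(G, ℝ)) (c : Gᵈᵐᵃ) (f : Lp ℝ 2 μ) :
    convolutionSq μ φ (c • f) = c • convolutionSq μ φ f := by
  refine ext_inner_left ℝ fun h => ?_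
  rw [inner_translate_right, inner_convolutionSq, inner_convolutionSq, convolutionOp_smul,
    convolutionOp_smul, inner_translate_right]

theorem isCompactOperator_convolutionSq (φ : C(G, ℝ)) :
    IsCompactOperator (convolutionSq μ φ) :=
  ((isCompactOperator_innerFamily (translates μ φ)).clm_comp (ContinuousMap.toLp 2 μ ℝ)).clm_comp
    (ContinuousLinearMap.adjoint (convolutionOp μ φ))

theorem isSymmetric_convolutionSq (φ : C(G, ℝ)) :
    (convolutionSq μ φ).toLinearMap.IsSymmetric := fun f h => by
  simp only [ContinuousLinearMap.coe_coe]
  rw [real_inner_comm, inner_convolutionSq, inner_convolutionSq, real_inner_comm]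

/-- From `S† S f = 0` follows `‖S f‖² = 0`, and a continuous function that vanishes almost
everywhere for Haar measure is zero. -/
theorem innerFamily_eq_zero_of_convolutionSq (φ : C(G, ℝ)) {f : Lp ℝ 2 μ}
    (hf : convolutionSq μ φ f = 0) : innerFamily (translates μ φ) f = 0 := by
  have h1 : convolutionOp μ φ f = 0 := by
    rw [← inner_self_eq_zero (𝕜 := ℝ), ← inner_convolutionSq, hf, inner_zero_right]
  exact ContinuousMap.toLp_injective (p := 2) (𝕜 := ℝ) μ (h1.trans (map_zero _).symm)

open Module.End in
/-- An element that fixes all eigenvectors of nonzero eigenvalue is a period of `φ`. -/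
theorem apply_eq_of_smul_eigenvectors (φ : C(G, ℝ)) (g : G)
    (hg : ∀ r : ℝ, r ≠ 0 → ∀ f ∈ eigenspace (convolutionSq μ φ).toLinearMap r, mk g • f = f) :
    φ g = φ 1 := by
  set T := innerFamily (translates μ φ)
  let D : Lp ℝ 2 μ →L[ℝ] C(G, ℝ) := T.comp (translateIsometry μ (mk g)).toContinuousLinearMap - T
  have hD : ∀ f, D f = T (mk g • f) - T f := fun f => rfl
  -- `D` compares `T` before and after translation by `g`. It vanishes on the kernel of `S† S`,
  -- which is translation invariant and killed by `T`, and on the other eigenspaces by hypothesis;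
  -- by the spectral theorem the eigenspaces span a dense subspace.
  have hker : (⨆ r, eigenspace (convolutionSq μ φ).toLinearMap r) ≤ D.ker := by
    refine iSup_le fun r f hf => ?_
    change D f = 0
    rw [hD]
    by_cases hr : r = 0
    · subst hr
      have h0 : convolutionSq μ φ f = 0 := by simpa using mem_eigenspace_iff.1 hf
      have h1 : convolutionSq μ φ (mk g • f) = 0 := by
        rw [convolutionSq_smul, h0, smul_zero]
      rw [innerFamily_eq_zero_of_convolutionSq μ φ h0,
        innerFamily_eq_zero_of_convolutionSq μ φ h1, sub_zero]
    · rw [hg r hr f hf, sub_self]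
  have htop : D.ker = ⊤ := by
    have h1 := ContinuousLinearMap.orthogonalComplement_iSup_eigenspaces_eq_bot
      (isCompactOperator_convolutionSq μ φ) (isSymmetric_convolutionSq μ φ)
    rw [← Submodule.topologicalClosure_eq_top_iff] at h1
    exact top_le_iff.1 (h1 ▸ Submodule.topologicalClosure_minimal _ hker D.isClosed_ker)
  have hall : ∀ f, ⟪translates μ φ g, f⟫_ℝ = ⟪translates μ φ 1, f⟫_ℝ := fun f => by
    have h1 : D f = 0 := (htop ▸ Submodule.mem_top : f ∈ D.ker)
    rw [hD, sub_eq_zero, innerFamily_translates_smul] at h1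
    -- The value at `1` of the translate of `T f` by `g` is the value of `T f` at `g`.
    have := congrArg (fun u : C(G, ℝ) => u 1) h1
    simpa [T, innerFamily_apply] using this
  have h2 := ContinuousMap.toLp_injective (p := 2) (𝕜 := ℝ) μ (ext_inner_right ℝ hall)
  -- The identity `φ (g⁻¹ y) = φ y`, evaluated at `y = g`.
  have := congrArg (fun u : C(G, ℝ) => u g) h2
  simpa using this.symm


/-- The representation of `G` on an invariant subspace of `L²(G)`. -/
noncomputable def translateRep (V : Submodule ℝ (Lp ℝ 2 μ)) (hV : ∀ (c : Gᵈᵐᵃ), ∀ f ∈ V, c • f ∈ V) :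
    G →* (V →L[ℝ] V) where
  -- The action on functions through the domain reverses products; the inverse makes this a
  -- homomorphism.
  toFun g := ((translateIsometry μ (mk g⁻¹)).toContinuousLinearMap.restrict
    (p := V) (q := V) fun f hf => hV _ f hf)
  map_one' := by
    ext1 f
    exact Subtype.ext (by
      change mk (1 : G)⁻¹ • (f : Lp ℝ 2 μ) = f
      rw [inv_one, mk_one, one_smul])
  map_mul' g h := by
    ext1 f
    exact Subtype.ext (by
      change mk (g * h)⁻¹ • (f : Lp ℝ 2 μ) = mk g⁻¹ • mk h⁻¹ • (f : Lp ℝ 2 μ)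
      rw [mul_inv_rev, mk_mul, mul_smul])

omit [CompactSpace G] in
theorem translateRep_apply (V : Submodule ℝ (Lp ℝ 2 μ)) (hV : ∀ (c : Gᵈᵐᵃ), ∀ f ∈ V, c • f ∈ V)
    (g : G) (f : V) : (translateRep μ V hV g f : Lp ℝ 2 μ) = mk g⁻¹ • (f : Lp ℝ 2 μ) := rfl

theorem continuous_translateRep (V : Submodule ℝ (Lp ℝ 2 μ)) [FiniteDimensional ℝ V]
    (hV : ∀ (c : Gᵈᵐᵃ), ∀ f ∈ V, c • f ∈ V) : Continuous (translateRep μ V hV) := by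
  refine continuous_clm_apply.2 fun f => Continuous.subtype_mk (f := fun g =>
    mk g⁻¹ • (f : Lp ℝ 2 μ)) ?_ _
  have : Fact ((2 : ENNReal) ≠ ⊤) := ⟨by simp⟩
  exact (continuous_mk.comp continuous_inv).smul continuous_const

end PeterWeyl

open DomMulAct Module.End in
/-- A compact Hausdorff group without small subgroups has a faithful finite-dimensional
representation. -/
theorem NoSmallSubgroups.exists_faithful_representation {G : Type u} [Group G]
    [TopologicalSpace G] [IsTopologicalGroup G] [CompactSpace G] [T2Space G]
    (hG : NoSmallSubgroups G) :
    ∃ (V : Type u) (_ : NormedAddCommGroup V) (_ : NormedSpace ℝ V) (_ : FiniteDimensional ℝ V)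
      (ρ : G →* (V →L[ℝ] V)), Continuous ρ ∧ Function.Injective ρ := by
  obtain ⟨U', hU', hU'K⟩ := hG
  obtain ⟨U, hUU', hU, h1U⟩ := mem_nhds_iff.1 hU'
  obtain ⟨φ, hφ1, hφ0, -⟩ := exists_continuous_zero_one_of_isClosed (isClosed_singleton (x := (1 : G)))
    hU.isClosed_compl (Set.disjoint_singleton_left.2 fun h => h h1U)
  borelize G
  let μ : Measure G := Measure.haar
  let A := convolutionSq μ φ
  have : Fact ((2 : ENNReal) ≠ ⊤) := ⟨by simp⟩
  let F : {r : ℝ // r ≠ 0} → Set G := fun r =>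
    {g | ∀ f ∈ eigenspace A.toLinearMap r.1, mk g • f = f}
  have hFcl : ∀ r, IsClosed (F r) := fun r => by
    have : F r = ⋂ f ∈ eigenspace A.toLinearMap r.1, {g | mk g • f = f} := by
      ext g; simp [F]
    rw [this]
    exact isClosed_biInter fun f _ =>
      isClosed_eq (continuous_mk.smul continuous_const) continuous_const
  -- An element outside `U` is not a period of `φ`, so it moves some eigenvector of nonzero
  -- eigenvalue. By compactness of the complement of `U`, finitely many eigenvalues detect all these
  -- elements, and their eigenspaces are finite-dimensional.
  obtain ⟨t, ht⟩ := isCompact_univ.inter_right hU.isClosed_compl |>.elim_finite_subfamily_closed F hFcl (by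
    refine Set.eq_empty_iff_forall_notMem.2 fun g hg => ?_
    have h1 := apply_eq_of_smul_eigenvectors μ φ g fun r hr f hf =>
      Set.mem_iInter.1 hg.2 ⟨r, hr⟩ f hf
    rw [hφ1 rfl, hφ0 hg.1.2] at h1
    simp at h1)
  let V : Submodule ℝ (Lp ℝ 2 μ) := ⨆ r : t, eigenspace A.toLinearMap r.1.1
  have hfin : ∀ r : t, FiniteDimensional ℝ (eigenspace A.toLinearMap r.1.1) := fun r =>
    ContinuousLinearMap.finite_dimensional_eigenspace (isCompactOperator_convolutionSq μ φ) _ r.1.2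
  have hVfin : FiniteDimensional ℝ V := Submodule.finiteDimensional_iSup _
  have hV : ∀ c : Gᵈᵐᵃ, ∀ f ∈ V, c • f ∈ V := fun c => by
    have : V ≤ V.comap (translateIsometry μ c).toLinearMap := iSup_le fun r f hf => by
      refine Submodule.mem_iSup_of_mem r ?_
      rw [mem_eigenspace_iff] at hf ⊢
      change A f = _ at hf
      change A (c • f) = r.1.1 • (c • f)
      rw [convolutionSq_smul, hf, smul_comm]
    exact this
  refine ⟨V, inferInstance, inferInstance, hVfin, translateRep μ V hV,
    continuous_translateRep μ V hV, ?_⟩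
  rw [← MonoidHom.ker_eq_bot_iff]
  -- The kernel is a subgroup contained in `U`, hence trivial.
  refine hU'K _ fun g hg => hUU' (by_contra fun hgU => ?_)
  refine Set.eq_empty_iff_forall_notMem.1 ht g ⟨⟨trivial, hgU⟩, Set.mem_iInter₂.2 fun r hr f hf => ?_⟩
  have hfV : f ∈ V := Submodule.mem_iSup_of_mem (⟨r, hr⟩ : t) hf
  have h1 : translateRep μ V hV g = 1 := hg
  have h2 : mk g⁻¹ • f = f := by
    have := translateRep_apply μ V hV g ⟨f, hfV⟩
    rw [h1] at this
    exact this.symm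
  rw [mk_inv, inv_smul_eq_iff] at h2
  exact h2.symm

/-! ### The exponential in a real Banach algebra -/

section RealExp

open NormedSpace

variable {𝓐 : Type*} [NormedRing 𝓐] [NormedAlgebra ℝ 𝓐] [CompleteSpace 𝓐]

theorem exp_nsmul_real (n : ℕ) (x : 𝓐) : exp (n • x) = exp x ^ n :=
  letI := NormedAlgebra.restrictScalars ℚ ℝ 𝓐
  exp_nsmul n x

theorem exp_neg_mul_exp (x : 𝓐) : exp (-x) * exp x = 1 := by
  let _ := NormedAlgebra.restrictScalars ℚ ℝ 𝓐
  rw [← exp_add_of_commute (Commute.neg_left (Commute.refl x)), neg_add_cancel, exp_zero]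

theorem exp_mul_exp_neg (x : 𝓐) : exp x * exp (-x) = 1 := by
  simpa using exp_neg_mul_exp (-x)

theorem exp_conj_of_mul_eq_one {a b : 𝓐} (hab : a * b = 1) (hba : b * a = 1) (x : 𝓐) :
    exp (a * x * b) = a * exp x * b :=
  letI := NormedAlgebra.restrictScalars ℚ ℝ 𝓐
  exp_units_conj ⟨a, b, hab, hba⟩ x

theorem contDiff_exp_real {n : WithTop ℕ∞} : ContDiff ℝ n (exp : 𝓐 → 𝓐) :=
  AnalyticOnNhd.contDiff fun x _ => exp_analytic (𝕂 := ℝ) x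

theorem continuous_exp_real : Continuous (exp : 𝓐 → 𝓐) :=
  (contDiff_exp_real (n := 0)).continuous

end RealExp

/-! ## Closed linear groups -/

section LinearGroup

open NormedSpace Filter
open scoped Topology

variable {𝓐 : Type*} [NormedRing 𝓐]

/-- A submonoid of a Banach algebra that is closed as a subset and consists of elements with an
inverse in it. -/
structure IsClosedLinearGroup (Γ : Submonoid 𝓐) : Prop where
  isClosed : IsClosed (Γ : Set 𝓐)
  exists_inv : ∀ x ∈ Γ, ∃ y ∈ Γ, x * y = 1

namespace IsClosedLinearGroup

theorem mem_of_mul_eq_one {Γ : Submonoid 𝓐} (hΓ : IsClosedLinearGroup Γ) {x y : 𝓐} (hx : x ∈ Γ)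
    (hyx : y * x = 1) : y ∈ Γ := by
  obtain ⟨z, hz, hxz⟩ := hΓ.exists_inv x hx
  rwa [left_inv_eq_right_inv hyx hxz]

variable [NormedAlgebra ℝ 𝓐] [CompleteSpace 𝓐] {Γ : Submonoid 𝓐} (hΓ : IsClosedLinearGroup Γ)
include hΓ

theorem exp_neg_mem {X : 𝓐} (hX : exp X ∈ Γ) : exp (-X) ∈ Γ :=
  hΓ.mem_of_mul_eq_one hX (exp_neg_mul_exp X)

theorem exp_zsmul_mem {X : 𝓐} (hX : exp X ∈ Γ) (k : ℤ) : exp (k • X) ∈ Γ := by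
  have h : ∀ n : ℕ, exp (n • X) ∈ Γ := fun n => by
    rw [exp_nsmul_real]; exact pow_mem hX n
  obtain ⟨n, rfl | rfl⟩ := k.eq_nat_or_neg
  · rw [natCast_zsmul]; exact h n
  · rw [neg_smul, natCast_zsmul]; exact hΓ.exp_neg_mem (h n)

/-- Limits of rescaled logarithms of elements near `1` generate one-parameter subgroups. -/
theorem exp_smul_mem_of_tendsto {ι : Type*} {l : Filter ι} [l.NeBot] {X : ι → 𝓐} {r : ι → ℝ}
    {Y : 𝓐} (hX : Tendsto X l (𝓝 0)) (hXΓ : ∀ᶠ i in l, exp (X i) ∈ Γ)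
    (hY : Tendsto (fun i => r i • X i) l (𝓝 Y)) (t : ℝ) : exp (t • Y) ∈ Γ := by
  -- Integer multiples of `X i` have exponentials in `Γ`. Rounding `t * r i` down costs a multiple
  -- of `X i` by a number in `[0, 1)`, which tends to `0`.
  have h1 : Tendsto (fun i => (⌊t * r i⌋ : ℤ) • X i) l (𝓝 (t • Y)) := by
    have h2 : Tendsto (fun i => (Int.fract (t * r i)) • X i) l (𝓝 0) := by
      refine squeeze_zero_norm (fun i => ?_) (tendsto_norm_zero.comp hX)
      rw [norm_smul, Real.norm_of_nonneg (Int.fract_nonneg _)]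
      exact mul_le_of_le_one_left (norm_nonneg _) (Int.fract_lt_one _).le
    have h3 := (hY.const_smul t).sub h2
    rw [sub_zero] at h3
    refine h3.congr fun i => ?_
    rw [smul_smul, ← sub_smul, Int.self_sub_fract, Int.cast_smul_eq_zsmul]
  refine hΓ.isClosed.mem_of_tendsto ((continuous_exp_real.tendsto _).comp h1) ?_
  filter_upwards [hXΓ] with i hi using hΓ.exp_zsmul_mem hi _

/-- The curve `exp (s X) * exp (s Y)` stays in `Γ`, and its local logarithm has derivative `X + Y`
at `s = 0`. Rescaling that logarithm by `s⁻¹` makes `exp_smul_mem_of_tendsto` apply. -/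
theorem exp_smul_add_mem {X Y : 𝓐} (hX : ∀ t : ℝ, exp (t • X) ∈ Γ)
    (hY : ∀ t : ℝ, exp (t • Y) ∈ Γ) (t : ℝ) : exp (t • (X + Y)) ∈ Γ := by
  have hs : HasStrictFDerivAt (exp : 𝓐 → 𝓐)
      ((ContinuousLinearEquiv.refl ℝ 𝓐 : 𝓐 ≃L[ℝ] 𝓐) : 𝓐 →L[ℝ] 𝓐) 0 := hasStrictFDerivAt_exp_zero
  set L := hs.localInverse _ _ _
  have hL : HasFDerivAt L (ContinuousLinearMap.id ℝ 𝓐) 1 := by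
    have := hs.to_localInverse.hasFDerivAt
    rwa [exp_zero] at this
  have hL1 : L 1 = 0 := by
    have := hs.localInverse_apply_image
    rwa [exp_zero] at this
  have hev : ∀ᶠ z in 𝓝 (1 : 𝓐), exp (L z) = z := by
    have := hs.eventually_right_inverse
    rwa [exp_zero] at this
  let c : ℝ → 𝓐 := fun s => exp (s • X) * exp (s • Y)
  have hc : HasDerivAt c (X + Y) 0 := by
    have := (hasDerivAt_exp_smul_const (𝕂 := ℝ) X 0).mul (hasDerivAt_exp_smul_const (𝕂 := ℝ) Y 0)
    exact this.congr_deriv (by simp [exp_zero])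
  have hc0 : c 0 = 1 := by simp [c, exp_zero]
  have hd : HasDerivAt (fun s => L (c s)) (X + Y) 0 := by
    rw [← hc0] at hL
    exact hL.comp_hasDerivAt 0 hc
  have hcont : Tendsto c (𝓝[≠] 0) (𝓝 1) := hc0 ▸ hc.continuousAt.tendsto.mono_left inf_le_left
  refine hΓ.exp_smul_mem_of_tendsto (l := 𝓝[≠] (0 : ℝ)) (X := fun s => L (c s))
    (r := fun s => s⁻¹) ?_ ?_ ?_ t
  · have := hd.continuousAt.tendsto.mono_left (inf_le_left : 𝓝[≠] (0 : ℝ) ≤ 𝓝 0)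
    rwa [hc0, hL1] at this
  · filter_upwards [hcont.eventually hev] with s h1
    rw [h1]
    exact mul_mem (hX s) (hY s)
  · have := hasDerivAt_iff_tendsto_slope_zero.1 hd
    simpa [hc0, hL1] using this

/-- The Lie algebra of a closed linear group. -/
def lieAlgebra : Submodule ℝ 𝓐 where
  carrier := {X | ∀ t : ℝ, exp (t • X) ∈ Γ}
  add_mem' hX hY := hΓ.exp_smul_add_mem hX hY
  zero_mem' t := by rw [smul_zero, exp_zero]; exact one_mem Γ
  smul_mem' r X hX t := by rw [smul_smul]; exact hX _

theorem exp_mem {X : 𝓐} (hX : X ∈ hΓ.lieAlgebra) : exp X ∈ Γ := by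
  simpa using hX 1

/-- Near `0`, no nonzero element of a complement of the Lie algebra has its exponential in the
group. -/
theorem eventually_eq_zero_of_exp_mem [FiniteDimensional ℝ 𝓐] {m : Submodule ℝ 𝓐}
    (hm : Disjoint m hΓ.lieAlgebra) : ∀ᶠ X : m in 𝓝 (0 : m), exp (X : 𝓐) ∈ Γ → X = 0 := by
  by_contra hcon
  rw [not_eventually] at hcon
  let l : Filter m := 𝓝 0 ⊓ 𝓟 {X | ¬(exp (X : 𝓐) ∈ Γ → X = 0)}
  have : l.NeBot := frequently_iff_neBot.1 hcon
  have hl : ∀ᶠ X : m in l, exp (X : 𝓐) ∈ Γ ∧ X ≠ 0 := by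
    filter_upwards [mem_inf_of_right (mem_principal_self _)] with X hX
    simpa using hX
  let U := Ultrafilter.of l
  have hU : (U : Filter m) ≤ l := Ultrafilter.of_le l
  have hproper : ProperSpace m := FiniteDimensional.proper ℝ m
  -- If there were nonzero counterexamples arbitrarily near `0`, their normalizations would
  -- accumulate at a unit vector `Y` of `m`. By `exp_smul_mem_of_tendsto`, `Y` would lie in the Lie
  -- algebra, against disjointness.
  obtain ⟨Y, hY, hUY⟩ := (isCompact_sphere (0 : m) 1).ultrafilter_le_nhds
    (U.map fun X => ‖X‖⁻¹ • X) (by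
      rw [le_principal_iff, Ultrafilter.mem_coe, Ultrafilter.mem_map]
      filter_upwards [hU hl] with X hX
      simp [norm_smul, hX.2])
  have hUY' : Tendsto (fun X : m => ‖X‖⁻¹ • X) (U : Filter m) (𝓝 Y) := hUY
  have hmem : (Y : 𝓐) ∈ hΓ.lieAlgebra := hΓ.exp_smul_mem_of_tendsto (l := (U : Filter m))
    (X := fun X => (X : 𝓐)) (r := fun X => ‖X‖⁻¹)
    ((continuous_subtype_val.tendsto (0 : m)).mono_left (hU.trans inf_le_left))
    (hU (hl.mono fun _ h => h.1)) ((continuous_subtype_val.tendsto Y).comp hUY')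
  have h0 : (Y : 𝓐) = 0 := Submodule.disjoint_def.1 hm Y Y.2 hmem
  have : Y = 0 := Subtype.ext h0
  simp [this] at hY

/-- Near the identity, the algebra is the product of a complement of the Lie algebra and of the
group, by `(X, Y) ↦ exp X * exp Y`. -/
theorem exists_local_product [FiniteDimensional ℝ 𝓐] {m : Submodule ℝ 𝓐}
    (hm : IsCompl m hΓ.lieAlgebra) :
    ∃ Φ : OpenPartialHomeomorph (m × hΓ.lieAlgebra) 𝓐,
      (∀ p, Φ p = exp (p.1 : 𝓐) * exp (p.2 : 𝓐)) ∧ 0 ∈ Φ.source ∧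
      (∀ z ∈ Φ.target, ContDiffAt ℝ ω Φ.symm z) ∧ ∀ p ∈ Φ.source, Φ p ∈ Γ → p.1 = 0 := by
  let F : m × hΓ.lieAlgebra → 𝓐 := fun p => exp (p.1 : 𝓐) * exp (p.2 : 𝓐)
  have hFs : ContDiff ℝ ω F :=
    (contDiff_exp_real.comp (m.subtypeL.contDiff.comp contDiff_fst)).mul
      (contDiff_exp_real.comp (hΓ.lieAlgebra.subtypeL.contDiff.comp contDiff_snd))
  let e : (m × hΓ.lieAlgebra) ≃L[ℝ] 𝓐 :=
    (Submodule.prodEquivOfIsCompl m hΓ.lieAlgebra hm).toContinuousLinearEquiv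
  -- The derivative at `0` is addition `(X, Y) ↦ X + Y`, invertible because the two subspaces are
  -- complementary; this feeds the inverse function theorem.
  have hF' : HasFDerivAt F (e : m × hΓ.lieAlgebra →L[ℝ] 𝓐) 0 := by
    have hexp : ∀ x : 𝓐, x = 0 → HasFDerivAt (exp : 𝓐 → 𝓐) (1 : 𝓐 →L[ℝ] 𝓐) x := by
      rintro _ rfl
      exact (hasStrictFDerivAt_exp_zero (𝕂 := ℝ)).hasFDerivAt
    have key : ∀ L : m × hΓ.lieAlgebra →L[ℝ] 𝓐, HasFDerivAt (fun p => exp (L p)) L 0 := fun L =>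
      (HasFDerivAt.comp (g := exp) (f := L) 0 (hexp (L 0) (map_zero L)) L.hasFDerivAt).congr_fderiv
        (by ext p <;> rfl)
    have h1 := key (m.subtypeL.comp (ContinuousLinearMap.fst ℝ m hΓ.lieAlgebra))
    have h2 := key (hΓ.lieAlgebra.subtypeL.comp (ContinuousLinearMap.snd ℝ m hΓ.lieAlgebra))
    refine (h1.mul' h2).congr_fderiv ?_
    ext p <;> simp [e, exp_zero]
  have hn : (ω : WithTop ℕ∞) ≠ 0 := by simp
  let Φ₀ := hFs.contDiffAt.toOpenPartialHomeomorph F hF' hn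
  have hΦ₀ : ∀ p, Φ₀ p = F p := fun p => rfl
  have hF0 : F 0 = 1 := by simp [F, exp_zero]
  have h0s : (0 : m × hΓ.lieAlgebra) ∈ Φ₀.source :=
    hFs.contDiffAt.mem_toOpenPartialHomeomorph_source hF' hn
  have hsm : ∀ᶠ z in 𝓝 (F 0), ContDiffAt ℝ ω Φ₀.symm z :=
    (hFs.contDiffAt.to_localInverse hF' hn).eventually (by simp)
  obtain ⟨B, hB, hBo, h0B⟩ := eventually_nhds_iff.1 hsm
  obtain ⟨C, hC, hCo, h0C⟩ :=
    eventually_nhds_iff.1 (hΓ.eventually_eq_zero_of_exp_mem hm.disjoint)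
  -- The domain is shrunk so that the inverse is analytic on the whole target and the `m`-coordinate
  -- stays where `eventually_eq_zero_of_exp_mem` holds.
  let s : Set (m × hΓ.lieAlgebra) := Prod.fst ⁻¹' C ∩ F ⁻¹' B
  have hso : IsOpen s := (hCo.preimage continuous_fst).inter (hBo.preimage hFs.continuous)
  refine ⟨Φ₀.restrOpen s hso, fun p => rfl, ?_, ?_, ?_⟩
  · rw [OpenPartialHomeomorph.restrOpen_source]
    exact ⟨h0s, h0C, h0B⟩
  · intro z hz
    have h1 := (Φ₀.restrOpen s hso).map_target hz
    rw [OpenPartialHomeomorph.restrOpen_source] at h1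
    have h2 : F ((Φ₀.restrOpen s hso).symm z) = z := (Φ₀.restrOpen s hso).right_inv hz
    refine hB z ?_
    rw [← h2]
    exact h1.2.2
  · intro p hp hpΓ
    rw [OpenPartialHomeomorph.restrOpen_source] at hp
    refine hC _ hp.2.1 ?_
    have h1 : F p * exp (-(p.2 : 𝓐)) ∈ Γ :=
      mul_mem hpΓ (hΓ.exp_neg_mem (hΓ.exp_mem p.2.2))
    rwa [mul_assoc, exp_mul_exp_neg, mul_one] at h1

end IsClosedLinearGroup

end LinearGroup

/-! ## Compact groups without small subgroups are Lie groups -/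

section LieChart

open NormedSpace Topology

variable {G : Type*} [Group G] [TopologicalSpace G] {𝓐 : Type*} [NormedRing 𝓐]

theorem isClosedLinearGroup_mrange [CompactSpace G] {ρ : G →* 𝓐} (hρ : Continuous ρ) :
    IsClosedLinearGroup (MonoidHom.mrange ρ) where
  isClosed := by
    rw [MonoidHom.coe_mrange]
    exact (isCompact_range hρ).isClosed
  exists_inv := by
    rintro _ ⟨g, rfl⟩
    exact ⟨ρ g⁻¹, ⟨g⁻¹, rfl⟩, by rw [← map_mul, mul_inv_cancel, map_one]⟩

variable [NormedAlgebra ℝ 𝓐]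

/-- A chart around the identity of a group with a representation `ρ`, which is compatible with
`ρ`. -/
structure LieChart (ρ : G →* 𝓐) (E : Type*) [NormedAddCommGroup E] [NormedSpace ℝ E] where
  chart : OpenPartialHomeomorph G E
  log : 𝓐 → E
  exp : E → 𝓐
  one_mem : 1 ∈ chart.source
  chart_apply : ∀ x, chart x = log (ρ x)
  map_symm : ∀ Y, ρ (chart.symm Y) = exp Y
  contDiffAt_log : ∀ x ∈ chart.source, ContDiffAt ℝ ω log (ρ x)
  contDiff_exp : ContDiff ℝ ω exp

/-- In the local product coordinates, elements of the image of `ρ` have vanishing complement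
coordinate, so the Lie algebra coordinate is a chart. By compactness `ρ` is an embedding, which
carries the chart back to `G`. The function `log` lives on the ambient algebra, so that smoothness
can be checked there. -/
theorem exists_lieChart [FiniteDimensional ℝ 𝓐] [CompactSpace G] {ρ : G →* 𝓐} (hρ : Continuous ρ)
    (hinj : Function.Injective ρ) :
    ∃ d : ℕ, Nonempty (LieChart ρ (EuclideanSpace ℝ (Fin d))) := by
  have hcomplete : CompleteSpace 𝓐 := FiniteDimensional.complete ℝ 𝓐
  have hΓ := isClosedLinearGroup_mrange hρ
  obtain ⟨m', hm'⟩ := exists_isCompl hΓ.lieAlgebra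
  obtain ⟨Φ, hΦ, h0, hsm, hΦΓ⟩ := hΓ.exists_local_product hm'.symm
  let ℓ : hΓ.lieAlgebra ≃L[ℝ] EuclideanSpace ℝ (Fin (Module.finrank ℝ hΓ.lieAlgebra)) :=
    ContinuousLinearEquiv.ofFinrankEq (by simp)
  have hex : ∀ Y : hΓ.lieAlgebra, ∃ g, ρ g = NormedSpace.exp (Y : 𝓐) := fun Y => hΓ.exp_mem Y.2
  choose γ hγ using hex
  have hemb : IsEmbedding ρ := (hρ.isClosedEmbedding hinj).isEmbedding
  have hΦ0 : ∀ Y, Φ (0, Y) = NormedSpace.exp (Y : 𝓐) := fun Y => by simp [hΦ, exp_zero]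
  have hfst : ∀ g, ρ g ∈ Φ.target → (0, (Φ.symm (ρ g)).2) = Φ.symm (ρ g) := fun g hg =>
    Prod.ext (hΦΓ _ (Φ.map_target hg) (by rw [Φ.right_inv hg]; exact ⟨g, rfl⟩)).symm rfl
  have hγc : Continuous γ := by
    rw [hemb.continuous_iff]
    have : ρ ∘ γ = fun Y : hΓ.lieAlgebra => NormedSpace.exp (Y : 𝓐) := funext hγ
    rw [this]
    exact continuous_exp_real.comp continuous_subtype_val
  let e : OpenPartialHomeomorph G hΓ.lieAlgebra :=
    { toFun := fun g => (Φ.symm (ρ g)).2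
      invFun := γ
      source := ρ ⁻¹' Φ.target
      target := (fun Y => (0, Y)) ⁻¹' Φ.source
      map_source' := fun g hg => by
        change (0, (Φ.symm (ρ g)).2) ∈ Φ.source
        rw [hfst g hg]
        exact Φ.map_target hg
      map_target' := fun Y hY => by
        change ρ (γ Y) ∈ Φ.target
        rw [hγ, ← hΦ0]
        exact Φ.map_source hY
      left_inv' := fun g hg => hinj (by
        rw [hγ, ← hΦ0, hfst g hg, Φ.right_inv hg])
      right_inv' := fun Y hY => by
        rw [hγ, ← hΦ0, Φ.left_inv hY]
      open_source := Φ.open_target.preimage hρ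
      open_target := Φ.open_source.preimage (by fun_prop)
      continuousOn_toFun := continuous_snd.comp_continuousOn
        (Φ.continuousOn_symm.comp hρ.continuousOn fun _ h => h)
      continuousOn_invFun := hγc.continuousOn }
  refine ⟨_, ⟨
    { chart := e.transHomeomorph ℓ.toHomeomorph
      log := fun z => ℓ (Φ.symm z).2
      exp := fun v => NormedSpace.exp ((ℓ.symm v : hΓ.lieAlgebra) : 𝓐)
      one_mem := ?_
      chart_apply := fun x => rfl
      map_symm := fun Y => hγ _
      contDiffAt_log := fun x hx => ?_
      contDiff_exp := contDiff_exp_real.comp (hΓ.lieAlgebra.subtypeL.contDiff.comp ℓ.symm.contDiff) }⟩⟩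
  · change ρ 1 ∈ Φ.target
    have := Φ.map_source h0
    rw [show (0 : m' × hΓ.lieAlgebra) = (0, 0) from rfl, hΦ0] at this
    simpa [exp_zero] using this
  · exact ℓ.contDiff.contDiffAt.comp _ ((hsm _ hx).snd)

namespace LieChart

variable {ρ : G →* 𝓐} {E : Type*} [NormedAddCommGroup E] [NormedSpace ℝ E] [IsTopologicalGroup G]

/-- The left translate of the chart around the identity. -/
def translate (c : LieChart ρ E) (g : G) : OpenPartialHomeomorph G E :=
  (Homeomorph.mulLeft g⁻¹).transOpenPartialHomeomorph c.chart

theorem translate_apply (c : LieChart ρ E) (g x : G) :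
    c.translate g x = c.log (ρ g⁻¹ * ρ x) := by
  rw [← map_mul]; exact c.chart_apply _

theorem map_translate_symm (c : LieChart ρ E) (g : G) (Y : E) :
    ρ ((c.translate g).symm Y) = ρ g * c.exp Y := by
  rw [← c.map_symm, ← map_mul]
  change ρ (g⁻¹⁻¹ * c.chart.symm Y) = _
  rw [inv_inv]

/-- The atlas of left translates. -/
abbrev chartedSpace (c : LieChart ρ E) : ChartedSpace E G where
  atlas := Set.range c.translate
  chartAt := c.translate
  mem_chart_source g := by
    change g⁻¹ * g ∈ c.chart.source
    rw [inv_mul_cancel]; exact c.one_mem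
  chart_mem_atlas g := ⟨g, rfl⟩

/-- In terms of `ρ`, a transition map is an exponential, a left multiplication in the algebra and a
logarithm, all analytic where they are used. -/
theorem isManifold (c : LieChart ρ E) : @IsManifold ℝ _ E _ _ E _ 𝓘(ℝ, E) ∞ G _ c.chartedSpace := by
  let _ := c.chartedSpace
  refine isManifold_of_contDiffOn _ _ _ ?_
  rintro _ _ ⟨g, rfl⟩ ⟨g', rfl⟩ Y hY
  refine ContDiffAt.contDiffWithinAt ?_
  have h1 : (𝓘(ℝ, E) ∘ ((c.translate g).symm.trans (c.translate g')) ∘ 𝓘(ℝ, E).symm) =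
      fun Y => c.log (ρ g'⁻¹ * (ρ g * c.exp Y)) := by
    ext1 Y
    change c.translate g' ((c.translate g).symm Y) = _
    rw [translate_apply, map_translate_symm]
  rw [h1]
  have hY' : g'⁻¹ * (c.translate g).symm Y ∈ c.chart.source := hY.1.2
  have h2 := c.contDiffAt_log _ hY'
  rw [map_mul, map_translate_symm] at h2
  exact (h2.comp Y (contDiffAt_const.mul (contDiffAt_const.mul c.contDiff_exp.contDiffAt))).of_le
    (by simp)

theorem contMDiff_rep (c : LieChart ρ E) (hρ : Continuous ρ) :
    @ContMDiff ℝ _ E _ _ E _ 𝓘(ℝ, E) G _ c.chartedSpace 𝓐 _ _ 𝓐 _ 𝓘(ℝ, 𝓐) 𝓐 _ _ ∞ ρ := by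
  let _ := c.chartedSpace
  intro x
  refine contMDiffAt_iff.2 ⟨hρ.continuousAt, ContDiffAt.contDiffWithinAt ?_⟩
  have h1 : extChartAt 𝓘(ℝ, 𝓐) (ρ x) ∘ ρ ∘ (extChartAt 𝓘(ℝ, E) x).symm =
      fun Y => ρ x * c.exp Y := funext fun Y => c.map_translate_symm x Y
  rw [h1]
  exact (contDiffAt_const.mul c.contDiff_exp.contDiffAt).of_le (by simp)

/-- In the chart at `f p`, the map `f` becomes `log (ρ (f p)⁻¹ * ρ (f q))`, a smooth function of `ρ
(f q)`. Thus smoothness into `G` may be tested after `ρ`. -/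
theorem contMDiffAt_of_comp (c : LieChart ρ E) {F H M : Type*} [NormedAddCommGroup F]
    [NormedSpace ℝ F] [TopologicalSpace H] {I : ModelWithCorners ℝ F H} [TopologicalSpace M]
    [ChartedSpace H M] {f : M → G} {p : M} (hf : ContinuousAt f p)
    (hρf : ContMDiffAt I 𝓘(ℝ, 𝓐) ∞ (fun q => ρ (f q)) p) :
    @ContMDiffAt ℝ _ F _ _ H _ I M _ _ E _ _ E _ 𝓘(ℝ, E) G _ c.chartedSpace ∞ f p := by
  let _ := c.chartedSpace
  refine contMDiffAt_iff_target.2 ⟨hf, ?_⟩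
  have h1 : extChartAt 𝓘(ℝ, E) (f p) ∘ f = fun q => c.log (ρ (f p)⁻¹ * ρ (f q)) :=
    funext fun q => c.translate_apply _ _
  rw [h1]
  have h2 : ContDiffAt ℝ ∞ (fun z => c.log (ρ (f p)⁻¹ * z)) (ρ (f p)) := by
    refine ContDiffAt.comp (g := c.log) _ ?_ (contDiffAt_const.mul contDiffAt_id)
    have := c.contDiffAt_log 1 c.one_mem
    rw [← inv_mul_cancel (f p), map_mul] at this
    exact this.of_le (by simp)
  exact ContMDiffAt.comp (g := fun z => c.log (ρ (f p)⁻¹ * z)) p h2.contMDiffAt hρf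

/-- Tested after `ρ`, the group operations become multiplication and inversion in the algebra. -/
theorem lieGroup (c : LieChart ρ E) (hρ : Continuous ρ) [CompleteSpace 𝓐] :
    @LieGroup ℝ _ E _ E _ _ 𝓘(ℝ, E) ∞ G _ _ c.chartedSpace := by
  let _ := c.chartedSpace
  have := c.isManifold
  have hρs := c.contMDiff_rep hρ
  exact
    { contMDiff_mul := fun p => c.contMDiffAt_of_comp continuous_mul.continuousAt (by
        simp only [map_mul]
        have h1 : ContDiff ℝ ∞ (fun z : 𝓐 × 𝓐 => z.1 * z.2) := contDiff_mul
        exact h1.contMDiff.contMDiffAt.comp p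
          ((hρs.comp contMDiff_fst).prodMk_space (hρs.comp contMDiff_snd)).contMDiffAt)
      contMDiff_inv := fun x => c.contMDiffAt_of_comp continuous_inv.continuousAt (by
        have h1 : (fun y => ρ y⁻¹) = fun y => Ring.inverse (ρ y) := funext fun y =>
          (Ring.inverse_unit (⟨ρ y, ρ y⁻¹, by simp [← map_mul], by simp [← map_mul]⟩ : 𝓐ˣ)).symm
        rw [h1]
        have h2 := contDiffAt_ringInverse ℝ (n := ∞)
          (⟨ρ x, ρ x⁻¹, by simp [← map_mul], by simp [← map_mul]⟩ : 𝓐ˣ)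
        exact h2.contMDiffAt.comp x (hρs x)) }

end LieChart

end LieChart

/-- A compact Hausdorff group without small subgroups is a compact Lie group. -/
theorem NoSmallSubgroups.isCompactLieGroup {G : Type u} [Group G] [TopologicalSpace G]
    [IsTopologicalGroup G] [CompactSpace G] [T2Space G] (hG : NoSmallSubgroups G) :
    IsCompactLieGroup G := by
  obtain ⟨V, _, _, _, ρ, hρ, hinj⟩ := hG.exists_faithful_representation
  obtain ⟨d, ⟨c⟩⟩ := exists_lieChart hρ hinj
  have : CompleteSpace (V →L[ℝ] V) := FiniteDimensional.complete ℝ _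
  exact ⟨d, c.chartedSpace, c.lieGroup hρ⟩

/-! ## Absence of small subgroups -/

section NoSmallSubgroups

open Topology Filter

/-- In the chart at the identity, the derivative of squaring is multiplication by `2`. -/
theorem LieGroup.hasFDerivAt_sq {E : Type*} [NormedAddCommGroup E] [NormedSpace ℝ E] {M G : Type*}
    [TopologicalSpace M] (I : ModelWithCorners ℝ E M) [I.Boundaryless] [Group G]
    [TopologicalSpace G] [ChartedSpace M G] [LieGroup I ∞ G] :
    HasFDerivAt (fun x => extChartAt I (1 : G)
        ((extChartAt I (1 : G)).symm x * (extChartAt I (1 : G)).symm x))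
      ((2 : ℝ) • ContinuousLinearMap.id ℝ E) (extChartAt I (1 : G) 1) := by
  set e := extChartAt I (1 : G) with he
  set x₀ := e 1
  let m : E × E → E := fun p => e (e.symm p.1 * e.symm p.2)
  have hx₀ : e.symm x₀ = 1 := extChartAt_to_inv (I := I) (1 : G)
  have hm : DifferentiableAt ℝ m (x₀, x₀) := by
    have h1 := (contMDiffAt_iff.1 (contMDiff_mul I ∞ (G := G) (1, 1))).2
    rw [ModelWithCorners.range_eq_univ, contDiffWithinAt_univ, extChartAt_prod] at h1
    have h2 := h1.differentiableAt (by simp)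
    simp only [mul_one, ← he] at h2
    exact h2
  have hev : ∀ᶠ x in 𝓝 x₀, e (e.symm x) = x := by
    filter_upwards [extChartAt_target_mem_nhds (I := I) (1 : G)] with x hx using e.right_inv hx
  have h1 : HasFDerivAt m (fderiv ℝ m (x₀, x₀)) (x₀, x₀) := hm.hasFDerivAt
  have hl : ∀ v, fderiv ℝ m (x₀, x₀) (v, 0) = v := fun v => by
    have h2 : HasFDerivAt (fun x => m (x, x₀))
        ((fderiv ℝ m (x₀, x₀)).comp (ContinuousLinearMap.inl ℝ E E)) x₀ :=
      HasFDerivAt.comp (f := fun x => (x, x₀)) x₀ h1 (hasFDerivAt_prodMk_left x₀ x₀)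
    have h3 : HasFDerivAt (fun x => m (x, x₀)) (ContinuousLinearMap.id ℝ E) x₀ :=
      (hasFDerivAt_id x₀).congr_of_eventuallyEq (hev.mono fun x hx => by
        simp only [m, hx₀, mul_one, hx, id])
    exact congrArg (fun L : E →L[ℝ] E => L v) (h2.unique h3)
  have hr : ∀ v, fderiv ℝ m (x₀, x₀) (0, v) = v := fun v => by
    have h2 : HasFDerivAt (fun x => m (x₀, x))
        ((fderiv ℝ m (x₀, x₀)).comp (ContinuousLinearMap.inr ℝ E E)) x₀ :=
      HasFDerivAt.comp (f := fun x => (x₀, x)) x₀ h1 (hasFDerivAt_prodMk_right x₀ x₀)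
    have h3 : HasFDerivAt (fun x => m (x₀, x)) (ContinuousLinearMap.id ℝ E) x₀ :=
      (hasFDerivAt_id x₀).congr_of_eventuallyEq (hev.mono fun x hx => by
        simp only [m, hx₀, one_mul, hx, id])
    exact congrArg (fun L : E →L[ℝ] E => L v) (h2.unique h3)
  have h4 : HasFDerivAt (fun x => m (x, x)) ((fderiv ℝ m (x₀, x₀)).comp
      ((ContinuousLinearMap.id ℝ E).prod (ContinuousLinearMap.id ℝ E))) x₀ :=
    HasFDerivAt.comp (f := fun x => (x, x)) x₀ h1 ((hasFDerivAt_id x₀).prodMk (hasFDerivAt_id x₀))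
  -- Multiplication has derivative `(v, w) ↦ v + w` at the identity; squaring is multiplication
  -- composed with the diagonal.
  refine h4.congr_fderiv (ContinuousLinearMap.ext fun v => ?_)
  have h5 : ((v, v) : E × E) = (v, 0) + (0, v) := by simp
  change fderiv ℝ m (x₀, x₀) (v, v) = (2 : ℝ) • v
  rw [h5, map_add, hl, hr, two_smul]

/-- Since squaring has derivative `2` at the identity, it multiplies the distance to the identity in
a small chart by at least `3 / 2`. For `g ≠ 1` the powers `g ^ 2 ^ k` therefore cannot all stay in
the chart ball. -/
theorem LieGroup.noSmallSubgroups {E : Type*} [NormedAddCommGroup E] [NormedSpace ℝ E]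
    {M G : Type*} [TopologicalSpace M] (I : ModelWithCorners ℝ E M) [I.Boundaryless] [Group G]
    [TopologicalSpace G] [ChartedSpace M G] [LieGroup I ∞ G] : NoSmallSubgroups G := by
  have hq := LieGroup.hasFDerivAt_sq I (G := G)
  set e := extChartAt I (1 : G) with he
  set x₀ := e 1
  have hx₀ : e.symm x₀ = 1 := extChartAt_to_inv (I := I) (1 : G)
  -- An error of `1 / 2` leaves the expansion factor `2 - 1 / 2 = 3 / 2`.
  have h1 := hq.isLittleO.bound (c := 1 / 2) (by norm_num)
  obtain ⟨r, hr, hball⟩ := Metric.eventually_nhds_iff_ball.1 h1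
  refine ⟨e.source ∩ e ⁻¹' Metric.ball x₀ r, inter_mem (extChartAt_source_mem_nhds (I := I) (1 : G))
    ((continuousAt_extChartAt (I := I) (1 : G)).preimage_mem_nhds (Metric.ball_mem_nhds _ hr)),
    fun K hK => (Subgroup.eq_bot_iff_forall K).2 fun g hg => ?_⟩
  have hstep : ∀ a ∈ K, 3 / 2 * ‖e a - x₀‖ ≤ ‖e (a * a) - x₀‖ := fun a ha => by
    have h2 := hball (e a) (hK ha).2
    rw [e.left_inv (hK ha).1, hx₀, mul_one] at h2
    have h3 : ‖(2 : ℝ) • (e a - x₀)‖ ≤ ‖e (a * a) - x₀‖ +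
        ‖e (a * a) - x₀ - (2 : ℝ) • (e a - x₀)‖ := by
      have := norm_sub_le (e (a * a) - x₀) (e (a * a) - x₀ - (2 : ℝ) • (e a - x₀))
      rwa [sub_sub_cancel] at this
    rw [norm_smul, Real.norm_of_nonneg (by norm_num)] at h3
    have h4 : ‖e (a * a) - x₀ - (2 : ℝ) • (e a - x₀)‖ ≤ 1 / 2 * ‖e a - x₀‖ := h2
    linarith
  have hpow : ∀ k : ℕ, (3 / 2 : ℝ) ^ k * ‖e g - x₀‖ ≤ ‖e (g ^ 2 ^ k) - x₀‖ := fun k => by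
    induction k with
    | zero => simp
    | succ k ih =>
      have := hstep _ (pow_mem hg (2 ^ k))
      rw [← pow_add, ← two_mul, ← pow_succ'] at this
      rw [pow_succ']
      linarith
  have h0 : ‖e g - x₀‖ = 0 := by
    by_contra hne
    have hpos : 0 < ‖e g - x₀‖ := lt_of_le_of_ne (norm_nonneg _) (Ne.symm hne)
    obtain ⟨k, hk⟩ := pow_unbounded_of_one_lt (r / ‖e g - x₀‖) (by norm_num : (1 : ℝ) < 3 / 2)
    rw [div_lt_iff₀ hpos] at hk
    have h5 := (hK (pow_mem hg (2 ^ k))).2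
    rw [Set.mem_preimage, mem_ball_iff_norm] at h5
    linarith [hpow k]
  rw [norm_eq_zero, sub_eq_zero] at h0
  exact e.injOn (hK hg).1 (mem_extChartAt_source (I := I) (1 : G)) h0

theorem IsCompactLieGroup.noSmallSubgroups (G : Type u) [Group G] [TopologicalSpace G]
    [IsCompactLieGroup G] : NoSmallSubgroups G := by
  obtain ⟨d, _, _⟩ := IsCompactLieGroup.exists_lieGroup (G := G)
  exact LieGroup.noSmallSubgroups (𝓡 d)

namespace NoSmallSubgroups

variable {G H : Type*} [Group G] [TopologicalSpace G] [Group H] [TopologicalSpace H]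

theorem of_injective (hG : NoSmallSubgroups G) (φ : H →* G) (hφ : Continuous φ)
    (hinj : Function.Injective φ) : NoSmallSubgroups H := by
  obtain ⟨U, hU, h⟩ := hG
  refine ⟨φ ⁻¹' U, hφ.continuousAt.preimage_mem_nhds (by rwa [map_one]), fun K hK => ?_⟩
  rw [← K.map_eq_bot_iff_of_injective hinj]
  refine h _ ?_
  rintro _ ⟨k, hk, rfl⟩
  exact hK hk

theorem prod (hG : NoSmallSubgroups G) (hH : NoSmallSubgroups H) : NoSmallSubgroups (G × H) := by
  obtain ⟨U, hU, hUK⟩ := hG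
  obtain ⟨W, hW, hWK⟩ := hH
  refine ⟨U ×ˢ W, prod_mem_nhds hU hW, fun K hK => ?_⟩
  have h1 : K.map (MonoidHom.fst G H) = ⊥ := hUK _ (by
    rintro _ ⟨k, hk, rfl⟩
    exact (hK hk).1)
  have h2 : K.map (MonoidHom.snd G H) = ⊥ := hWK _ (by
    rintro _ ⟨k, hk, rfl⟩
    exact (hK hk).2)
  refine (Subgroup.eq_bot_iff_forall K).2 fun x hx => Prod.ext ?_ ?_
  · exact (Subgroup.eq_bot_iff_forall _).1 h1 _ ⟨x, hx, rfl⟩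
  · exact (Subgroup.eq_bot_iff_forall _).1 h2 _ ⟨x, hx, rfl⟩

/-- A small subgroup of the quotient lifts: near the identity the projection is injective and
products and inverses of lifts are again the lifts, so the lifts in `V` form a subgroup of `G`
inside `U`. -/
theorem quotient [IsTopologicalGroup G] (hG : NoSmallSubgroups G) (D : Subgroup G) [D.Normal]
    (hD : ∃ W ∈ 𝓝 (1 : G), ∀ x ∈ W, x ∈ D → x = 1) : NoSmallSubgroups (G ⧸ D) := by
  obtain ⟨U, hU, hUK⟩ := hG
  obtain ⟨W, hW, hWD⟩ := hD
  have hc : ∀ᶠ p : G × G × G in 𝓝 (1, 1, 1), (p.1 * p.2.1)⁻¹ * p.2.2 ∈ W := by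
    have : ContinuousAt (fun p : G × G × G => (p.1 * p.2.1)⁻¹ * p.2.2) (1, 1, 1) := by fun_prop
    exact this.preimage_mem_nhds (by simpa using hW)
  have hc' : ∀ᶠ p : G × G in 𝓝 (1, 1), p.1 * p.2 ∈ W := by
    have : ContinuousAt (fun p : G × G => p.1 * p.2) (1, 1) := by fun_prop
    exact this.preimage_mem_nhds (by simpa using hW)
  rw [nhds_prod_eq, nhds_prod_eq] at hc
  rw [nhds_prod_eq] at hc'
  obtain ⟨V₁, hV₁, hc1⟩ := (eventually_prod_self_iff (r := fun a b => a * b ∈ W)).1 hc'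
  obtain ⟨V₂, hV₂, V₃', hV₃', hc2⟩ := mem_prod_iff.1 hc
  obtain ⟨V₃, hV₃, V₄, hV₄, hc3⟩ := mem_prod_iff.1 hV₃'
  -- For `a`, `b`, `c` in `V`, both `(a * b)⁻¹ * c` and `a * c` lie in `W`, where the only element
  -- of `D` is `1`.
  let V := U ∩ V₁ ∩ V₂ ∩ V₃ ∩ V₄
  have hV : V ∈ 𝓝 (1 : G) := inter_mem (inter_mem (inter_mem (inter_mem hU hV₁) hV₂) hV₃) hV₄
  refine ⟨QuotientGroup.mk '' V, QuotientGroup.isOpenMap_coe.image_mem_nhds hV, fun K hK => ?_⟩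
  have hmul : ∀ a ∈ V, ∀ b ∈ V, ∀ c ∈ V, (c : G ⧸ D) = (a : G ⧸ D) * b → c = a * b := by
    intro a ha b hb c hc h
    have h1 : (a * b)⁻¹ * c ∈ W :=
      hc2 (show (a, b, c) ∈ V₂ ×ˢ V₃' from ⟨ha.1.1.2, hc3 ⟨hb.1.2, hc.2⟩⟩)
    exact (inv_mul_eq_one.1 (hWD _ h1 (QuotientGroup.eq.1 h.symm))).symm
  let K' : Subgroup G :=
    { carrier := {a | a ∈ V ∧ (a : G ⧸ D) ∈ K}
      one_mem' := ⟨mem_of_mem_nhds hV, one_mem K⟩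
      mul_mem' := by
        rintro a b ⟨ha, haK⟩ ⟨hb, hbK⟩
        have h1 : ((a * b : G) : G ⧸ D) ∈ K := mul_mem haK hbK
        obtain ⟨c, hc, hcab⟩ := hK h1
        refine ⟨?_, h1⟩
        rwa [← hmul a ha b hb c hc hcab]
      inv_mem' := by
        rintro a ⟨ha, haK⟩
        have h1 : ((a⁻¹ : G) : G ⧸ D) ∈ K := inv_mem haK
        obtain ⟨c, hc, hca⟩ := hK h1
        refine ⟨?_, h1⟩
        have h2 : a * c = 1 := hWD _ (hc1 a ha.1.1.1.2 c hc.1.1.1.2) (by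
          have := QuotientGroup.eq.1 hca.symm
          rwa [inv_inv] at this)
        rwa [← eq_inv_of_mul_eq_one_right h2] }
  have hK' : K' = ⊥ := hUK _ fun a ha => ha.1.1.1.1.1
  refine (Subgroup.eq_bot_iff_forall K).2 fun x hx => ?_
  obtain ⟨a, ha, rfl⟩ := hK hx
  rw [(Subgroup.eq_bot_iff_forall K').1 hK' a ⟨ha, hx⟩]
  rfl

theorem multiplicative (E : Type*) [NormedAddCommGroup E] [NormedSpace ℝ E] :
    NoSmallSubgroups (Multiplicative E) := by
  refine ⟨Multiplicative.toAdd ⁻¹' Metric.ball 0 1,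
    continuous_toAdd.continuousAt.preimage_mem_nhds (Metric.ball_mem_nhds _ one_pos),
    fun K hK => (Subgroup.eq_bot_iff_forall K).2 fun x hx => ?_⟩
  by_contra hne
  have hpos : 0 < ‖x.toAdd‖ := norm_pos_iff.2 hne
  obtain ⟨k, hk⟩ := exists_nat_gt (1 / ‖x.toAdd‖)
  rw [div_lt_iff₀ hpos] at hk
  have h1 := hK (pow_mem hx k)
  rw [Set.mem_preimage, mem_ball_zero_iff, toAdd_pow, ← Nat.cast_smul_eq_nsmul ℝ, norm_smul,
    Real.norm_natCast] at h1
  linarith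

end NoSmallSubgroups

/-- Cartan's closed subgroup theorem, in the compact case. -/
theorem IsCompactLieGroup.subgroup {G : Type u} [Group G] [TopologicalSpace G]
    [IsCompactLieGroup G] {H : Subgroup G} (hH : IsClosed (H : Set G)) : IsCompactLieGroup H :=
  have : CompactSpace H := isCompact_iff_compactSpace.1 hH.isCompact
  ((IsCompactLieGroup.noSmallSubgroups G).of_injective H.subtype continuous_subtype_val
    Subtype.val_injective).isCompactLieGroup

end NoSmallSubgroups

/-! ## `Λ_G(σ)` is a compact Lie group -/

section LambdaLie

open Topology

variable {G : Type u} [Group G] {n : ℕ} {σ : Fin n → G}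

/-- The generators `(σᵢ, -eᵢ)` of the relations of `Λ_G(σ)`. -/
def lambdaGen (hσ : ∀ i j, Commute (σ i) (σ j)) (i : Fin n) :
    centralizerOf σ × Multiplicative (Fin n → ℝ) :=
  (⟨σ i, Subgroup.mem_centralizer_iff.2 (by rintro _ ⟨j, rfl⟩; exact hσ j i)⟩,
    Multiplicative.ofAdd (-(Pi.single i 1)))

theorem commute_lambdaGen (hσ : ∀ i j, Commute (σ i) (σ j)) :
    Pairwise fun i j => ∀ x y : Multiplicative ℤ,
      Commute (zpowersHom _ (lambdaGen hσ i) x) (zpowersHom _ (lambdaGen hσ j) y) :=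
  fun i j _ x y =>
    have h : Commute (lambdaGen hσ i) (lambdaGen hσ j) :=
      Prod.ext (Subtype.ext (hσ i j)) (mul_comm _ _)
    h.zpow_zpow x.toAdd y.toAdd

/-- The homomorphism `ℤⁿ → C_G(σ) × ℝⁿ` with image the relations of `Λ_G(σ)`. -/
noncomputable def lambdaRelHom (hσ : ∀ i j, Commute (σ i) (σ j)) :
    (Fin n → Multiplicative ℤ) →* centralizerOf σ × Multiplicative (Fin n → ℝ) :=
  MonoidHom.noncommPiCoprod (fun i => zpowersHom _ (lambdaGen hσ i)) (commute_lambdaGen hσ)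

/-- The vector coordinate determines the integers `k`. Hence the relations form a discrete group,
and they can be used to move a vector by any integer vector. -/
theorem lambdaRelHom_snd (hσ : ∀ i j, Commute (σ i) (σ j)) (k : Fin n → Multiplicative ℤ) :
    (lambdaRelHom hσ k).2 = Multiplicative.ofAdd fun i => -((k i).toAdd : ℝ) := by
  let f : (Fin n → Multiplicative ℤ) →* Multiplicative (Fin n → ℝ) :=
    { toFun := fun k => Multiplicative.ofAdd fun i => -((k i).toAdd : ℝ)
      map_one' := by ext; simp
      map_mul' := fun a b => by
        refine congrArg Multiplicative.ofAdd (funext fun i => ?_)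
        change -(((a i).toAdd + (b i).toAdd : ℤ) : ℝ) = -((a i).toAdd : ℝ) + -((b i).toAdd : ℝ)
        push_cast; ring }
  have : (MonoidHom.snd _ _).comp (lambdaRelHom hσ) = f := MonoidHom.pi_ext fun i x => by
    change (lambdaRelHom hσ (Pi.mulSingle i x)).2 = _
    rw [lambdaRelHom, MonoidHom.noncommPiCoprod_mulSingle]
    refine Multiplicative.toAdd.injective (funext fun j => ?_)
    change x.toAdd • (-(Pi.single i 1 : Fin n → ℝ)) j =
      -((((Pi.mulSingle i x : Fin n → Multiplicative ℤ) j).toAdd : ℤ) : ℝ)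
    by_cases h : j = i
    · subst h; simp
    · simp [h]
  exact congrArg (fun g => g k) this

theorem range_lambdaRelHom (hσ : ∀ i j, Commute (σ i) (σ j)) :
    (lambdaRelHom hσ).range = lambdaRel σ := by
  refine le_antisymm ?_ ((Subgroup.closure_le _).2 ?_)
  · rw [lambdaRelHom, MonoidHom.noncommPiCoprod_range]
    refine iSup_le fun i => ?_
    rintro _ ⟨x, rfl⟩
    have h : lambdaGen hσ i ∈ lambdaRel σ := Subgroup.subset_closure ⟨i, rfl, rfl⟩
    exact zpow_mem h x.toAdd
  · rintro ⟨a, t⟩ ⟨i, ha, ht⟩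
    refine ⟨Pi.mulSingle i (Multiplicative.ofAdd 1), ?_⟩
    rw [lambdaRelHom, MonoidHom.noncommPiCoprod_mulSingle]
    refine Prod.ext (Subtype.ext ?_) ?_
    · rw [ha]; simp [lambdaGen]
    · rw [ht]; simp [lambdaGen]

variable [TopologicalSpace G]

theorem eq_one_of_mem_lambdaRel (hσ : ∀ i j, Commute (σ i) (σ j)) :
    ∃ W ∈ 𝓝 (1 : centralizerOf σ × Multiplicative (Fin n → ℝ)), ∀ x ∈ W, x ∈ lambdaRel σ → x = 1 := by
  refine ⟨(fun x => x.2.toAdd) ⁻¹' Metric.ball 0 1,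
    (continuous_toAdd.comp continuous_snd).continuousAt.preimage_mem_nhds
      (Metric.ball_mem_nhds _ one_pos), fun x hx hxr => ?_⟩
  rw [← range_lambdaRelHom hσ] at hxr
  obtain ⟨k, rfl⟩ := hxr
  have : k = 1 := funext fun i => Multiplicative.toAdd.injective (by
    have h1 := mem_ball_zero_iff.1 hx
    simp only [lambdaRelHom_snd] at h1
    have h2 := (norm_le_pi_norm _ i).trans_lt h1
    rw [toAdd_ofAdd, norm_neg, Real.norm_eq_abs, ← Int.cast_abs] at h2
    have h3 : |(k i).toAdd| < 1 := by exact_mod_cast h2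
    simpa using Int.abs_lt_one_iff.1 h3)
  rw [this, map_one]

variable [IsCompactLieGroup G]

theorem isClosed_centralizerOf (σ : Fin n → G) : IsClosed (centralizerOf σ : Set G) :=
  Set.isClosed_centralizer _

theorem isClosed_lambdaRel (hσ : ∀ i j, Commute (σ i) (σ j)) :
    IsClosed (lambdaRel σ : Set (centralizerOf σ × Multiplicative (Fin n → ℝ))) := by
  obtain ⟨W, hW, h⟩ := eq_one_of_mem_lambdaRel hσ
  have : DiscreteTopology (lambdaRel σ) := discreteTopology_of_isOpen_singleton_one (by
    rw [isOpen_singleton_iff_nhds_eq_pure]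
    refine le_antisymm ?_ (pure_le_nhds _)
    rw [nhds_subtype, Filter.le_pure_iff]
    exact ⟨W, hW, fun x hx => Subtype.ext (h _ hx x.2)⟩)
  have : T2Space (centralizerOf σ × Multiplicative (Fin n → ℝ)) := inferInstance
  exact Subgroup.isClosed_of_discrete

theorem compactSpace_lambdaGroup (hσ : ∀ i j, Commute (σ i) (σ j)) :
    CompactSpace (LambdaGroup σ) := by
  have hC : CompactSpace (centralizerOf σ) :=
    isCompact_iff_compactSpace.1 (isClosed_centralizerOf σ).isCompact
  have hI : IsCompact (Set.pi Set.univ fun _ : Fin n => Set.Icc (0 : ℝ) 1) :=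
    isCompact_univ_pi fun _ => isCompact_Icc
  have h1 : IsCompact ((Set.univ : Set (centralizerOf σ)) ×ˢ
      (Multiplicative.ofAdd '' Set.pi Set.univ fun _ : Fin n => Set.Icc (0 : ℝ) 1)) :=
    isCompact_univ.prod (hI.image continuous_ofAdd)
  have h2 := h1.image (QuotientGroup.continuous_mk (N := lambdaRel σ))
  refine ⟨h2.of_isClosed_subset isClosed_univ ?_⟩
  rintro ⟨a, t⟩ -
  -- The relation with exponents `k` has vector coordinate `-k`, so it moves `t` into the unit cube.
  -- Thus `Λ_G(σ)` is the image of the compact set `C_G(σ) × [0, 1]ⁿ`.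
  let k : Fin n → Multiplicative ℤ := fun i => Multiplicative.ofAdd ⌊t.toAdd i⌋
  refine ⟨(a, t) * lambdaRelHom hσ k, ⟨trivial, fun i => Int.fract (t.toAdd i), fun i _ =>
    ⟨Int.fract_nonneg _, (Int.fract_lt_one _).le⟩, ?_⟩, ?_⟩
  · rw [Prod.snd_mul, lambdaRelHom_snd]
    refine Multiplicative.toAdd.injective (funext fun i => ?_)
    change Int.fract (t.toAdd i) = t.toAdd i + -(⌊t.toAdd i⌋ : ℝ)
    rw [Int.fract, sub_eq_add_neg]
  · exact QuotientGroup.mk_mul_of_mem _ (range_lambdaRelHom hσ ▸ ⟨k, rfl⟩)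

/-- The group `C_G(σ) × ℝⁿ` need not be compact, so the criterion by small subgroups is applied to
the quotient itself. -/
theorem isCompactLieGroup_lambdaGroup (hσ : ∀ i j, Commute (σ i) (σ j)) :
    IsCompactLieGroup (LambdaGroup σ) := by
  have := isClosed_lambdaRel hσ
  have := compactSpace_lambdaGroup hσ
  have h1 := IsCompactLieGroup.subgroup (isClosed_centralizerOf σ)
  have h2 := ((IsCompactLieGroup.noSmallSubgroups (centralizerOf σ)).prod
    (NoSmallSubgroups.multiplicative (Fin n → ℝ))).quotient (lambdaRel σ)
    (eq_one_of_mem_lambdaRel hσ)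
  have h3 : T3Space (LambdaGroup σ) := QuotientGroup.instT3Space _
  exact h2.isCompactLieGroup

end LambdaLie

/-! ## Rigidity of commuting torsion tuples in closed subgroups -/

section Rigidity

open Topology Filter NormedSpace

/-- Maschke's argument: a projection onto `p` is averaged over `A`, and the kernel of the average is
the complement. -/
theorem exists_invariant_isCompl {A E : Type*} [Group A] [Finite A] [AddCommGroup E] [Module ℝ E]
    (π : A →* Module.End ℝ E) (p : Submodule ℝ E) (hp : ∀ a, ∀ x ∈ p, π a x ∈ p) :
    ∃ q : Submodule ℝ E, IsCompl q p ∧ ∀ a, ∀ x ∈ q, π a x ∈ q := by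
  have := Fintype.ofFinite A
  obtain ⟨f, hf⟩ := p.subtype.exists_leftInverse_of_injective p.ker_subtype
  have hf' : ∀ x (hx : x ∈ p), (f x : E) = x := fun x hx =>
    congrArg Subtype.val (LinearMap.congr_fun hf ⟨x, hx⟩)
  let Q : E →ₗ[ℝ] E := (Fintype.card A : ℝ)⁻¹ • ∑ a : A, π a ∘ₗ (p.subtype ∘ₗ f) ∘ₗ π a⁻¹
  have hQ : ∀ x, Q x = (Fintype.card A : ℝ)⁻¹ • ∑ a : A, π a (f (π a⁻¹ x)) := fun x => by
    simp [Q, LinearMap.sum_apply]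
  have hQp : ∀ x, Q x ∈ p := fun x => by
    rw [hQ]
    exact p.smul_mem _ (p.sum_mem fun a _ => hp a _ (f _).2)
  have hinv : ∀ a x, π a (π a⁻¹ x) = x := fun a x => by
    rw [← Module.End.mul_apply, ← map_mul, mul_inv_cancel, map_one, Module.End.one_apply]
  have hQid : ∀ x ∈ p, Q x = x := fun x hx => by
    rw [hQ, Finset.sum_congr rfl fun a _ => show π a (f (π a⁻¹ x)) = x by
      rw [hf' _ (hp _ _ hx), hinv]]
    rw [Finset.sum_const, Finset.card_univ, ← Nat.cast_smul_eq_nsmul ℝ, smul_smul,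
      inv_mul_cancel₀ (by simp), one_smul]
  have hQπ : ∀ b x, Q (π b x) = π b (Q x) := fun b x => by
    rw [hQ, hQ, map_smul, map_sum]
    congr 1
    refine Fintype.sum_equiv (Equiv.mulLeft b⁻¹) _ _ fun a => ?_
    simp only [Equiv.coe_mulLeft, mul_inv_rev, inv_inv, map_mul, Module.End.mul_apply, hinv]
  refine ⟨LinearMap.ker Q, ⟨?_, ?_⟩, fun a x hx => ?_⟩
  · exact Submodule.disjoint_def.2 fun x hx hxp => (hQid x hxp).symm.trans hx
  · refine codisjoint_iff.2 (eq_top_iff.2 fun x _ => Submodule.mem_sup.2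
      ⟨x - Q x, ?_, Q x, hQp x, sub_add_cancel _ _⟩)
    rw [LinearMap.mem_ker, map_sub, hQid _ (hQp x), sub_self]
  · rw [LinearMap.mem_ker] at hx ⊢
    rw [hQπ, hx, map_zero]

-- The generated group is abelian, finitely generated and torsion. This is where torsion enters,
-- through the averaging in `exists_invariant_isCompl`.
open scoped IsMulCommutative in
theorem IsCommutingTorsion.finite_closure {G : Type*} [Group G] {n : ℕ} {σ : Fin n → G}
    (hσ : IsCommutingTorsion σ) : Finite (Subgroup.closure (Set.range σ)) := by
  have hcomm : ∀ x ∈ Set.range σ, ∀ y ∈ Set.range σ, x * y = y * x := by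
    rintro _ ⟨i, rfl⟩ _ ⟨j, rfl⟩
    exact hσ.2 i j
  have := Subgroup.isMulCommutative_closure hcomm
  have : Finite (Set.range σ) := (Set.finite_range σ).to_subtype
  have htor : IsMulTorsion (Subgroup.closure (Set.range σ)) := by
    rintro ⟨x, hx⟩
    rw [← Submonoid.isOfFinOrder_coe]
    change IsOfFinOrder x
    induction hx using Subgroup.closure_induction with
    | mem x hx => obtain ⟨i, rfl⟩ := hx; exact hσ.1 i
    | one => exact IsOfFinOrder.one
    | mul x y hx hy h1 h2 =>
      refine Commute.isOfFinOrder_mul ?_ h1 h2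
      exact congrArg Subtype.val
        (mul_comm' (⟨x, hx⟩ : Subgroup.closure (Set.range σ)) ⟨y, hy⟩)
    | inv x hx h1 => exact h1.inv
  exact CommGroup.finite_of_fg_isMulTorsion _ htor

/-- The action of a group on an algebra by conjugation through a representation. -/
def conjRep {A 𝓐 : Type*} [Group A] [Ring 𝓐] [Algebra ℝ 𝓐] (ρ : A →* 𝓐) : A →* Module.End ℝ 𝓐 where
  toFun a := LinearMap.mulLeft ℝ (ρ a) ∘ₗ LinearMap.mulRight ℝ (ρ a⁻¹)
  map_one' := by ext; simp
  map_mul' a b := by ext; simp [mul_assoc]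

theorem conjRep_apply {A 𝓐 : Type*} [Group A] [Ring 𝓐] [Algebra ℝ 𝓐] (ρ : A →* 𝓐) (a : A) (x : 𝓐) :
    conjRep ρ a x = ρ a * x * ρ a⁻¹ := (mul_assoc _ _ _).symm

/-- If an element near `1` conjugates a commuting torsion tuple of a closed subgroup `H` into `H`,
then it does so up to an element of `H` by centralizing the tuple. -/
theorem eventually_mem_centralizerOf_mul {G : Type u} [Group G] [TopologicalSpace G]
    [IsCompactLieGroup G] {H : Subgroup G} (hH : IsClosed (H : Set G)) {n : ℕ} {σ : Fin n → G}
    (hσ : IsCommutingTorsion σ) (hσH : ∀ i, σ i ∈ H) :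
    ∀ᶠ g in 𝓝 (1 : G), (∀ i, g⁻¹ * σ i * g ∈ H) → ∃ h ∈ H, g * h ∈ centralizerOf σ := by
  obtain ⟨V, _, _, _, ρ, hρ, hinj⟩ :=
    (IsCompactLieGroup.noSmallSubgroups G).exists_faithful_representation
  have hcomplete : CompleteSpace (V →L[ℝ] V) := FiniteDimensional.complete ℝ _
  have hHc : CompactSpace H := isCompact_iff_compactSpace.1 hH.isCompact
  have hΓ := isClosedLinearGroup_mrange (ρ := ρ.comp H.subtype) (hρ.comp continuous_subtype_val)
  have hmemΓ : ∀ h ∈ H, ρ h ∈ MonoidHom.mrange (ρ.comp H.subtype) := fun h hh => ⟨⟨h, hh⟩, rfl⟩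
  have hρi : ∀ g, ρ g * ρ g⁻¹ = 1 := fun g => by rw [← map_mul, mul_inv_cancel, map_one]
  have hρi' : ∀ g, ρ g⁻¹ * ρ g = 1 := fun g => by rw [← map_mul, inv_mul_cancel, map_one]
  have hA := hσ.finite_closure
  have hAH : Subgroup.closure (Set.range σ) ≤ H := (Subgroup.closure_le _).2 (by
    rintro _ ⟨i, rfl⟩; exact hσH i)
  let π := conjRep (ρ.comp (Subgroup.closure (Set.range σ)).subtype)
  -- The complement `m` of the Lie algebra of `H` is taken invariant under conjugation by `σ`, so
  -- that conjugating `exp X` with `X ∈ m` gives the exponential of an element of `m`.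
  obtain ⟨m, hm, hmA⟩ := exists_invariant_isCompl π hΓ.lieAlgebra fun a X hX t => by
    have h1 : t • π a X = ρ a * (t • X) * ρ (a : G)⁻¹ := by
      rw [conjRep_apply, mul_smul_comm, smul_mul_assoc]; rfl
    rw [h1, exp_conj_of_mul_eq_one (hρi _) (hρi' _)]
    exact mul_mem (mul_mem (hmemΓ _ (hAH a.2)) (hX t)) (hmemΓ _ (inv_mem (hAH a.2)))
  have hmσ : ∀ i, ∀ X ∈ m, ρ (σ i) * X * ρ (σ i)⁻¹ ∈ m := fun i X hX => by
    have := hmA ⟨σ i, Subgroup.subset_closure ⟨i, rfl⟩⟩ X hX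
    rwa [conjRep_apply] at this
  obtain ⟨Φ, hΦ, h0, -, hΦΓ⟩ := hΓ.exists_local_product hm
  have hΦ0 : Φ 0 = 1 := by simp [hΦ, exp_zero]
  have hsymm1 : Φ.symm 1 = 0 := by rw [← hΦ0, Φ.left_inv h0]
  have h1t : (1 : V →L[ℝ] V) ∈ Φ.target := hΦ0 ▸ Φ.map_source h0
  let ad : Fin n → m → m := fun i X => ⟨ρ (σ i) * X * ρ (σ i)⁻¹, hmσ i X X.2⟩
  have hadc : ∀ i, Continuous (ad i) := fun i => by
    refine Continuous.subtype_mk ?_ _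
    fun_prop
  have had0 : ∀ i, ad i 0 = 0 := fun i => Subtype.ext (by simp [ad])
  let z : Fin n → m → (V →L[ℝ] V) := fun i X => exp (-(X : V →L[ℝ] V)) * exp (ad i X : V →L[ℝ] V)
  have hzc : ∀ i, Continuous (z i) := fun i =>
    (continuous_exp_real.comp continuous_subtype_val.neg).mul
      (continuous_exp_real.comp (continuous_subtype_val.comp (hadc i)))
  have hz0 : ∀ i, z i 0 = 1 := fun i => by simp [z, had0, exp_zero]
  have hsymmc : ContinuousAt Φ.symm 1 := Φ.continuousAt_symm h1t
  -- These conditions hold at `X = 0` and are open; they keep all points compared below inside the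
  -- domain of the local coordinates.
  have hev : ∀ i, ∀ᶠ X in 𝓝 (0 : m), (ad i X, (0 : hΓ.lieAlgebra)) ∈ Φ.source ∧
      z i X ∈ Φ.target ∧ (X, (Φ.symm (z i X)).2) ∈ Φ.source := fun i => by
    have c1 : ContinuousAt (fun X => (ad i X, (0 : hΓ.lieAlgebra))) (0 : m) :=
      ((hadc i).prodMk continuous_const).continuousAt
    have c2 : ContinuousAt (fun X => Φ.symm (z i X)) (0 : m) :=
      ContinuousAt.comp (g := Φ.symm) (by rwa [hz0]) (hzc i).continuousAt
    have c3 : ContinuousAt (fun X => (X, (Φ.symm (z i X)).2)) (0 : m) :=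
      continuousAt_id.prodMk (continuous_snd.continuousAt.comp c2)
    refine (c1.eventually_mem (Φ.open_source.mem_nhds ?_)).and
      (((hzc i).continuousAt.eventually_mem (Φ.open_target.mem_nhds ?_)).and
        (c3.eventually_mem (Φ.open_source.mem_nhds ?_)))
    · rw [had0]; exact h0
    · rw [hz0]; exact h1t
    · simp only [hz0, hsymm1]; exact h0
  have htend : Tendsto (fun g => (Φ.symm (ρ g)).1) (𝓝 1) (𝓝 0) := by
    have : ContinuousAt (fun g => (Φ.symm (ρ g)).1) 1 :=
      continuous_fst.continuousAt.comp
        (ContinuousAt.comp (g := Φ.symm) (by rwa [map_one]) hρ.continuousAt)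
    have h2 := this.tendsto
    rwa [map_one, hsymm1] at h2
  have htarget : ∀ᶠ g in 𝓝 (1 : G), ρ g ∈ Φ.target :=
    hρ.continuousAt.eventually_mem (Φ.open_target.mem_nhds (by rwa [map_one]))
  filter_upwards [htarget, htend.eventually (eventually_all.2 hev)] with g hg hgev hgσ
  set X := (Φ.symm (ρ g)).1
  set Y := (Φ.symm (ρ g)).2
  have hgXY : ρ g = exp (X : V →L[ℝ] V) * exp (Y : V →L[ℝ] V) := by
    rw [← hΦ, Φ.right_inv hg]
  obtain ⟨⟨h, hh⟩, hhY⟩ := hΓ.exp_mem Y.2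
  change ρ h = _ at hhY
  -- Removing the `H`-factor `exp Y = ρ h` leaves `g * h⁻¹`, with image `exp X`. It remains to see
  -- that `σ i` fixes `X`.
  have hc : ρ (g * h⁻¹) = exp (X : V →L[ℝ] V) := by
    rw [map_mul, hgXY, ← hhY, mul_assoc, hρi, mul_one]
  refine ⟨h⁻¹, inv_mem hh, Subgroup.mem_centralizer_iff.2 ?_⟩
  rintro _ ⟨i, rfl⟩
  obtain ⟨e1, e2, e3⟩ := hgev i
  have hconj : exp (ad i X : V →L[ℝ] V) = ρ (σ i * (g * h⁻¹) * (σ i)⁻¹) := by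
    rw [exp_conj_of_mul_eq_one (hρi _) (hρi' _), ← hc]
    simp only [map_mul]
  -- As `g * h⁻¹` also conjugates `σ i` into `H`, its commutator with `σ i` lies in `H`.
  have hzΓ : z i X ∈ MonoidHom.mrange (ρ.comp H.subtype) := by
    have h2 : exp (-(X : V →L[ℝ] V)) = ρ (g * h⁻¹)⁻¹ :=
      left_inv_eq_right_inv (exp_neg_mul_exp _) (by rw [← hc, hρi])
    change exp (-(X : V →L[ℝ] V)) * exp (ad i X : V →L[ℝ] V) ∈ _
    rw [hconj, h2, ← map_mul]
    refine hmemΓ _ ?_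
    have h3 : (g * h⁻¹)⁻¹ * (σ i * (g * h⁻¹) * (σ i)⁻¹) =
        h * (g⁻¹ * σ i * g) * h⁻¹ * (σ i)⁻¹ := by group
    rw [h3]
    exact mul_mem (mul_mem (mul_mem hh (hgσ i)) (inv_mem hh)) (inv_mem (hσH i))
  have hfst : (Φ.symm (z i X)).1 = 0 :=
    hΦΓ _ (Φ.map_target e2) (by rwa [Φ.right_inv e2])
  have hexpY : exp ((Φ.symm (z i X)).2 : V →L[ℝ] V) = z i X := by
    have h2 := Φ.right_inv e2
    rw [hΦ, hfst] at h2
    simpa [exp_zero] using h2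
  -- Both `(X, Y')` and `(ad i X, 0)` are coordinates of `exp (ad i X)`, where `exp Y' = z i X`.
  -- Uniqueness of coordinates gives `ad i X = X`.
  have heq : ((X, (Φ.symm (z i X)).2) : m × hΓ.lieAlgebra) = (ad i X, 0) := by
    refine Φ.injOn e3 e1 ?_
    rw [hΦ, hΦ]
    simp only [hexpY, z]
    rw [← mul_assoc, exp_mul_exp_neg]
    simp [exp_zero]
  have hX : ad i X = X := (congrArg Prod.fst heq).symm
  rw [hX, ← hc] at hconj
  exact (eq_mul_inv_iff_mul_eq.1 (hinj hconj)).symm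

end Rigidity

/-! ## Finite additivity and change of groups along quotient maps -/

theorem PairMap.ext_toMap {H G : Type u} [Group H] [TopologicalSpace H] [Group G]
    [TopologicalSpace G] {φ : H →ₜ* G} {P : GPair H} {Q : GPair G} {f g : PairMap φ P Q}
    (h : ∀ x, f.toMap x = g.toMap x) : f = g := by
  cases f; cases g
  congr
  exact ContinuousMap.ext h

/-- The inclusion of an invariant subset. -/
def subspaceIncl {G : Type u} [Group G] [TopologicalSpace G] (X : GSpace G) (A : Set X)
    (hA : ∀ (g : G) (x : X), x ∈ A → g • x ∈ A) :
    PairMap (ContinuousMonoidHom.id G) (X.subspace A hA).toPair X.toPair :=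
  PairMap.ofMap (X := X.subspace A hA) ⟨fun x : A => x.1, continuous_subtype_val⟩ fun _ _ => rfl

namespace EquivariantCohomologyTheory

open Topology

variable (E : EquivariantCohomologyTheory.{u, v})

/-! ### Maps with an inverse induce isomorphisms -/

section Functoriality

variable {H G : Type u} [Group H] [TopologicalSpace H] [Group G] [TopologicalSpace G]

theorem map_congr {φ φ' : H →ₜ* G} {P : GPair H} {Q : GPair G} (f : PairMap φ P Q)
    (f' : PairMap φ' P Q) (hφ : ∀ h, φ h = φ' h) (hf : ∀ x, f.toMap x = f'.toMap x) (k : ℤ) :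
    E.map f k = E.map f' k := by
  obtain rfl : φ = φ' := ContinuousMonoidHom.ext hφ
  rw [PairMap.ext_toMap hf]

theorem bijective_map_of_inverse [IsCompactLieGroup H] [IsCompactLieGroup G] {φ : H →ₜ* G}
    {ψ : G →ₜ* H} {P : GPair H} {Q : GPair G} (f : PairMap φ P Q) (g : PairMap ψ Q P)
    (h1 : ∀ x, φ (ψ x) = x) (h2 : ∀ x, ψ (φ x) = x) (h3 : ∀ x, f.toMap (g.toMap x) = x)
    (h4 : ∀ x, g.toMap (f.toMap x) = x) (k : ℤ) : Function.Bijective (E.map f k) := by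
  refine Function.bijective_iff_has_inverse.2 ⟨E.map g k, fun a => ?_, fun a => ?_⟩
  · rw [← E.map_comp, E.map_congr _ (PairMap.id Q) h1 h3, E.map_id]
  · rw [← E.map_comp, E.map_congr _ (PairMap.id P) h2 h4, E.map_id]

theorem bijective_map_of_homeomorph [IsCompactLieGroup G] {X Y : GSpace G}
    (f : PairMap (ContinuousMonoidHom.id G) X.toPair Y.toPair) (e : X ≃ₜ Y)
    (he : ∀ x, e x = f.toMap x) (k : ℤ) : Function.Bijective (E.map f k) := by
  refine E.bijective_map_of_inverse f (PairMap.ofMap (φ := ContinuousMonoidHom.id G)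
    (X := Y) (Y := X) ⟨e.symm, e.symm.continuous⟩ fun g y => ?_) (fun _ => rfl) (fun _ => rfl)
    (fun x => ?_) (fun x => ?_) k
  · refine e.injective ?_
    change e (e.symm (g • y)) = e (g • e.symm y)
    rw [he (g • e.symm y)]
    refine (e.apply_symm_apply _).trans ((f.map_smul g (e.symm y)).trans ?_).symm
    rw [← he]
    exact congrArg (g • ·) (e.apply_symm_apply y)
  · exact (he _).symm.trans (e.apply_symm_apply x)
  · exact (congrArg e.symm (he x)).symm.trans (e.symm_apply_apply x)

end Functoriality

/-! ### Additivity for finite open decompositions -/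

section Additivity

variable {G : Type u} [Group G] [TopologicalSpace G] [IsCompactLieGroup G]

/-- For the pair `(X, ∅)` the map `toRel` is the identity, so by exactness restriction to the empty
subspace is zero. If `X` is empty, the identity factors through that restriction. -/
theorem subsingleton_of_isEmpty (X : GSpace G) [IsEmpty X] (k : ℤ) : Subsingleton (E.abs X k) := by
  refine subsingleton_of_forall_eq 0 fun a => ?_
  have h1 : E.map (PairMap.subIncl X.toPair) k a = 0 :=
    (E.exact_space X.toPair k a).2 ⟨a, E.map_id X.toPair k a⟩
  let f : PairMap (ContinuousMonoidHom.id G) X.toPair X.toPair.subSpace.toPair :=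
    PairMap.ofMap (X := X) (Y := X.toPair.subSpace)
      ⟨fun x => isEmptyElim x, continuous_iff_continuousAt.2 fun x => isEmptyElim x⟩
      fun _ x => isEmptyElim x
  have h2 := E.map_comp (PairMap.subIncl X.toPair) f k a
  rw [h1, map_zero] at h2
  have h3 := E.map_congr ((PairMap.subIncl X.toPair).comp f) (PairMap.id X.toPair) (fun _ => rfl)
    (fun x => (IsEmpty.false (show X.carrier from x)).elim) k
  exact (E.map_id X.toPair k a).symm.trans ((congrArg (fun F : _ →+ _ => F a) h3).symm.trans h2)

/-- The map from a clopen complement to the relative group is an isomorphism. -/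
theorem bijective_map_compl_toRel (X : GSpace G) (A : Set X) (hA : IsClopen A)
    (hAG : ∀ (g : G) (x : X), x ∈ A → g • x ∈ A) (hAG' : ∀ (g : G) (x : X), x ∈ Aᶜ → g • x ∈ Aᶜ)
    (k : ℤ) :
    Function.Bijective fun b => E.map (subspaceIncl X Aᶜ hAG') k
      (E.map (PairMap.toRel ⟨X, A, hAG⟩) k b) := by
  classical
  let P : GPair G := ⟨X, A, hAG⟩
  -- All of `A` is excised; as `A` is clopen, the indicator of its complement is a separating
  -- function.
  let w : C(X, unitInterval) := ⟨fun x => if x ∈ A then 0 else 1,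
    IsLocallyConstant.continuous (f := fun x => if x ∈ A then (0 : unitInterval) else 1)
      ((IsLocallyConstant.iff_exists_open _).2 fun x => by
        by_cases hx : x ∈ A
        · exact ⟨A, hA.isOpen, hx, fun y hy => by rw [if_pos hx, if_pos hy]⟩
        · exact ⟨Aᶜ, hA.compl.isOpen, hx, fun y hy => by rw [if_neg hx, if_neg hy]⟩)⟩
  have hw : ∀ (g : G) x, w (g • x) = w x := fun g x => by
    by_cases hx : x ∈ A
    · simp [w, hx, hAG g x hx]
    · have : g • x ∉ A := hAG' g x hx
      simp [w, hx, this]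
  have h1 := E.excision P A hAG w hw (fun x hx => by simp [w, hx])
    (fun x hx => by
      have : x ∉ A := hx
      simp [w, this]) k
  -- After excision the relative part is empty, though not literally `∅`; `u` and `u'` pass between
  -- the two descriptions.
  let u : PairMap (ContinuousMonoidHom.id G) (X.subspace Aᶜ hAG').toPair (P.excise A hAG) :=
    { toMap := ContinuousMap.id _
      map_smul := fun _ _ => rfl
      map_sub := fun _ h => h.elim }
  let u' : PairMap (ContinuousMonoidHom.id G) (P.excise A hAG) (X.subspace Aᶜ hAG').toPair :=
    { toMap := ContinuousMap.id _
      map_smul := fun _ _ => rfl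
      map_sub := fun x h => (x.2 h).elim }
  have h2 := E.bijective_map_of_inverse u u' (fun _ => rfl) (fun _ => rfl) (fun _ => rfl)
    (fun _ => rfl) k
  have h3 : (fun b => E.map (subspaceIncl X Aᶜ hAG') k (E.map (PairMap.toRel P) k b)) =
      E.map u k ∘ E.map (PairMap.exciseIncl P A hAG) k := funext fun b => by
    rw [Function.comp_apply, ← E.map_comp, ← E.map_comp]
    exact congrArg (fun F : _ →+ _ => F b)
      (E.map_congr _ _ (fun _ => rfl) (fun _ => rfl) k)
  rw [h3]
  exact h2.comp h1

/-- Restriction to `Aᶜ` splits the exact sequence of `(X, A)`, since the composite `E(X, A) → E(X) →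
E(Aᶜ)` is an isomorphism. -/
theorem bijective_prod_of_isClopen (X : GSpace G) (A : Set X) (hA : IsClopen A)
    (hAG : ∀ (g : G) (x : X), x ∈ A → g • x ∈ A) (hAG' : ∀ (g : G) (x : X), x ∈ Aᶜ → g • x ∈ Aᶜ)
    (k : ℤ) :
    Function.Bijective fun a : E.abs X k =>
      (E.map (subspaceIncl X A hAG) k a, E.map (subspaceIncl X Aᶜ hAG') k a) := by
  have hθ := E.bijective_map_compl_toRel X A hA hAG hAG'
  let P : GPair G := ⟨X, A, hAG⟩
  have hex : Function.Exact (E.map (PairMap.toRel P) k) (E.map (subspaceIncl X A hAG) k) :=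
    E.exact_space P k
  have hex' : Function.Exact (E.map (subspaceIncl X A hAG) k) (E.δ P k) := E.exact_sub P k
  constructor
  · intro a a' h
    obtain ⟨h1, h2⟩ := Prod.ext_iff.1 h
    simp only at h1 h2
    obtain ⟨b, hb⟩ := (hex (a - a')).1 (by rw [map_sub, h1, sub_self])
    have hb0 : b = 0 := (hθ k).1 (by
      change E.map (subspaceIncl X Aᶜ hAG') k (E.map (PairMap.toRel P) k b) =
        E.map (subspaceIncl X Aᶜ hAG') k (E.map (PairMap.toRel P) k 0)
      rw [hb, map_sub, h2, sub_self, map_zero, map_zero])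
    rw [hb0, map_zero] at hb
    exact sub_eq_zero.1 hb.symm
  · rintro ⟨α, β⟩
    -- The class `δ α` dies in `E(X)`, while `E(X, A) → E(X)` is injective.
    have h1 : E.δ P k α = 0 := (hθ (k + 1)).1
      (congrArg (E.map (subspaceIncl X Aᶜ hAG') (k + 1))
        (((E.exact_rel P k).apply_apply_eq_zero α).trans (map_zero _).symm))
    obtain ⟨a₀, rfl⟩ := (hex' α).1 h1
    obtain ⟨b, hb⟩ := (hθ k).2 (β - E.map (subspaceIncl X Aᶜ hAG') k a₀)
    refine ⟨a₀ + E.map (PairMap.toRel P) k b, Prod.ext ?_ ?_⟩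
    · simp only [map_add]
      rw [hex.apply_apply_eq_zero, add_zero]
    · simp only [map_add]
      exact (congrArg (_ + ·) hb).trans (add_sub_cancel _ _)

/-- A theory is additive for finite decompositions into open invariant subspaces. -/
theorem bijective_pi_of_isOpenEmbedding {ι : Type*} [Finite ι] (k : ℤ) :
    ∀ (X : GSpace G) (Y : ι → GSpace G)
      (f : ∀ i, PairMap (ContinuousMonoidHom.id G) (Y i).toPair X.toPair)
      (_ : ∀ i, IsOpenEmbedding (f i).toMap)
      (_ : ∀ i j y z, (f i).toMap y = (f j).toMap z → i = j) (_ : ∀ x, ∃ i y, (f i).toMap y = x),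
      Function.Bijective fun (a : E.abs X k) (i : ι) => E.map (f i) k a := by
  induction ι using Finite.induction_empty_option with
  | of_equiv e ih =>
    intro X Y f hf hdis hcov
    have h1 := ih X (fun i => Y (e i)) (fun i => f (e i)) (fun i => hf _)
      (fun i j y z h => e.injective (hdis _ _ y z h)) (fun x => by
        obtain ⟨i, y, rfl⟩ := hcov x
        obtain ⟨i, rfl⟩ := e.surjective i
        exact ⟨i, y, rfl⟩)
    refine ⟨fun a a' h => h1.1 (funext fun i => congrFun h (e i)), fun t => ?_⟩
    obtain ⟨a, ha⟩ := h1.2 fun i => t (e i)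
    refine ⟨a, funext fun j => ?_⟩
    obtain ⟨i, rfl⟩ := e.surjective j
    exact congrFun ha i
  | h_empty =>
    intro X Y f _ _ hcov
    have : IsEmpty X := ⟨fun x => (hcov x).choose.elim⟩
    have := E.subsingleton_of_isEmpty X k
    exact ⟨fun a a' _ => Subsingleton.elim _ _, fun t => ⟨0, funext fun i => i.elim⟩⟩
  | h_option ih =>
    rename_i α _
    intro X Y f hf hdis hcov
    -- One piece is split off. It is clopen because its complement is the union of the other open
    -- pieces.
    let A : Set X := Set.range (f none).toMap
    have hAc : Aᶜ = ⋃ i : α, Set.range (f (some i)).toMap := by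
      refine Set.ext fun x => ⟨fun hx => ?_, fun hx => ?_⟩
      · obtain ⟨_ | i, y, rfl⟩ := hcov x
        · exact (hx ⟨y, rfl⟩).elim
        · exact Set.mem_iUnion.2 ⟨i, y, rfl⟩
      · obtain ⟨i, y, rfl⟩ := Set.mem_iUnion.1 hx
        rintro ⟨z, hz⟩
        exact Option.some_ne_none _ (hdis _ _ _ _ hz).symm
    have hA : IsClopen A := ⟨isOpen_compl_iff.1 (by
      rw [hAc]; exact isOpen_iUnion fun i => (hf _).isOpen_range), (hf none).isOpen_range⟩
    have hAG : ∀ (g : G) (x : X), x ∈ A → g • x ∈ A := by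
      rintro g _ ⟨y, rfl⟩
      exact ⟨g • y, (f none).map_smul g y⟩
    have hAG' : ∀ (g : G) (x : X), x ∈ Aᶜ → g • x ∈ Aᶜ := fun g x hx hgx =>
      hx (by simpa only [inv_smul_smul] using hAG g⁻¹ (g • x) hgx)
    have hmem : ∀ (i : α) y, (f (some i)).toMap y ∈ Aᶜ := fun i y => by
      rw [hAc]; exact Set.mem_iUnion.2 ⟨i, y, rfl⟩
    let f' : ∀ i : α, PairMap (ContinuousMonoidHom.id G) (Y (some i)).toPair
        (X.subspace Aᶜ hAG').toPair := fun i =>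
      PairMap.ofMap (X := Y (some i)) (Y := X.subspace Aᶜ hAG')
        ⟨fun y => (⟨(f (some i)).toMap y, hmem i y⟩ : (Aᶜ : Set X)),
          (f (some i)).toMap.continuous.subtype_mk _⟩
        fun g y => Subtype.ext ((f (some i)).map_smul g y)
    have h1 := ih (X.subspace Aᶜ hAG') (fun i => Y (some i)) f'
      (fun i => IsOpenEmbedding.of_comp (f := (f' i).toMap)
        (g := (Subtype.val : (Aᶜ : Set X) → X)) hA.compl.isOpen.isOpenEmbedding_subtypeVal
          (hf (some i)))
      (fun i j y z h => Option.some_injective _ (hdis _ _ y z (congrArg Subtype.val h)))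
      (fun x => by
        obtain ⟨_ | i, y, hy⟩ := hcov x.1
        · exact (x.2 ⟨y, hy⟩).elim
        · exact ⟨i, y, Subtype.ext hy⟩)
    let f₀ : PairMap (ContinuousMonoidHom.id G) (Y none).toPair (X.subspace A hAG).toPair :=
      PairMap.ofMap (X := Y none) (Y := X.subspace A hAG)
        ⟨fun y => (⟨(f none).toMap y, ⟨y, rfl⟩⟩ : A), (f none).toMap.continuous.subtype_mk _⟩
        fun g y => Subtype.ext ((f none).map_smul g y)
    have h0 : Function.Bijective (E.map f₀ k) :=
      E.bijective_map_of_homeomorph f₀ (hf none).isEmbedding.toHomeomorph (fun _ => rfl) k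
    have h2 := E.bijective_prod_of_isClopen X A hA hAG hAG' k
    have hnone : ∀ a : E.abs X k, E.map (f none) k a =
        E.map f₀ k (E.map (subspaceIncl X A hAG) k a) := fun a => by
      rw [← E.map_comp]
      exact congrArg (fun F : _ →+ _ => F a) (E.map_congr _ _ (fun _ => rfl) (fun _ => rfl) k)
    have hsome : ∀ (i : α) (a : E.abs X k), E.map (f (some i)) k a =
        E.map (f' i) k (E.map (subspaceIncl X Aᶜ hAG') k a) := fun i a => by
      rw [← E.map_comp]
      exact congrArg (fun F : _ →+ _ => F a) (E.map_congr _ _ (fun _ => rfl) (fun _ => rfl) k)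
    constructor
    · intro a a' h
      refine h2.1 (Prod.ext (h0.1 ?_) (h1.1 (funext fun i => ?_)))
      · have := congrFun h none
        simpa only [hnone] using this
      · have := congrFun h (some i)
        simpa only [hsome] using this
    · intro t
      obtain ⟨α', hα⟩ := h0.2 (t none)
      obtain ⟨β', hβ⟩ := h1.2 fun i => t (some i)
      obtain ⟨a, ha⟩ := h2.2 (α', β')
      obtain ⟨ha1, ha2⟩ := Prod.ext_iff.1 ha
      simp only at ha1 ha2
      refine ⟨a, funext fun i => ?_⟩
      cases i with
      | none => exact (hnone a).trans (by rw [ha1, hα])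
      | some i => exact (hsome i a).trans (by rw [ha2]; exact congrFun hβ i)

end Additivity

end EquivariantCohomologyTheory

/-! ### Change of groups for disjoint unions of balanced products -/

section OrbitDecomposition

open Topology

/-- The inverse of an injective homomorphism of compact groups, on its image. -/
theorem exists_continuous_inverse_range {K L : Type*} [Group K] [TopologicalSpace K]
    [CompactSpace K] [Group L] [TopologicalSpace L] [T2Space L] (φ : K →ₜ* L)
    (hφ : Function.Injective φ) :
    ∃ (M : Subgroup L) (ψ : K →ₜ* M) (ψ' : M →ₜ* K), IsClosed (M : Set L) ∧
      (∀ x, (ψ x : L) = φ x) ∧ (∀ x, ψ (ψ' x) = x) ∧ ∀ x, ψ' (ψ x) = x := by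
  let e : K ≃* φ.toMonoidHom.range := MonoidHom.ofInjective hφ
  have he : Continuous e := (map_continuous φ).subtype_mk _
  let h : K ≃ₜ φ.toMonoidHom.range := he.homeoOfEquivCompactToT2 (f := e.toEquiv)
  exact ⟨_, ⟨e.toMonoidHom, he⟩, ⟨e.symm.toMonoidHom, h.symm.continuous⟩, by
    rw [MonoidHom.coe_range]
    exact (isCompact_range (map_continuous φ)).isClosed, fun _ => rfl, e.apply_symm_apply, e.symm_apply_apply⟩

/-- The map `L × Z → Y`, `(l, z) ↦ l f(z)`, for a map `f` from a `K`-space to an `L`-space. -/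
def PairMap.orbitMap {K L : Type u} [Group K] [TopologicalSpace K] [Group L] [TopologicalSpace L]
    {φ : K →ₜ* L} {Z : GSpace K} {Y : GSpace L} (f : PairMap φ Z.toPair Y.toPair) (p : L × Z) : Y :=
  p.1 • (show Y from f.toMap p.2)

namespace EquivariantCohomologyTheory

variable {E : EquivariantCohomologyTheory.{u, v}} (hE : E.HasChangeOfGroup)
include hE

/-- If `Y` is the balanced product of a `K`-space `Z` along an injective homomorphism
`φ : K → L`, then restriction to `Z` is an isomorphism. -/
theorem HasChangeOfGroup.bijective_map_of_isQuotientMap {K L : Type u} [Group K]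
    [TopologicalSpace K] [IsCompactLieGroup K] [Group L] [TopologicalSpace L] [IsCompactLieGroup L]
    {φ : K →ₜ* L} (hφ : Function.Injective φ) {Z : GSpace K} {Y : GSpace L}
    (f : PairMap φ Z.toPair Y.toPair)
    (hq : IsQuotientMap f.orbitMap)
    (hfib : ∀ (l l' : L) (z z' : Z), f.orbitMap (l, z) = f.orbitMap (l', z') →
      ∃ k : K, l' = l * (φ k)⁻¹ ∧ z' = k • z) (k : ℤ) : Function.Bijective (E.map f k) := by
  obtain ⟨M, ψ, ψ', hM, hψ, hψψ', hψ'ψ⟩ := exists_continuous_inverse_range φ hφ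
  have hMlie : IsCompactLieGroup M := IsCompactLieGroup.subgroup hM
  -- The hypothesis on `E` speaks of closed subgroups, so `K` is replaced by its image `M` and `Z`
  -- by the same space with `M` acting through `ψ'`.
  let Z' : GSpace M := Z.res ψ'
  have hsmul : ∀ (m : M) (z : Z), f.toMap (ψ' m • z) = (m : L) • (show Y from f.toMap z) :=
    fun m z => by
      rw [← hψψ' m, hψ'ψ, hψ]
      exact f.map_smul _ _
  let v : PairMap ψ Z.toPair Z'.toPair :=
    PairMap.ofMap (X := Z) (Y := Z') (ContinuousMap.id Z) fun h z => by
      change h • z = ψ' (ψ h) • z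
      rw [hψ'ψ]
  have hv : Function.Bijective (E.map v k) :=
    E.bijective_map_of_inverse v (PairMap.ofRes ψ' Z) hψψ' hψ'ψ (fun _ => rfl) (fun _ => rfl) k
  let F₀ : BalancedProduct M Z' → Y :=
    Quotient.lift f.orbitMap (by
      rintro p _ ⟨h, rfl⟩
      change p.1 • (show Y from f.toMap p.2) =
        (p.1 * (h : L)⁻¹) • (show Y from f.toMap (ψ' h • (show Z from p.2)))
      rw [hsmul, smul_smul, inv_mul_cancel_right])
  have hF₀ : Continuous F₀ := hq.continuous.quotient_lift _
  have hbij : Function.Bijective F₀ := by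
    constructor
    · rintro ⟨l, z⟩ ⟨l', z'⟩ h
      obtain ⟨a, h1, h2⟩ := hfib l l' z z' h
      refine Quotient.sound ⟨ψ a, Prod.ext ?_ ?_⟩
      · change l' = l * (ψ a : L)⁻¹
        rw [hψ]; exact h1
      · change z' = ψ' (ψ a) • (show Z from z)
        rw [hψ'ψ]
        exact h2
    · intro y
      obtain ⟨p, rfl⟩ := hq.surjective y
      exact ⟨Quotient.mk _ p, rfl⟩
  -- Both sides are quotients of `L × Z` with the same fibres.
  let e : (Z'.induced M) ≃ₜ Y :=
    { Equiv.ofBijective F₀ hbij with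
      continuous_toFun := hF₀
      continuous_invFun := by
        refine hq.continuous_iff.2 ?_
        have : (Equiv.ofBijective F₀ hbij).symm ∘ f.orbitMap = Quotient.mk (balancedSetoid M Z') :=
          funext fun p => (Equiv.ofBijective F₀ hbij).symm_apply_apply (Quotient.mk _ p)
        change Continuous ((Equiv.ofBijective F₀ hbij).symm ∘ _)
        rw [this]
        exact continuous_quot_mk }
  let F : PairMap (ContinuousMonoidHom.id L) (Z'.induced M).toPair Y.toPair :=
    PairMap.ofMap (X := Z'.induced M) ⟨F₀, hF₀⟩ (by
      rintro l ⟨l', z⟩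
      exact mul_smul l l' (show Y from f.toMap z))
  have hF : Function.Bijective (E.map F k) := E.bijective_map_of_homeomorph F e (fun _ => rfl) k
  have h3 : ⇑(E.map f k) = E.map v k ∘ E.changeOfGroup M Z' k ∘ E.map F k := funext fun a => by
    simp only [Function.comp_apply, changeOfGroup, AddMonoidHom.comp_apply, pullback, restrict]
    rw [← E.map_comp, ← E.map_comp, ← E.map_comp]
    refine congrArg (fun F : _ →+ _ => F a) (E.map_congr _ _ (fun x => (hψ x).symm) (fun z => ?_) k)
    exact (one_smul L (show Y from f.toMap z)).symm
  rw [h3]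
  exact hv.comp ((hE L M hM Z' k).comp hF)

/-- If `Y` is a finite disjoint union of open subspaces that are balanced products of
`Kᵢ`-spaces `Zᵢ`, then restriction to the `Zᵢ` is an isomorphism onto the product. -/
theorem HasChangeOfGroup.bijective_pi {L : Type u} [Group L] [TopologicalSpace L]
    [IsCompactLieGroup L] {ι : Type*} [Finite ι] {K : ι → Type u} [∀ i, Group (K i)]
    [∀ i, TopologicalSpace (K i)] [∀ i, IsCompactLieGroup (K i)] {φ : ∀ i, K i →ₜ* L}
    (hφ : ∀ i, Function.Injective (φ i)) {Z : ∀ i, GSpace (K i)} {Y : GSpace L}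
    (f : ∀ i, PairMap (φ i) (Z i).toPair Y.toPair)
    (hopen : ∀ i, IsOpen (Set.range (f i).orbitMap))
    (hq : ∀ i, IsQuotientMap (Set.rangeFactorization (f i).orbitMap))
    (hfib : ∀ i (l l' : L) (z z' : Z i),
      (f i).orbitMap (l, z) = (f i).orbitMap (l', z') →
        ∃ k : K i, l' = l * (φ i k)⁻¹ ∧ z' = k • z)
    (hdis : ∀ i j (l l' : L) (z : Z i) (z' : Z j),
      (f i).orbitMap (l, z) = (f j).orbitMap (l', z') → i = j)
    (hcov : ∀ y : Y, ∃ (i : ι) (l : L) (z : Z i), (f i).orbitMap (l, z) = y) (k : ℤ) :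
    Function.Bijective fun (a : E.abs Y k) i => E.map (f i) k a := by
  let A : ι → Set Y := fun i => Set.range (f i).orbitMap
  have hA : ∀ i (l : L) (y : Y), y ∈ A i → l • y ∈ A i := by
    rintro i l _ ⟨p, rfl⟩
    exact ⟨(l * p.1, p.2), mul_smul _ _ _⟩
  let incl := fun i => subspaceIncl Y (A i) (hA i)
  have h1 := E.bijective_pi_of_isOpenEmbedding k Y (fun i => Y.subspace (A i) (hA i)) incl
    (fun i => (hopen i).isOpenEmbedding_subtypeVal) (by
      rintro i j ⟨_, ⟨l, z⟩, rfl⟩ ⟨_, ⟨l', z'⟩, rfl⟩ h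
      exact hdis i j l l' z z' h) (fun y => by
      obtain ⟨i, l, z, h⟩ := hcov y
      exact ⟨i, ⟨y, (l, z), h⟩, rfl⟩)
  let f' : ∀ i, PairMap (φ i) (Z i).toPair (Y.subspace (A i) (hA i)).toPair := fun i =>
    PairMap.ofMap (X := Z i) (Y := Y.subspace (A i) (hA i))
      ⟨fun z => (⟨(f i).toMap z, (1, z), one_smul _ _⟩ : A i),
        (f i).toMap.continuous.subtype_mk _⟩ fun h z => Subtype.ext ((f i).map_smul h z)
  have h2 : ∀ i, Function.Bijective (E.map (f' i) k) := fun i =>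
    hE.bijective_map_of_isQuotientMap (hφ i) (f' i) (hq i)
      (fun l l' z z' h => hfib i l l' z z' (congrArg Subtype.val h)) k
  have h3 : (fun (a : E.abs Y k) i => E.map (f i) k a) =
      (fun t i => E.map (f' i) k (t i)) ∘ fun (a : E.abs Y k) i => E.map (incl i) k a := by
    funext a i
    rw [Function.comp_apply, ← E.map_comp]
    exact congrArg (fun F : _ →+ _ => F a) (E.map_congr _ _ (fun _ => rfl) (fun _ => rfl) k)
  rw [h3]
  exact (Function.Bijective.piMap h2).comp h1

end EquivariantCohomologyTheory

end OrbitDecomposition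

/-! ## The fixed points of a balanced product -/

section BalancedFixed

open Topology

variable {G : Type u} [Group G] [TopologicalSpace G] {H : Subgroup G}

/-! ### Representatives of fixed points -/

section Mk

variable {X : GSpace H}

theorem balanced_mk_eq_iff {a b : G} {x y : X} :
    Quotient.mk (balancedSetoid H X) (a, x) = Quotient.mk (balancedSetoid H X) (b, y) ↔
      ∃ h : H, b = a * (h : G)⁻¹ ∧ y = h • x :=
  Quotient.eq.trans (exists_congr fun _ => Prod.ext_iff)

theorem balanced_mk_mul (a : G) (h : H) (x : X) :
    Quotient.mk (balancedSetoid H X) (a * h, x) = Quotient.mk (balancedSetoid H X) (a, h • x) :=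
  balanced_mk_eq_iff.2 ⟨h, by simp, rfl⟩

theorem balanced_mk_injective (a : G) :
    Function.Injective fun x : X => Quotient.mk (balancedSetoid H X) (a, x) := fun x y hxy => by
  obtain ⟨h, h1, h2⟩ := balanced_mk_eq_iff.1 hxy
  have : h = 1 := by simpa using h1
  rw [h2, this, one_smul]

variable [IsTopologicalGroup G] {n : ℕ} {σ : Fin n → G} {τ : Fin n → H}

/-- Here `σ i [a, x] = [a τ i, x] = [a, τ i x]`, and `x ↦ [a, x]` is injective. -/
theorem balanced_mk_mem_fixedSet_iff {a : G} (h : ∀ i, σ i * a = a * τ i) {x : X} :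
    Quotient.mk (balancedSetoid H X) (a, x) ∈ fixedSet σ (X.induced H) ↔ x ∈ fixedSet τ X := by
  refine forall_congr' fun i => ?_
  change Quotient.mk (balancedSetoid H X) (σ i * a, x) = _ ↔ _
  rw [h, balanced_mk_mul]
  exact (balanced_mk_injective a).eq_iff

theorem conj_mem_of_balanced_mk_mem_fixedSet {a : G} {x : X}
    (h : Quotient.mk (balancedSetoid H X) (a, x) ∈ fixedSet σ (X.induced H)) (i : Fin n) :
    a⁻¹ * σ i * a ∈ H := by
  have h1 : Quotient.mk (balancedSetoid H X) (σ i * a, x) =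
    Quotient.mk (balancedSetoid H X) (a, x) := h i
  obtain ⟨k, hk, -⟩ := balanced_mk_eq_iff.1 h1.symm
  rw [mul_assoc, hk, inv_mul_cancel_left]
  exact inv_mem k.2

end Mk

-- This supplies the intertwining hypothesis of `balanced_mk_mem_fixedSet_iff` for `a = c * g⁻¹`.
omit [TopologicalSpace G] in
theorem mul_conj_eq {n : ℕ} {σ : Fin n → G} {τ : Fin n → H} {g c : G}
    (hg : ∀ i, (τ i : G) = g * σ i * g⁻¹) (hc : c ∈ centralizerOf σ) (i : Fin n) :
    σ i * (c * g⁻¹) = c * g⁻¹ * τ i := by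
  have h := Subgroup.mem_centralizer_iff.1 hc (σ i) ⟨i, rfl⟩
  rw [hg, ← mul_assoc, h]
  group

/-! ### Double cosets -/

section DoubleCosets

variable {n : ℕ}

omit [TopologicalSpace G] in
theorem IsCommutingTorsion.conj {σ : Fin n → G} (hσ : IsCommutingTorsion σ) (a : G) :
    IsCommutingTorsion fun i => a⁻¹ * σ i * a := by
  have h : ∀ i, a⁻¹ * σ i * a = MulAut.conj a⁻¹ (σ i) := fun i => by simp
  simp only [h]
  exact ⟨fun i => MonoidHom.isOfFinOrder (MulAut.conj a⁻¹).toMonoidHom (hσ.1 i),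
    fun i j => (hσ.2 i j).map (MulAut.conj a⁻¹)⟩

omit [TopologicalSpace G] in
theorem IsCommutingTorsion.coe {τ : Fin n → H} (hτ : IsCommutingTorsion τ) :
    IsCommutingTorsion fun i => (τ i : G) :=
  ⟨fun i => H.subtype.isOfFinOrder (hτ.1 i), fun i j => (hτ.2 i j).map H.subtype⟩

omit [TopologicalSpace G] in
theorem IsCommutingTorsion.of_coe {τ : Fin n → H} (hτ : IsCommutingTorsion fun i => (τ i : G)) :
    IsCommutingTorsion τ :=
  ⟨fun i => Submonoid.isOfFinOrder_coe.1 (hτ.1 i), fun i j => Subtype.ext (hτ.2 i j)⟩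

/-- The double cosets `C_G(σ) a H` are open in the set of all `a` with `a⁻¹ σ a` in `H`. -/
theorem eventually_mem_double_coset [IsCompactLieGroup G] (hH : IsClosed (H : Set G))
    {σ : Fin n → G} (hσ : IsCommutingTorsion σ) {a : G} (ha : ∀ i, a⁻¹ * σ i * a ∈ H) :
    ∀ᶠ b in 𝓝 a, (∀ i, b⁻¹ * σ i * b ∈ H) → ∃ c ∈ centralizerOf σ, ∃ h ∈ H, b = c * a * h := by
  -- Rigidity at the identity is applied to the tuple `a⁻¹ σ a` and to `a⁻¹ * b` for `b` near `a`.
  have h1 := eventually_mem_centralizerOf_mul hH (hσ.conj a) ha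
  have h2 : Filter.Tendsto (fun b => a⁻¹ * b) (𝓝 a) (𝓝 1) := by
    have : ContinuousAt (fun b => a⁻¹ * b) a := by fun_prop
    simpa [ContinuousAt] using this
  filter_upwards [h2.eventually h1] with b hb hbσ
  obtain ⟨h, hh, hc⟩ := hb fun i => by
    have : (a⁻¹ * b)⁻¹ * (a⁻¹ * σ i * a) * (a⁻¹ * b) = b⁻¹ * σ i * b := by group
    rw [this]; exact hbσ i
  refine ⟨b * h * a⁻¹, Subgroup.mem_centralizer_iff.2 ?_, h⁻¹, inv_mem hh, by group⟩
  rintro _ ⟨i, rfl⟩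
  have h3 := Subgroup.mem_centralizer_iff.1 hc _ ⟨i, rfl⟩
  have h4 := congrArg (fun z => a * z * a⁻¹) h3
  simp only [mul_assoc, mul_inv_cancel_left, mul_inv_cancel, mul_one] at h4
  simpa only [mul_assoc] using h4

variable {SG : Set (Fin n → G)} (hSG : IsConjugacyRepresentatives SG)
  {SH : Set (Fin n → H)} (hSH : IsConjugacyRepresentatives SH) {s : SH → SG} {g : SH → G}
  (hg : ∀ (τ : SH) (i : Fin n), (τ.1 i : G) = g τ * (s τ).1 i * (g τ)⁻¹)
include hSG hSH hg

-- The tuple `a⁻¹ σ a` lies in `H`, and `τ` is the representative of its `H`-class. As `τ` is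
-- `G`-conjugate to `σ`, uniqueness gives `s τ = σ`; two elements that conjugate `σ` to `τ` differ
-- by an element of `C_G(σ)`.
omit [TopologicalSpace G] in
theorem exists_double_coset_rep {σ : SG} {a : G} (ha : ∀ i, a⁻¹ * σ.1 i * a ∈ H) :
    ∃ τ : SH, s τ = σ ∧ ∃ c ∈ centralizerOf σ.1, ∃ h ∈ H, a = c * (g τ)⁻¹ * h := by
  have hσ := hSG.isCommutingTorsion σ.1 σ.2
  obtain ⟨τ, ⟨hτ, h, hh⟩, -⟩ := hSH.existsUnique (fun i => ⟨_, ha i⟩) (hσ.conj a).of_coe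
  have hh' : ∀ i, a⁻¹ * σ.1 i * a = h * τ i * (h : G)⁻¹ := fun i => congrArg Subtype.val (hh i)
  have hτσ : ∀ i, (τ i : G) = (h : G)⁻¹ * a⁻¹ * σ.1 i * ((h : G)⁻¹ * a⁻¹)⁻¹ := fun i => by
    have h1 : (τ i : G) = (h : G)⁻¹ * (a⁻¹ * σ.1 i * a) * h := by rw [hh']; group
    rw [h1]; group
  have hs : s ⟨τ, hτ⟩ = σ := Subtype.ext
    ((hSG.existsUnique _ (hSH.isCommutingTorsion τ hτ).coe).unique
      ⟨(s ⟨τ, hτ⟩).2, g ⟨τ, hτ⟩, hg ⟨τ, hτ⟩⟩ ⟨σ.2, _, hτσ⟩)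
  refine ⟨⟨τ, hτ⟩, hs, a * h * g ⟨τ, hτ⟩, Subgroup.mem_centralizer_iff.2 ?_, (h : G)⁻¹,
    inv_mem h.2, by group⟩
  rintro _ ⟨i, rfl⟩
  have h1 := hg ⟨τ, hτ⟩ i
  rw [hs] at h1
  have h2 := h1.symm.trans (hτσ i)
  have h3 := congrArg (fun z => a * h * z * g ⟨τ, hτ⟩) h2
  simp only [mul_assoc, inv_mul_cancel, mul_one, mul_inv_rev, inv_inv, mul_inv_cancel_left] at h3
  simpa only [mul_assoc] using h3.symm

-- Both `c * (g τ)⁻¹` and `c' * (g τ')⁻¹` intertwine `σ` with the respective tuple and differ by `h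
-- * h'⁻¹`, which hence conjugates `τ'` to `τ` within `H`.
omit [TopologicalSpace G] hSG in
theorem eq_of_double_coset_eq {σ : SG} {τ τ' : SH} (hτ : s τ = σ) (hτ' : s τ' = σ) {c c' h h' : G}
    (hc : c ∈ centralizerOf σ.1) (hc' : c' ∈ centralizerOf σ.1) (hh : h ∈ H) (hh' : h' ∈ H)
    (heq : c * (g τ)⁻¹ * h = c' * (g τ')⁻¹ * h') : τ = τ' := by
  have h1 : ∀ i, (τ.1 i : G) = g τ * σ.1 i * (g τ)⁻¹ := fun i => by rw [← hτ]; exact hg τ i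
  have h1' : ∀ i, (τ'.1 i : G) = g τ' * σ.1 i * (g τ')⁻¹ := fun i => by rw [← hτ']; exact hg τ' i
  have key : ∀ i, (τ.1 i : G) = (h * h'⁻¹) * τ'.1 i * (h * h'⁻¹)⁻¹ := fun i => by
    have e1 := mul_conj_eq h1 hc i
    have e2 := mul_conj_eq h1' hc' i
    have e3 : c' * (g τ')⁻¹ = c * (g τ)⁻¹ * (h * h'⁻¹) := by
      rw [← mul_assoc, heq]; group
    rw [e3, ← mul_assoc, e1] at e2
    have e4 : (τ.1 i : G) * (h * h'⁻¹) = h * h'⁻¹ * τ'.1 i :=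
      mul_left_cancel (a := c * (g τ)⁻¹) (by simpa only [mul_assoc] using e2)
    exact eq_mul_inv_of_mul_eq e4
  refine Subtype.ext ((hSH.existsUnique τ.1 (hSH.isCommutingTorsion τ.1 τ.2)).unique
    ⟨τ.2, 1, fun i => by simp⟩ ⟨τ'.2, ⟨h * h'⁻¹, mul_mem hh (inv_mem hh')⟩, fun i => ?_⟩)
  exact Subtype.ext (key i)

/-- Sending `a ∈ N` to the `τ` of its double coset is locally constant by rigidity, and surjective
because `(g τ)⁻¹` goes to `τ`. A locally constant map on a compact space has finite range. -/
theorem finite_reps [IsCompactLieGroup G] (hH : IsClosed (H : Set G)) (σ : SG) :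
    Finite {τ : SH // s τ = σ} := by
  have hσ := hSG.isCommutingTorsion σ.1 σ.2
  let N : Set G := {a | ∀ i, a⁻¹ * σ.1 i * a ∈ H}
  have hN : IsClosed N := by
    have : N = ⋂ i, (fun a => a⁻¹ * σ.1 i * a) ⁻¹' H := by ext; simp [N]
    rw [this]
    exact isClosed_iInter fun i => hH.preimage (by fun_prop)
  have hNc : CompactSpace N := isCompact_iff_compactSpace.1 hN.isCompact
  choose t ht c hc h hh hch using fun a : N => exists_double_coset_rep hSG hSH hg (σ := σ) a.2
  let t' : N → {τ : SH // s τ = σ} := fun a => ⟨t a, ht a⟩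
  have hloc : IsLocallyConstant t' := (IsLocallyConstant.iff_eventually_eq _).2 fun a => by
    have h1 := continuous_subtype_val.continuousAt.eventually
      (eventually_mem_double_coset hH hσ (a := a.1) a.2)
    filter_upwards [h1] with b hb
    obtain ⟨c', hc', h', hh', hab⟩ := hb b.2
    have h2 : b.1 = c' * c a * (g (t a))⁻¹ * (h a * h') := by
      rw [hab, hch a]
      group
    exact Subtype.ext (eq_of_double_coset_eq hSH hg (ht b) (ht a) (hc b)
      (mul_mem hc' (hc a)) (hh b) (mul_mem (hh a) hh') ((hch b).symm.trans h2))
  have hsurj : Function.Surjective t' := fun τ => by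
    have h1 : ∀ i, (τ.1.1 i : G) = g τ.1 * σ.1 i * (g τ.1)⁻¹ := fun i => by
      have := hg τ.1 i
      rwa [τ.2] at this
    have hmem : (g τ.1)⁻¹ ∈ N := fun i => by
      rw [inv_inv, ← h1]; exact (τ.1.1 i).2
    exact ⟨⟨_, hmem⟩, Subtype.ext (eq_of_double_coset_eq hSH hg (ht _) τ.2 (hc _) (one_mem _)
      (hh _) (one_mem _) ((hch ⟨_, hmem⟩).symm.trans (by simp)))⟩
  have := hloc.range_finite
  rw [hsurj.range_eq] at this
  exact Set.finite_univ_iff.1 this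

end DoubleCosets

end BalancedFixed

/-! ## The components of the change-of-group map -/

/-- Relations on both sides are indexed by `ℤⁿ`, and the homomorphism matches the relations with
equal exponents. An element of the kernel gives a relation over `σ`; the one over `τ` with the same
exponents is the element itself, as conjugation and `φ` are injective. -/
theorem lambdaHom_injective {H G : Type u} [Group H] [TopologicalSpace H] [Group G]
    [TopologicalSpace G] [IsTopologicalGroup H] [IsTopologicalGroup G] {n : ℕ} {φ : H →ₜ* G}
    (hφ : Function.Injective φ) {τ : Fin n → H} {σ : Fin n → G}
    (hτ : ∀ i j, Commute (τ i) (τ j)) (hσ : ∀ i j, Commute (σ i) (σ j)) {g : G}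
    (hg : ∀ i, φ (τ i) = g * σ i * g⁻¹) : Function.Injective (lambdaHom φ τ σ g hg) := by
  refine (injective_iff_map_eq_one _).2 ?_
  rintro ⟨u, t⟩ hut
  obtain ⟨v, hv⟩ : ∃ v : centralizerOf σ, (v : G) = g⁻¹ * φ u * g ∧ (v, t) ∈ lambdaRel σ :=
    ⟨_, rfl, (QuotientGroup.eq_one_iff _).1 hut⟩
  rw [← range_lambdaRelHom hσ] at hv
  obtain ⟨hv, k, hk⟩ := hv
  have key : (centralizerOf σ).subtype.comp ((MonoidHom.fst _ _).comp (lambdaRelHom hσ)) =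
      (MulAut.conj g⁻¹).toMonoidHom.comp (φ.toMonoidHom.comp
        ((centralizerOf τ).subtype.comp ((MonoidHom.fst _ _).comp (lambdaRelHom hτ)))) :=
    MonoidHom.pi_ext fun i x => by
      change ((lambdaRelHom hσ (Pi.mulSingle i x)).1 : G) =
        MulAut.conj g⁻¹ (φ (lambdaRelHom hτ (Pi.mulSingle i x)).1)
      rw [lambdaRelHom, MonoidHom.noncommPiCoprod_mulSingle, lambdaRelHom,
        MonoidHom.noncommPiCoprod_mulSingle]
      change ((lambdaGen hσ i ^ x.toAdd).1 : G) = MulAut.conj g⁻¹ (φ (lambdaGen hτ i ^ x.toAdd).1)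
      have h1 : σ i = MulAut.conj g⁻¹ (φ (τ i)) := by rw [hg]; simp [mul_assoc]
      simp only [Prod.pow_fst, SubgroupClass.coe_zpow, map_zpow]
      exact congrArg (· ^ x.toAdd) h1
  refine (QuotientGroup.eq_one_iff _).2 (range_lambdaRelHom hτ ▸ ⟨k, Prod.ext (Subtype.ext ?_) ?_⟩)
  · have h1 : ((lambdaRelHom hσ k).1 : G) = MulAut.conj g⁻¹ (φ (lambdaRelHom hτ k).1) :=
      congrArg (fun F => F k) key
    rw [hk, hv] at h1
    refine hφ ((MulAut.conj g⁻¹).injective (h1.symm.trans ?_))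
    simp
  · have h2 := congrArg Prod.snd hk
    rw [lambdaRelHom_snd] at h2 ⊢
    exact h2

/-! ### The part of the fixed points that belongs to one `τ` -/

section Component

open Topology

variable {G : Type u} [Group G] [TopologicalSpace G] [IsTopologicalGroup G] {H : Subgroup G}
  {X : GSpace H} {n : ℕ} {τ : Fin n → H} {σ : Fin n → G} {g : G}
  (hg : ∀ i, (τ i : G) = g * σ i * g⁻¹)

variable (X) in
/-- The map `X^τ → (G ×_H X)^σ`, `x ↦ g⁻¹ [e, x]`, over `Λ_H(τ) → Λ_G(σ)`. -/
def fixedUnit : PairMap ((lambdaHom (subgroupIncl H) τ σ g hg).comp (ContinuousMonoidHom.id _))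
    (X.fixed τ).toPair ((X.induced H).fixed σ).toPair :=
  (fixedTranslate (subgroupIncl H) τ σ g hg (X.induced H)).comp
    (PairMap.ofMap (fixedMap (inducedUnit H X) (inducedUnit_smul H X) τ)
      (fixedMap_smul (inducedUnit H X) (inducedUnit_smul H X) τ))

theorem coe_orbitMap_fixedUnit (c : centralizerOf σ) (t : Multiplicative (Fin n → ℝ))
    (x : fixedSet τ X) :
    ((fixedUnit X hg).orbitMap (QuotientGroup.mk (c, t), x) : fixedSet σ (X.induced H)).1 =
      Quotient.mk (balancedSetoid H X) (c * g⁻¹, x.1) := by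
  change Quotient.mk (balancedSetoid H X) (c * (g⁻¹ * 1), x.1) = _
  rw [mul_one]

theorem mem_range_orbitMap_fixedUnit_iff (y : fixedSet σ (X.induced H)) :
    y ∈ Set.range (fixedUnit X hg).orbitMap ↔ ∃ c ∈ centralizerOf σ, ∃ x ∈ fixedSet τ X,
      y.1 = Quotient.mk (balancedSetoid H X) (c * g⁻¹, x) := by
  constructor
  · rintro ⟨⟨⟨c, t⟩, x⟩, rfl⟩
    exact ⟨c, c.2, x.1, x.2, coe_orbitMap_fixedUnit hg c t x⟩
  · rintro ⟨c, hc, x, hx, h⟩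
    exact ⟨(QuotientGroup.mk (⟨c, hc⟩, 1), ⟨x, hx⟩),
      Subtype.ext ((coe_orbitMap_fixedUnit hg ⟨c, hc⟩ 1 ⟨x, hx⟩).trans h.symm)⟩

/-- Membership depends only on the double coset of `a`, so openness of the part reduces to openness
of double cosets. -/
theorem mk_mem_range_orbitMap_fixedUnit_iff {a : G} {x : X}
    (h : Quotient.mk (balancedSetoid H X) (a, x) ∈ fixedSet σ (X.induced H)) :
    (⟨_, h⟩ : fixedSet σ (X.induced H)) ∈ Set.range (fixedUnit X hg).orbitMap ↔
      ∃ c ∈ centralizerOf σ, ∃ k ∈ H, a = c * g⁻¹ * k := by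
  rw [mem_range_orbitMap_fixedUnit_iff]
  constructor
  · rintro ⟨c, hc, y, -, hy⟩
    obtain ⟨k, hk, -⟩ := balanced_mk_eq_iff.1 hy
    exact ⟨c, hc, k, k.2, by rw [hk]; simp⟩
  · rintro ⟨c, hc, k, hk, rfl⟩
    have h1 := balanced_mk_mul (c * g⁻¹) ⟨k, hk⟩ x
    refine ⟨c, hc, (⟨k, hk⟩ : H) • x, ?_, h1⟩
    refine (balanced_mk_mem_fixedSet_iff (mul_conj_eq hg hc)).1 ?_
    rw [← h1]
    exact h

/-- The element `k` of `H` relating the two representatives centralizes `τ`, because both `c * g⁻¹`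
and `c' * g⁻¹` intertwine `σ` and `τ`. The vectors `t` and `t'` act trivially, so their difference
can be put into the element of `Λ_H(τ)`. -/
theorem exists_of_orbitMap_fixedUnit_eq (l l' : LambdaGroup σ) (x x' : X.fixed τ)
    (h : (fixedUnit X hg).orbitMap (l, x) = (fixedUnit X hg).orbitMap (l', x')) :
    ∃ k : LambdaGroup τ, l' = l * (lambdaHom (subgroupIncl H) τ σ g hg k)⁻¹ ∧ x' = k • x := by
  obtain ⟨c, t⟩ := l
  obtain ⟨c', t'⟩ := l'
  obtain ⟨x, hx⟩ : fixedSet τ X := x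
  obtain ⟨x', hx'⟩ : fixedSet τ X := x'
  have h1 := (coe_orbitMap_fixedUnit hg c t ⟨x, hx⟩).symm.trans
    ((congrArg Subtype.val h).trans (coe_orbitMap_fixedUnit hg c' t' ⟨x', hx'⟩))
  obtain ⟨k, hk, rfl⟩ := balanced_mk_eq_iff.1 h1
  have hkc : k ∈ centralizerOf τ := by
    refine Subgroup.mem_centralizer_iff.2 ?_
    rintro _ ⟨i, rfl⟩
    have e1 := mul_conj_eq hg c.2 i
    have e2 := mul_conj_eq hg c'.2 i
    rw [hk, ← mul_assoc, e1] at e2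
    have e3 : (τ i : G) * (k : G)⁻¹ = (k : G)⁻¹ * τ i :=
      mul_left_cancel (a := (c : G) * g⁻¹) (by simpa only [mul_assoc] using e2)
    refine Subtype.ext ?_
    change (τ i : G) * k = k * τ i
    rw [eq_inv_mul_iff_mul_eq, ← mul_assoc] at e3
    exact (mul_inv_eq_iff_eq_mul.1 e3).symm
  refine ⟨QuotientGroup.mk (⟨k, hkc⟩, t * t'⁻¹), ?_, rfl⟩
  refine congrArg (QuotientGroup.mk (s := lambdaRel σ)) (Prod.ext (Subtype.ext ?_) ?_)
  · change (c' : G) = c * (g⁻¹ * k * g)⁻¹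
    have : (c' : G) = c * g⁻¹ * (k : G)⁻¹ * g := by rw [← hk]; group
    rw [this]; group
  · change t' = t * (t * t'⁻¹)⁻¹
    simp

end Component

/-! ### Openness and quotient topology of the parts -/

section ComponentTopology

open Topology

variable {G : Type u} [Group G] [TopologicalSpace G] [IsCompactLieGroup G] {H : Subgroup G}
  (hH : IsClosed (H : Set G)) {X : GSpace H} {n : ℕ} {τ : Fin n → H} {σ : Fin n → G} {g : G}
  (hg : ∀ i, (τ i : G) = g * σ i * g⁻¹)
include hH

theorem isOpen_range_orbitMap_fixedUnit (hσ : IsCommutingTorsion σ) :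
    IsOpen (Set.range (fixedUnit X hg).orbitMap) := by
  have hq := ((isOpenQuotientMap_balanced H X).restrictPreimage
    (fixedSet σ (X.induced H))).isQuotientMap
  refine hq.isOpen_preimage.1 (isOpen_iff_eventually.2 ?_)
  rintro ⟨⟨a, x⟩, hax⟩ hmem
  obtain ⟨c, hc, k, hk, hac⟩ := (mk_mem_range_orbitMap_fixedUnit_iff hg hax).1 hmem
  have h1 := eventually_mem_double_coset hH hσ (conj_mem_of_balanced_mk_mem_fixedSet hax)
  have h2 : ContinuousAt (fun p : Quotient.mk (balancedSetoid H X) ⁻¹' fixedSet σ (X.induced H) =>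
    p.1.1) ⟨(a, x), hax⟩ := (continuous_fst.comp continuous_subtype_val).continuousAt
  filter_upwards [h2.eventually h1]
  rintro ⟨⟨b, y⟩, hby⟩ hb
  obtain ⟨c', hc', k', hk', hbc⟩ := hb (conj_mem_of_balanced_mk_mem_fixedSet hby)
  refine (mk_mem_range_orbitMap_fixedUnit_iff hg hby).2
    ⟨c' * c, mul_mem hc' hc, k * k', mul_mem hk hk', ?_⟩
  change b = c' * a * k' at hbc
  rw [hbc, hac]
  group

/-- The part `R` is a quotient of its preimage in `G × X`, because the projection is open. That
preimage is a quotient of its preimage under `j`, a closed map because `C_G(σ) × H` is compact. The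
composite factors through the orbit map, which is therefore a quotient map. -/
theorem isQuotientMap_orbitMap_fixedUnit :
    IsQuotientMap (Set.rangeFactorization (fixedUnit X hg).orbitMap) := by
  have := isCompact_iff_compactSpace.1 hH.isCompact
  have := isCompact_iff_compactSpace.1 (isClosed_centralizerOf σ).isCompact
  let mk := Quotient.mk (balancedSetoid H X)
  -- `m (c, k) = c g⁻¹ k` is proper, hence so is `j (c, k, x) = (c g⁻¹ k, k⁻¹ x)`
  let j : centralizerOf σ × H × X → G × X := fun p => (p.1 * g⁻¹ * p.2.1, p.2.1⁻¹ • p.2.2)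
  have hj : IsClosedMap j := by
    let e : centralizerOf σ × H × X ≃ₜ (centralizerOf σ × H) × X :=
      { toFun := fun p => ((p.1, p.2.1), p.2.1⁻¹ • p.2.2)
        invFun := fun p => (p.1.1, p.1.2, p.1.2 • p.2)
        left_inv := fun p => by simp
        right_inv := fun p => by simp
        continuous_toFun := by fun_prop
        continuous_invFun := by fun_prop }
    have hm : IsProperMap fun p : centralizerOf σ × H => (p.1 : G) * g⁻¹ * p.2 :=
      Continuous.isProperMap (by fun_prop)
    exact (hm.prodMap isProperMap_id).isClosedMap.comp e.isClosedMap
  let R : Set (BalancedProduct H X) := {b | ∃ c ∈ centralizerOf σ, ∃ x ∈ fixedSet τ X,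
    b = mk (c * g⁻¹, x)}
  have hjmk : ∀ p, mk (j p) = mk (p.1 * g⁻¹, p.2.2) := fun p => by
    rw [← smul_inv_smul p.2.1 p.2.2]
    exact balanced_mk_mul _ _ _
  have hjR : ∀ p, mk (j p) ∈ R → p.2.2 ∈ fixedSet τ X := by
    rintro p ⟨c, hc, x, hx, h⟩
    rw [hjmk] at h
    refine (balanced_mk_mem_fixedSet_iff (mul_conj_eq hg p.1.2)).1 ?_
    change mk (p.1 * g⁻¹, p.2.2) ∈ _
    rw [h]
    exact (balanced_mk_mem_fixedSet_iff (mul_conj_eq hg hc)).2 hx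
  have h1 : IsQuotientMap (R.restrictPreimage mk) :=
    ((isOpenQuotientMap_balanced H X).restrictPreimage R).isQuotientMap
  have h2 : IsQuotientMap ((mk ⁻¹' R).restrictPreimage j) := by
    refine (hj.restrictPreimage _).isQuotientMap ?_ ?_
    · exact Continuous.restrictPreimage (by fun_prop)
    · rintro ⟨⟨a, x⟩, c, hc, y, hy, h⟩
      obtain ⟨k, hk, rfl⟩ := balanced_mk_eq_iff.1 h
      have hp : j (⟨c, hc⟩, k, k • x) = (a, x) := by
        refine Prod.ext ?_ (inv_smul_smul _ _)
        change c * g⁻¹ * k = a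
        rw [hk]; simp
      exact ⟨⟨(⟨c, hc⟩, k, k • x), by
        change mk (j _) ∈ R
        rw [hp]; exact ⟨c, hc, _, hy, h⟩⟩, Subtype.ext hp⟩
  have hR : ∀ b ∈ R, b ∈ fixedSet σ (X.induced H) := by
    rintro _ ⟨c, hc, x, hx, rfl⟩
    exact (balanced_mk_mem_fixedSet_iff (mul_conj_eq hg hc)).2 hx
  let e : R ≃ₜ Set.range (fixedUnit X hg).orbitMap :=
    { toFun := fun b => ⟨(⟨b.1, hR b.1 b.2⟩ : fixedSet σ (X.induced H)),
        (mem_range_orbitMap_fixedUnit_iff hg _).2 b.2⟩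
      invFun := fun y => ⟨(show fixedSet σ (X.induced H) from y.1).1,
        (mem_range_orbitMap_fixedUnit_iff hg _).1 y.2⟩
      left_inv := fun _ => rfl
      right_inv := fun _ => rfl
      continuous_toFun :=
        continuous_induced_rng.2 (continuous_induced_rng.2 continuous_subtype_val)
      continuous_invFun := Continuous.subtype_mk
        (Continuous.comp (Y := (X.induced H).fixed σ) continuous_induced_dom
          continuous_subtype_val) _ }
  -- The factor `k` and the vector coordinate play no role in the point of `R`, so `k` is dropped
  -- and the vector is taken to be zero.
  let r : j ⁻¹' (mk ⁻¹' R) → LambdaGroup σ × X.fixed τ := fun p =>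
    (QuotientGroup.mk (p.1.1, 1), (⟨p.1.2.2, hjR p.1 p.2⟩ : fixedSet τ X))
  have hr : Continuous r := by
    refine Continuous.prodMk (QuotientGroup.continuous_mk.comp (by fun_prop)) ?_
    exact Continuous.subtype_mk (by fun_prop) _
  have hcont : Continuous (fixedUnit X hg).orbitMap :=
    continuous_fst.smul ((fixedUnit X hg).toMap.continuous.comp continuous_snd)
  have h3 : Set.rangeFactorization (fixedUnit X hg).orbitMap ∘ r =
      e ∘ R.restrictPreimage mk ∘ (mk ⁻¹' R).restrictPreimage j := funext fun p =>
    Subtype.ext (Subtype.ext ((coe_orbitMap_fixedUnit hg p.1.1 1 ⟨p.1.2.2, hjR p.1 p.2⟩).trans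
      (hjmk p.1).symm))
  refine IsQuotientMap.of_comp hr hcont.rangeFactorization ?_
  rw [h3]
  exact e.isQuotientMap.comp (h1.comp h2)

end ComponentTopology

/-! ### Assembly of the isomorphism -/

namespace EquivariantCohomologyTheory

variable {E : EquivariantCohomologyTheory.{u, v}} {n : ℕ} {G : Type u} [Group G]
  [TopologicalSpace G] [IsCompactLieGroup G] {H : Subgroup G} (hH : IsClosed (H : Set G))
  (X : GSpace H) {SG : Set (Fin n → G)} (hSG : IsConjugacyRepresentatives SG)
  {SH : Set (Fin n → H)} (hSH : IsConjugacyRepresentatives SH) {s : SH → SG} {g : SH → G}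
  (hg : ∀ (τ : SH) (i : Fin n), (τ.1 i : G) = g τ * (s τ).1 i * (g τ)⁻¹)
include hH hSG hSH

/-- Each component is a single induced map of `E`, since `fixedUnit` is the composite that occurs in
the definition. Bijectivity and multiplicativity are both read off from this form. -/
theorem quasiChangeOfGroup_apply (k : ℤ) (a : E.Quasi SG (X.induced H) k) (τ : SH) :
    E.quasiChangeOfGroup H SH SG s g hg X k a τ = E.map (fixedUnit X (hg τ)) k (a (s τ)) := by
  have := IsCompactLieGroup.subgroup hH
  have := isCompactLieGroup_lambdaGroup (hSG.isCommutingTorsion _ (s τ).2).2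
  have := isCompactLieGroup_lambdaGroup (hSH.isCommutingTorsion _ τ.2).2
  exact (E.map_comp _ _ k _).symm

-- The parts for the `τ` over `σ` are open, finite in number, disjoint and cover the fixed points,
-- and each is a balanced product. The hypothesis `hg'` restates `hg` with `σ` in place of `s τ`, so
-- that all maps have the same target.
include hg in
theorem HasChangeOfGroup.bijective_pi_fixedUnit (hE : E.HasChangeOfGroup) (k : ℤ) (σ : SG)
    (hg' : ∀ (τ : {τ : SH // s τ = σ}) (i : Fin n), (τ.1.1 i : G) = g τ * σ.1 i * (g τ)⁻¹) :
    Function.Bijective fun (a : E.abs ((X.induced H).fixed σ.1) k) (τ : {τ : SH // s τ = σ}) =>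
      E.map (fixedUnit X (hg' τ)) k a := by
  have := IsCompactLieGroup.subgroup hH
  have hσ := hSG.isCommutingTorsion _ σ.2
  have := isCompactLieGroup_lambdaGroup hσ.2
  have := fun τ : {τ : SH // s τ = σ} =>
    isCompactLieGroup_lambdaGroup (hSH.isCommutingTorsion _ τ.1.2).2
  have := finite_reps hSG hSH hg hH σ
  refine hE.bijective_pi (fun τ => ?_) (fun τ => fixedUnit X (hg' τ))
    (fun τ => isOpen_range_orbitMap_fixedUnit hH (hg' τ) hσ)
    (fun τ => isQuotientMap_orbitMap_fixedUnit hH (hg' τ))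
    (fun τ => exists_of_orbitMap_fixedUnit_eq (hg' τ)) ?_ ?_ k
  · exact lambdaHom_injective (φ := subgroupIncl H) Subtype.val_injective
      (hSH.isCommutingTorsion _ τ.1.2).2 hσ.2 (hg' τ)
  · rintro τ τ' ⟨c, t⟩ ⟨c', t'⟩ x x' h
    have h1 := (coe_orbitMap_fixedUnit (hg' τ) c t x).symm.trans
      ((congrArg Subtype.val h).trans (coe_orbitMap_fixedUnit (hg' τ') c' t' x'))
    obtain ⟨k, hk, -⟩ := balanced_mk_eq_iff.1 h1
    exact Subtype.ext (eq_of_double_coset_eq hSH hg τ.2 τ'.2 c.2 c'.2 (inv_mem k.2) (one_mem _)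
      (by rw [← hk, mul_one]))
  · rintro ⟨⟨a, x⟩, hax⟩
    obtain ⟨τ, hτ, h⟩ := exists_double_coset_rep hSG hSH hg
      (conj_mem_of_balanced_mk_mem_fixedSet (X := X) hax)
    obtain ⟨⟨l, z⟩, h1⟩ := (mk_mem_range_orbitMap_fixedUnit_iff (hg' ⟨τ, hτ⟩) hax).2 h
    exact ⟨⟨τ, hτ⟩, l, z, h1⟩

/-- The index set `SH` is the disjoint union of the fibres of `s`, and the map is the product of the
isomorphisms over the single `σ`. An empty fibre means that the fixed points are empty and the
factor of `σ` vanishes. -/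
theorem HasChangeOfGroup.bijective_quasiChangeOfGroup (hE : E.HasChangeOfGroup) (k : ℤ) :
    Function.Bijective (E.quasiChangeOfGroup H SH SG s g hg X k) := by
  have hg' : ∀ (σ : SG) (τ : {τ : SH // s τ = σ}) (i : Fin n),
      (τ.1.1 i : G) = g τ * σ.1 i * (g τ)⁻¹ := by
    rintro _ ⟨τ, rfl⟩ i
    exact hg τ i
  have h := fun σ => hE.bijective_pi_fixedUnit hH X hSG hSH hg k σ (hg' σ)
  constructor
  · intro a b hab
    refine funext fun σ => (h σ).1 (funext ?_)
    rintro ⟨τ, rfl⟩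
    have h1 := congrFun hab τ
    rwa [quasiChangeOfGroup_apply hH X hSG hSH hg, quasiChangeOfGroup_apply hH X hSG hSH hg] at h1
  · intro b
    choose a ha using fun σ => (h σ).2 fun τ => b τ.1
    refine ⟨a, funext fun τ => ?_⟩
    rw [quasiChangeOfGroup_apply hH X hSG hSH hg]
    exact congrFun (ha (s τ)) ⟨τ, rfl⟩

end EquivariantCohomologyTheory

theorem mainTheorem5 (E : EquivariantCohomologyTheory.{u, v}) (hE : E.HasChangeOfGroup)
    (n : ℕ) (hn : 0 < n)
    (G : Type u) [Group G] [TopologicalSpace G] [IsCompactLieGroup G]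
    (H : Subgroup G) (hH : IsClosed (H : Set G)) (X : GSpace H)
    (SG : Set (Fin n → G)) (hSG : IsConjugacyRepresentatives SG)
    (SH : Set (Fin n → H)) (hSH : IsConjugacyRepresentatives SH)
    (s : SH → SG) (g : SH → G)
    (hg : ∀ (τ : SH) (i : Fin n), (τ.1 i : G) = g τ * (s τ).1 i * (g τ)⁻¹) :
    (∀ k : ℤ, Function.Bijective (E.quasiChangeOfGroup H SH SG s g hg X k)) ∧
    (∀ R : E.RingStructure,
      E.quasiChangeOfGroup H SH SG s g hg X 0 (R.quasiOne SG (X.induced H)) = R.quasiOne SH X ∧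
      ∀ {k l m : ℤ} (h : k + l = m) (a : E.Quasi SG (X.induced H) k)
        (b : E.Quasi SG (X.induced H) l),
        E.quasiChangeOfGroup H SH SG s g hg X m (R.quasiMul SG (X.induced H) h a b) =
          R.quasiMul SH X h (E.quasiChangeOfGroup H SH SG s g hg X k a)
            (E.quasiChangeOfGroup H SH SG s g hg X l b)) := by
  refine ⟨hE.bijective_quasiChangeOfGroup hH X hSG hSH hg, fun R => ?_⟩
  have := IsCompactLieGroup.subgroup hH
  have := fun σ : SG => isCompactLieGroup_lambdaGroup (hSG.isCommutingTorsion _ σ.2).2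
  have := fun τ : SH => isCompactLieGroup_lambdaGroup (hSH.isCommutingTorsion _ τ.2).2
  refine ⟨funext fun τ => ?_, fun h a b => funext fun τ => ?_⟩
  · rw [EquivariantCohomologyTheory.quasiChangeOfGroup_apply hH X hSG hSH hg]
    exact R.map_one _
  · rw [EquivariantCohomologyTheory.quasiChangeOfGroup_apply hH X hSG hSH hg]
    refine (R.map_mul _ h _ _).trans ?_
    rw [← EquivariantCohomologyTheory.quasiChangeOfGroup_apply hH X hSG hSH hg,
      ← EquivariantCohomologyTheory.quasiChangeOfGroup_apply hH X hSG hSH hg]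
    rfl
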